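/- **Theorem 3.1.** Let $d$ be a dimension. For a smooth Riemannian metric $g=(g_{ij})$ on $\mathbb R^d$, let $(g^{ij})$ be the inverse matrix, let $$\Gamma^n_{ij}=\tfrac12\sum_m g^{nm}\bigl(\partial_i g_{mj}+\partial_j g_{mi}-\partial_m g_{ij}\bigr)$$ be its Christoffel symbols, and let $R_{ijkl}=\langle R(\partial_i,\partial_j)\partial_k,\partial_l\rangle$ be its Riemann curvature tensor. Let $\gamma(t,y,w)\in\mathbb R^d$ denote the geodesic of $g$ with initial position $y$ and initial velocity $w$, that is, $$\partial_t^2\gamma^n=-\sum_{i,j}\Gamma^n_{ij}(\gamma)\,\dot\gamma^i\dot\gamma^j,\qquad \gamma(0,y,w)=y,\quad \dot\gamma(0,y,w)=w,\qquad \dot\gamma=\partial_t\gamma .$$ There are constants $c_0>0$ and $A$, depending only on $d$, and for every family of constants $(C_\beta)$, indexed by the multi-indices $\beta\in\mathbb N^d$, there are constants $C_{\alpha,\beta}$, depending only on $d$ and $(C_\beta)$, such that the following holds for all $0<c_d\le c_0$ and all $M\ge 1$. Let $g$ be a smooth Riemannian metric on $\mathbb R^d$ that satisfies $$\sup_{ijkl}\|R_{ijkl}\|_{L^\infty}+\sup_{ij}\|g_{ij}-\delta_{ij}\|_{\mathrm{Lip}}+\sup_{ijkl}\|\partial_k\partial_l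 g_{ij}\|_{BMO}\le c_d$$ (where $\|f\|_{\mathrm{Lip}}$ is $\|f\|_{L^\infty}$ plus the Lipschitz constant of $f$, and the $BMO$ seminorm is taken over balls) and, for all $i,j,k,l$, $$\|\partial_x^\beta g^{ij}\|_{L^\infty}\le C_\beta M^{|\beta|-1}\quad(|\beta|\ge1),\qquad \|\partial_x^\beta R_{ijkl}\|_{L^\infty}\le C_\beta M^{|\beta|}\quad(|\beta|\ge0).$$ Then $\gamma(t,y,w)$ exists for all $(t,y,w)\in\mathbb R\times\mathbb R^d\times\mathbb R^d$ and is a $C^\infty$ function of $(t,y,w)$, and for all $t,y,w$ with $|t|\le1$ and $\frac12\le|w|\le2$: $$|\partial_y\gamma-\mathrm I|+|\partial_y\dot\gamma|+|\partial_w\dot\gamma-\mathrm I|\le A\,c_d,\qquad |\partial_w\gamma-t\,\mathrm I|\le A\,c_d\,|t|,$$ $$|\partial_y^\beta\partial_w^\alpha\gamma|+|\partial_y^\beta\partial_w^\alpha\dot\gamma|\le C_{\alpha,\beta}\,M^{|\alpha|+|\beta|-1}\qquad\text{if }|\alpha|+|\beta|\ge1,$$ $$|\partial_y^\beta\partial_w^\alpha\gamma|\le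 C_{\alpha,\beta}\,|t|\,M^{|\alpha|+|\beta|-1}\qquad\text{if }|\alpha|\ge1\text{ or }|\beta|\ge2 .$$ -/

import Mathlib

open MeasureTheory
open scoped ContDiff ENNReal

noncomputable section

namespace GeodFlow

/-- Euclidean space `ℝ^d` with its Euclidean norm. -/
abbrev Sp (d : ℕ) : Type := EuclideanSpace ℝ (Fin d)

/-- Multi-indices in `d` variables. -/
abbrev MIdx (d : ℕ) : Type := Fin d → ℕ

/-- The order `|β|` of a multi-index. -/
def MIdx.order {d : ℕ} (β : MIdx d) : ℕ := ∑ i, β i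

section Calculus

variable {d : ℕ} {F : Type*} [NormedAddCommGroup F] [NormedSpace ℝ F]

/-- The partial derivative `∂_i f`. -/
def pd (i : Fin d) (f : Sp d → F) : Sp d → F :=
  fun x => fderiv ℝ f x (EuclideanSpace.single i 1)

/-- The iterated partial derivative `∂^β f = ∂_1^{β_1} ⋯ ∂_d^{β_d} f`. -/
def multiPd (β : MIdx d) (f : Sp d → F) : Sp d → F :=
  (List.finRange d).foldr (fun i u => (pd i)^[β i] u) f

/-- The mixed derivative `∂_y^β ∂_w^α Φ(y, w)`. -/
def mixedPd (β α : MIdx d) (Φ : Sp d → Sp d → F) (y w : Sp d) : F :=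
  multiPd β (fun y' => multiPd α (fun w' => Φ y' w') w) y

end Calculus

section Norms

variable {d : ℕ}

/-- The supremum norm; it is the `L^∞` norm for continuous functions on `ℝ^d`. -/
def supNorm (f : Sp d → ℝ) : ℝ≥0∞ := ⨆ x, ‖f x‖ₑ

/-- The Lipschitz norm: supremum norm plus the best Lipschitz constant. The terms with `x = y`
are `0 / 0 = 0`. -/
def lipNorm (f : Sp d → ℝ) : ℝ≥0∞ :=
  supNorm f + ⨆ (x : Sp d) (y : Sp d), edist (f x) (f y) / edist x y

/-- The `BMO` seminorm of a locally integrable function: the supremum over all balls `B` of the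
average over `B` of `|f - f_B|`, where `f_B` is the average of `f` over `B`. -/
def bmoNorm (f : Sp d → ℝ) : ℝ≥0∞ :=
  ⨆ (x : Sp d) (r : ℝ) (_ : 0 < r),
    laverage (volume.restrict (Metric.ball x r))
      fun y => ‖f y - average (volume.restrict (Metric.ball x r)) f‖ₑ

end Norms

section Metric

variable {d : ℕ}

/-- The components `g_{ij}(x)` of a (not yet positive or smooth) metric on `ℝ^d`. -/
abbrev MetricField (d : ℕ) : Type := Sp d → Matrix (Fin d) (Fin d) ℝ

/-- `g` is a smooth Riemannian metric on `ℝ^d`. `Matrix.PosDef` includes symmetry. -/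
structure IsRiemannianMetric (g : MetricField d) : Prop where
  smooth : ∀ i j, ContDiff ℝ ∞ (fun x => g x i j)
  posDef : ∀ x, (g x).PosDef

/-- The components `g^{ij}(x)` of the inverse matrix. -/
def upper (g : MetricField d) (i j : Fin d) : Sp d → ℝ := fun x => (g x)⁻¹ i j

/-- The Christoffel symbols
`Γ^n_{ij} = ½ ∑_m g^{nm} (∂_i g_{mj} + ∂_j g_{mi} - ∂_m g_{ij})`. -/
def christoffel (g : MetricField d) (n i j : Fin d) : Sp d → ℝ := fun x =>
  (1 / 2 : ℝ) * ∑ m, upper g n m x *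
    (pd i (fun z => g z m j) x + pd j (fun z => g z m i) x - pd m (fun z => g z i j) x)

/-- The Riemann curvature tensor `R_{ijkl} = ⟨R(∂_i, ∂_j) ∂_k, ∂_l⟩`, where
`R(X, Y) Z = ∇_X ∇_Y Z - ∇_Y ∇_X Z - ∇_{[X, Y]} Z`. Its second order part is
`½ (∂_j ∂_l g_{ik} + ∂_i ∂_k g_{jl} - ∂_i ∂_l g_{jk} - ∂_j ∂_k g_{il})`. -/
def riemann (g : MetricField d) (i j k l : Fin d) : Sp d → ℝ := fun x =>
  ∑ n, g x l n *
    (pd i (christoffel g n j k) x - pd j (christoffel g n i k) x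
      + ∑ m, (christoffel g m j k x * christoffel g n i m x
          - christoffel g m i k x * christoffel g n j m x))

/-- The smallness condition
`‖R_{ijkl}‖_{L^∞} + ‖g_{ij} - δ_{ij}‖_{Lip} + ‖∇² g_{ij}‖_{BMO} ≤ c`,
each norm being the largest one over all components. -/
def SmallNorms (g : MetricField d) (c : ℝ) : Prop :=
  (⨆ (i : Fin d) (j : Fin d) (k : Fin d) (l : Fin d), supNorm (riemann g i j k l))
    + (⨆ (i : Fin d) (j : Fin d),
        lipNorm (fun x => g x i j - (1 : Matrix (Fin d) (Fin d) ℝ) i j))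
    + (⨆ (i : Fin d) (j : Fin d) (k : Fin d) (l : Fin d),
        bmoNorm (pd k (pd l (fun x => g x i j))))
  ≤ ENNReal.ofReal c

/-- `‖∂^β g^{ij}‖_{L^∞} ≤ C_β M^{|β|-1}` for `|β| ≥ 1`, and
`‖∂^β R_{ijkl}‖_{L^∞} ≤ C_β M^{|β|}` for `|β| ≥ 0`. -/
structure DerivBounds (g : MetricField d) (C : MIdx d → ℝ) (M : ℝ) : Prop where
  upper_bound : ∀ β : MIdx d, 1 ≤ β.order → ∀ i j x,
    |multiPd β (upper g i j) x| ≤ C β * M ^ (β.order - 1)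
  riemann_bound : ∀ β : MIdx d, ∀ i j k l x,
    |multiPd β (riemann g i j k l) x| ≤ C β * M ^ β.order

/-- `c : ℝ → ℝ^d` is a (complete) geodesic: it is twice differentiable and
`c''^n = - ∑_{ij} Γ^n_{ij}(c) c'^i c'^j`. -/
def IsGeodesic (g : MetricField d) (c : ℝ → Sp d) : Prop :=
  Differentiable ℝ c ∧
    ∀ (t : ℝ) (n : Fin d), HasDerivAt (fun s => deriv c s n)
      (-∑ i, ∑ j, christoffel g n i j (c t) * deriv c t i * deriv c t j) t

/-- The velocity `∂_t γ(t, y, w)`. -/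
def velocity (γ : ℝ → Sp d → Sp d → Sp d) (t : ℝ) (y w : Sp d) : Sp d :=
  deriv (fun s => γ s y w) t

/-- `γ(·, y, w)` is the geodesic with initial position `y` and initial velocity `w`. -/
def IsGeodesicFlow (g : MetricField d) (γ : ℝ → Sp d → Sp d → Sp d) : Prop :=
  ∀ y w, IsGeodesic g (fun t => γ t y w) ∧ γ 0 y w = y ∧ velocity γ 0 y w = w

end Metric

end GeodFlow

end

/-! The difficulty is uniformity in `M`. Linearizing the geodesic equation directly produces `∂Γ`,
which is controlled only by a multiple of `M`, so Gronwall would give bounds exponential in `M`. The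
remedy is to pair the Jacobi field `J = Dγ` with its covariant derivative `K = Dv + Γ(v, J)`, where
`v` is the velocity. The derivatives of `Γ` then combine into curvature, and `J' = K - Γ(v, J)`, `K'
= -Γ(v, K) + R(v, J)v`. All coefficients other than the constant one in `J' = K` are `O(c)`, since
the velocity is bounded by conservation of energy. Thus `J` and `K` stay bounded for `|t| ≤ 1`, and
comparison with the flat flow `y + t w` costs only `O(c)`. This is `hasDerivAt_covJac` and
`exists_first_order_bound`.

For higher derivatives, call a function a symbol if its `i`-th derivative is `O(M^i)` (`SymBdd`).
The inverse metric and the curvature are symbols by hypothesis and by boundedness. The identity `∂g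
= -g (∂g⁻¹) g` carries this over to `g`, and then `Γ` is a symbol as well. Differentiating the
Jacobi system `k` times gives a linear system with the same principal part, of rate independent of
`M`, and a forcing `O(M^k)` made of lower order terms. The induction in `flowBdd_vel_jac_covJac`
runs in a loop: order `k` for `v` gives order `k` for `Γ(v, ·)` and `R(v, ·)v`, hence for `J` and
`K`, hence for `Dv = K - Γ(v, J)`, hence order `k + 1` for `v`. Since `J` and `Dv` are already first
derivatives, derivatives of order `k + 1` of the flow are `O(M^k)`. All bounds are uniform over the
type `FlowDatum d C`, so that the constants can depend only on `d`, `C` and the order.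

Completeness follows from the energy bound: trajectories stay in bounded sets over finite times,
where the geodesic field may be cut off to have compact support. Smooth dependence for a cut-off
field comes from the inverse function theorem applied to the integral equation in `C([0, 1], E)`,
using that superposition operators are smooth. The extra factor `|t|` in the last estimates comes
from integrating the velocity bounds from time `0`, where the derivatives of the position concerned
vanish. -/

namespace GeodFlow

/-! ### Smoothness of superposition operators on `C(K, E)`. -/

section Nemytskii

open Set

variable {K : Type} [TopologicalSpace K] [CompactSpace K]
variable {E F : Type} [NormedAddCommGroup E] [NormedSpace ℝ E] [NormedAddCommGroup F]
  [NormedSpace ℝ F]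

/-- The superposition operator `u ↦ X ∘ u` on continuous functions on a compact space. -/
def superpos (K : Type) [TopologicalSpace K] (X : E → F) (hX : Continuous X) (u : C(K, E)) :
    C(K, F) := ContinuousMap.comp ⟨X, hX⟩ u

/-- Pointwise application of a family of operators, as a bounded bilinear map. -/
noncomputable def pointwiseApply (K E F : Type) [TopologicalSpace K] [CompactSpace K]
    [NormedAddCommGroup E] [NormedSpace ℝ E] [NormedAddCommGroup F] [NormedSpace ℝ F] :
    C(K, E →L[ℝ] F) →L[ℝ] C(K, E) →L[ℝ] C(K, F) :=
  LinearMap.mkContinuous₂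
    (LinearMap.mk₂ ℝ (fun (T : C(K, E →L[ℝ] F)) (h : C(K, E)) =>
        (⟨fun k => T k (h k), T.continuous.clm_apply h.continuous⟩ : C(K, F)))
      (fun _ _ _ => by ext; simp) (fun _ _ _ => by ext; simp)
      (fun _ _ _ => by ext; simp) (fun _ _ _ => by ext; simp)) 1
    (fun T h => by
      rw [ContinuousMap.norm_le _ (by positivity)]
      intro k
      simp only [LinearMap.mk₂_apply, ContinuousMap.coe_mk, one_mul]
      exact ((T k).le_opNorm _).trans (mul_le_mul (T.norm_coe_le_norm k)
        (h.norm_coe_le_norm k) (norm_nonneg _) (by positivity)))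

@[simp] theorem pointwiseApply_apply (T : C(K, E →L[ℝ] F)) (h : C(K, E)) (k : K) :
    pointwiseApply K E F T h k = T k (h k) := rfl

/-- Compact support makes `fderiv ℝ X` globally Lipschitz, so the pointwise Taylor remainder is at
most `L * ‖v - u‖ ^ 2` uniformly over `K`, which is what the sup norm needs. -/
theorem hasFDerivAt_superpos {X : E → F} (hX : ContDiff ℝ ∞ X) (hc : HasCompactSupport X)
    (u : C(K, E)) :
    HasFDerivAt (superpos K X hX.continuous)
      (pointwiseApply K E F (superpos K (fderiv ℝ X) (hX.continuous_fderiv (by simp)) u)) u := by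
  obtain ⟨L, hL⟩ := (hX.fderiv_right (m := ∞) (by simp)).lipschitzWith_of_hasCompactSupport
    (hc.fderiv ℝ) (by simp)
  refine HasFDerivAt.of_isLittleO ?_
  have key : ∀ v : C(K, E), ‖superpos K X hX.continuous v - superpos K X hX.continuous u
      - pointwiseApply K E F (superpos K (fderiv ℝ X) (hX.continuous_fderiv (by simp)) u) (v - u)‖
      ≤ L * ‖(v - u)‖ ^ 2 := by
    intro v
    rw [ContinuousMap.norm_le _ (by positivity)]
    intro k
    have h1 := Convex.norm_image_sub_le_of_norm_hasFDerivWithin_le' (f := X)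
      (f' := fderiv ℝ X) (φ := fderiv ℝ X (u k)) (C := L * ‖v - u‖)
      (s := Metric.closedBall (u k) ‖v - u‖) (x := u k) (y := v k)
      (fun x _ => ((hX.differentiable (by simp)) x).hasFDerivAt.hasFDerivWithinAt)
      (fun x hx => by
        have := hL.dist_le_mul x (u k)
        rw [dist_eq_norm] at this
        exact this.trans (mul_le_mul_of_nonneg_left hx L.2))
      (convex_closedBall _ _) (Metric.mem_closedBall_self (norm_nonneg _))
      (by
        rw [Metric.mem_closedBall, dist_eq_norm]
        exact (v - u).norm_coe_le_norm k)
    refine h1.trans ?_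
    have h2 : ‖v k - u k‖ ≤ ‖v - u‖ := (v - u).norm_coe_le_norm k
    have : (L : ℝ) * ‖v - u‖ * ‖v k - u k‖ ≤ L * ‖v - u‖ * ‖v - u‖ := by gcongr
    linarith [this, sq (‖v - u‖), mul_assoc (L : ℝ) ‖v - u‖ ‖v - u‖]
  have h3 : (fun v : C(K, E) => (L : ℝ) * ‖(v - u)‖ ^ 2) =o[nhds u] fun v => v - u := by
    refine Asymptotics.IsLittleO.const_mul_left ?_ _
    have : Filter.Tendsto (fun v : C(K, E) => v - u) (nhds u) (nhds 0) := by
      have h : Continuous (fun v : C(K, E) => v - u) := by fun_prop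
      simpa using h.tendsto u
    exact (Asymptotics.isLittleO_norm_pow_id (one_lt_two)).comp_tendsto this
  exact (Asymptotics.IsBigO.of_bound 1 (Filter.Eventually.of_forall fun v => by
    rw [one_mul]
    refine (key v).trans (le_abs_self _))).trans_isLittleO h3

/-- The derivative is itself a superposition operator, that of `fderiv ℝ X`, followed by a bounded
linear map. The induction therefore has to vary the target space `F`. -/
theorem contDiff_superpos {X : E → F} (hX : ContDiff ℝ ∞ X) (hc : HasCompactSupport X) :
    ContDiff ℝ ∞ (superpos K X hX.continuous) := by
  rw [contDiff_infty]
  intro n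
  induction n generalizing F with
  | zero =>
    refine contDiff_zero.2 (continuous_iff_continuousAt.2 fun u => ?_)
    exact (hasFDerivAt_superpos hX hc u).continuousAt
  | succ n ih =>
    rw [Nat.cast_succ, contDiff_succ_iff_hasFDerivAt]
    refine ⟨_, ?_, fun u => hasFDerivAt_superpos hX hc u⟩
    exact (pointwiseApply K E F).contDiff.comp
      (ih (hX.fderiv_right (m := ∞) (by simp)) (hc.fderiv ℝ))

end Nemytskii

/-! ### Short-time smoothness of flows by the inverse function theorem. -/

section Flow

open Set

variable {E : Type} [NormedAddCommGroup E] [NormedSpace ℝ E]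

/-- The primitive vanishing at `0`, as an operator on continuous functions on `[0, 1]`. -/
noncomputable def primitive (E : Type) [NormedAddCommGroup E] [NormedSpace ℝ E] :
    C(Icc (0 : ℝ) 1, E) →L[ℝ] C(Icc (0 : ℝ) 1, E) :=
  LinearMap.mkContinuous
    { toFun := fun u =>
        ⟨fun s => ∫ r in (0 : ℝ)..s, IccExtend zero_le_one u r,
          (intervalIntegral.continuous_primitive
            (fun a b => (u.continuous.Icc_extend' (h := zero_le_one)).intervalIntegrable a b)
            0).comp continuous_subtype_val⟩
      map_add' := fun u v => by
        ext s
        simp only [ContinuousMap.coe_mk, ContinuousMap.add_apply]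
        rw [← intervalIntegral.integral_add
          ((u.continuous.Icc_extend' (h := zero_le_one)).intervalIntegrable _ _)
          ((v.continuous.Icc_extend' (h := zero_le_one)).intervalIntegrable _ _)]
        rfl
      map_smul' := fun a u => by
        ext s
        simp only [ContinuousMap.coe_mk, ContinuousMap.smul_apply, RingHom.id_apply]
        rw [← intervalIntegral.integral_smul]
        rfl } 1
    (fun u => by
      rw [ContinuousMap.norm_le _ (by positivity)]
      intro s
      have := intervalIntegral.norm_integral_le_of_norm_le_const (a := (0 : ℝ)) (b := s)
        (f := IccExtend zero_le_one u) (C := ‖u‖) (fun r _ => u.norm_coe_le_norm _)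
      refine this.trans ?_
      have h1 : |(s : ℝ) - 0| ≤ 1 := by
        rw [sub_zero, abs_of_nonneg s.2.1]; exact s.2.2
      nlinarith [norm_nonneg u])

theorem norm_primitive_le : ‖primitive E‖ ≤ 1 :=
  LinearMap.mkContinuous_norm_le _ zero_le_one _

theorem primitive_apply (u : C(Icc (0 : ℝ) 1, E)) (s : Icc (0 : ℝ) 1) :
    primitive E u s = ∫ r in (0 : ℝ)..s, IccExtend zero_le_one u r := rfl

variable [CompleteSpace E]

/-- The flow of a compactly supported smooth vector field is smooth for short times. -/
theorem contDiffAt_flow_of_small {X : E → E} (hX : ContDiff ℝ ∞ X) (hc : HasCompactSupport X)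
    {ψ : ℝ → E → E} (h0 : ∀ x, ψ 0 x = x) (hψ : ∀ t x, HasDerivAt (fun s => ψ s x) (X (ψ t x)) t)
    {L : NNReal} (hL : LipschitzWith L X) {q₀ : ℝ × E} (hq : |q₀.1| * L < 1) :
    ContDiffAt ℝ ∞ (fun q : ℝ × E => ψ q.1 q.2) q₀ := by
  classical
  let N : C(Icc (0 : ℝ) 1, E) → C(Icc (0 : ℝ) 1, E) := superpos (Icc (0 : ℝ) 1) X hX.continuous
  let cst : E →L[ℝ] C(Icc (0 : ℝ) 1, E) := LinearMap.mkContinuous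
        { toFun := fun x => ContinuousMap.const (Icc (0 : ℝ) 1) x
          map_add' := fun _ _ => by ext; simp
          map_smul' := fun _ _ => by ext; simp } 1
        (fun x => by
          rw [ContinuousMap.norm_le _ (by positivity)]
          intro s
          simp)
  have hcst : ∀ x s, cst x s = x := fun x s => rfl
  have hNsmooth : ContDiff ℝ ∞ N := contDiff_superpos hX hc
  have hNL : ∀ u v, ‖N u - N v‖ ≤ L * ‖u - v‖ := by
    intro u v
    rw [ContinuousMap.norm_le _ (by positivity)]
    intro s
    have h1 := hL.dist_le_mul (u s) (v s)
    rw [dist_eq_norm, dist_eq_norm] at h1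
    exact h1.trans (mul_le_mul_of_nonneg_left ((u - v).norm_coe_le_norm s) L.2)
  -- The second component is the defect in the integral equation for the rescaled curve `s ↦ ψ (t *
  -- s) x`, so that time becomes a parameter and the curve space is fixed. Keeping `z.1` as first
  -- component turns the implicit function problem into an inverse function problem.
  let G : (ℝ × E) × C(Icc (0 : ℝ) 1, E) → (ℝ × E) × C(Icc (0 : ℝ) 1, E) := fun z =>
    (z.1, z.2 - cst z.1.2 - z.1.1 • primitive E (N z.2))
  have hcont : ∀ x, Continuous fun s => ψ s x := fun x =>
    continuous_iff_continuousAt.2 fun t => (hψ t x).continuousAt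
  let U : ℝ × E → C(Icc (0 : ℝ) 1, E) := fun q =>
    ⟨fun s => ψ (q.1 * s) q.2, (hcont q.2).comp (continuous_const.mul continuous_subtype_val)⟩
  have hU : ∀ q, U q - cst q.2 - q.1 • primitive E (N (U q)) = 0 := by
    intro q
    ext s
    have hd : ∀ r : ℝ, HasDerivAt (fun r => ψ (q.1 * r) q.2) (q.1 • X (ψ (q.1 * r) q.2)) r := by
      intro r
      have h1 : HasDerivAt (fun r : ℝ => q.1 * r) q.1 r := by
        simpa using (hasDerivAt_id r).const_mul q.1
      exact HasDerivAt.scomp r (hψ (q.1 * r) q.2) h1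
    have hint : (∫ r in (0 : ℝ)..s, q.1 • X (ψ (q.1 * r) q.2))
        = ψ (q.1 * s) q.2 - ψ (q.1 * 0) q.2 := by
      refine intervalIntegral.integral_eq_sub_of_hasDerivAt (fun r _ => hd r) ?_
      refine Continuous.intervalIntegrable ?_ _ _
      exact (hX.continuous.comp ((hcont q.2).comp (by fun_prop))).const_smul q.1
    simp only [ContinuousMap.sub_apply, ContinuousMap.smul_apply, primitive_apply,
      ContinuousMap.zero_apply, hcst]
    have hcongr : (∫ r in (0 : ℝ)..s, IccExtend zero_le_one (N (U q)) r)
        = ∫ r in (0 : ℝ)..s, X (ψ (q.1 * r) q.2) := by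
      refine intervalIntegral.integral_congr fun r hr => ?_
      rw [uIcc_of_le s.2.1] at hr
      have hr' : r ∈ Icc (0 : ℝ) 1 := ⟨hr.1, hr.2.trans s.2.2⟩
      show IccExtend zero_le_one (N (U q)) r = X (ψ (q.1 * r) q.2)
      rw [IccExtend_of_mem _ _ hr']
      rfl
    rw [hcongr, ← intervalIntegral.integral_smul, hint, mul_zero, h0]
    show ψ (q.1 * s) q.2 - q.2 - (ψ (q.1 * s) q.2 - q.2) = 0
    simp
  -- For `|t| * L < 1` the integral operator is a contraction, so its fixed point is the trajectory
  -- `U q`.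
  have huniq : ∀ q : ℝ × E, |q.1| * L < 1 → ∀ u, u - cst q.2 - q.1 • primitive E (N u) = 0 →
      u = U q := by
    intro q hq u hu
    have h1 : u - U q = q.1 • primitive E (N u - N (U q)) := by
      rw [map_sub, smul_sub]
      have := hU q
      rw [sub_eq_zero] at this hu
      rw [← this, ← hu]; abel
    have h2 : ‖u - U q‖ ≤ |q.1| * L * ‖u - U q‖ := by
      calc ‖u - U q‖ = |q.1| * ‖primitive E (N u - N (U q))‖ := by
            conv_lhs => rw [h1]
            rw [norm_smul, Real.norm_eq_abs]
        _ ≤ |q.1| * (1 * (L * ‖u - U q‖)) := by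
            gcongr
            exact ((primitive E).le_opNorm _).trans
              (mul_le_mul norm_primitive_le (hNL _ _) (norm_nonneg _) zero_le_one)
        _ = |q.1| * L * ‖u - U q‖ := by ring
    have h3 : ‖u - U q‖ = 0 := by
      by_contra hne
      have : 0 < ‖u - U q‖ := lt_of_le_of_ne (norm_nonneg _) (Ne.symm hne)
      nlinarith
    rwa [norm_eq_zero, sub_eq_zero] at h3
  have hGsmooth : ContDiff ℝ ∞ G := by
    refine contDiff_fst.prodMk ?_
    refine (contDiff_snd.sub (cst.contDiff.comp (contDiff_snd.comp contDiff_fst))).sub ?_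
    exact (contDiff_fst.comp contDiff_fst).smul
      ((primitive E).contDiff.comp (hNsmooth.comp contDiff_snd))
  let D : C(Icc (0 : ℝ) 1, E) →L[ℝ] C(Icc (0 : ℝ) 1, E) := fderiv ℝ N (U q₀)
  have hD : ‖q₀.1 • (primitive E).comp D‖ < 1 := by
    have hDL : ‖D‖ ≤ L := by
      refine norm_fderiv_le_of_lipschitz ℝ (LipschitzWith.of_dist_le_mul fun u v => ?_)
      rw [dist_eq_norm, dist_eq_norm]
      exact hNL u v
    refine lt_of_le_of_lt (ContinuousLinearMap.opNorm_le_bound _ (by positivity) fun h => ?_) hq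
    have h1 : ‖primitive E (D h)‖ ≤ 1 * (L * ‖h‖) :=
      ((primitive E).le_opNorm _).trans (mul_le_mul norm_primitive_le
        ((D.le_opNorm h).trans (mul_le_mul_of_nonneg_right hDL (norm_nonneg _)))
        (norm_nonneg _) zero_le_one)
    calc ‖q₀.1 • primitive E (D h)‖ = |q₀.1| * ‖primitive E (D h)‖ := by
          rw [norm_smul, Real.norm_eq_abs]
      _ ≤ |q₀.1| * (1 * (L * ‖h‖)) := by gcongr
      _ = |q₀.1| * L * ‖h‖ := by ring
  -- The linearization in the curve variable is `1 - t • primitive ∘ D`, invertible by a Neumann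
  -- series because of `hD`.
  let e : C(Icc (0 : ℝ) 1, E) ≃L[ℝ] C(Icc (0 : ℝ) 1, E) :=
    ContinuousLinearEquiv.unitsEquiv ℝ _ (Units.oneSub (q₀.1 • (primitive E).comp D) hD)
  have he : ∀ h, e h = h - q₀.1 • primitive E (D h) := fun h => rfl
  let f : (ℝ × E) →L[ℝ] C(Icc (0 : ℝ) 1, E) := -(cst.comp (ContinuousLinearMap.snd ℝ ℝ E)) -
    (ContinuousLinearMap.fst ℝ ℝ E).smulRight (primitive E (N (U q₀)))
  let G' := ContinuousLinearEquiv.skewProd (ContinuousLinearEquiv.refl ℝ (ℝ × E)) e f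
  have hG' : HasFDerivAt G (G' : (ℝ × E) × C(Icc (0 : ℝ) 1, E) →L[ℝ] (ℝ × E) × C(Icc (0 : ℝ) 1, E)) (q₀, U q₀) := by
    have hN : HasFDerivAt (fun z : (ℝ × E) × C(Icc (0 : ℝ) 1, E) => N z.2)
        (D.comp (ContinuousLinearMap.snd ℝ _ _)) (q₀, U q₀) :=
      HasFDerivAt.comp (q₀, U q₀) ((hNsmooth.differentiable (by simp)) (U q₀)).hasFDerivAt
        hasFDerivAt_snd
    have hJ := (primitive E).hasFDerivAt.comp (q₀, U q₀) hN
    have h1 : HasFDerivAt (fun z : (ℝ × E) × C(Icc (0 : ℝ) 1, E) => z.1.1)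
        ((ContinuousLinearMap.fst ℝ ℝ E).comp (ContinuousLinearMap.fst ℝ (ℝ × E) C(Icc (0 : ℝ) 1, E)))
        (q₀, U q₀) :=
      ((ContinuousLinearMap.fst ℝ ℝ E).comp (ContinuousLinearMap.fst ℝ (ℝ × E) C(Icc (0 : ℝ) 1, E))).hasFDerivAt
    have h2 : HasFDerivAt (fun z : (ℝ × E) × C(Icc (0 : ℝ) 1, E) => cst z.1.2)
        (cst.comp ((ContinuousLinearMap.snd ℝ ℝ E).comp
          (ContinuousLinearMap.fst ℝ (ℝ × E) C(Icc (0 : ℝ) 1, E)))) (q₀, U q₀) :=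
      (cst.comp ((ContinuousLinearMap.snd ℝ ℝ E).comp
          (ContinuousLinearMap.fst ℝ (ℝ × E) C(Icc (0 : ℝ) 1, E)))).hasFDerivAt
    have h3 := (hasFDerivAt_fst (𝕜 := ℝ) (p := (q₀, U q₀))).prodMk
      (((hasFDerivAt_snd (𝕜 := ℝ) (p := (q₀, U q₀))).sub h2).sub (h1.smul hJ))
    refine h3.congr_fderiv ?_
    refine ContinuousLinearMap.ext fun z => ?_
    refine Prod.ext rfl ?_
    show z.2 - cst z.1.2 - (q₀.1 • primitive E (D z.2) + z.1.1 • primitive E (N (U q₀)))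
      = e z.2 + (-(cst z.1.2) - z.1.1 • primitive E (N (U q₀)))
    rw [he]; abel
  have hG0 : G (q₀, U q₀) = (q₀, 0) := Prod.ext rfl (hU q₀)
  have hGat : ContDiffAt ℝ ∞ G (q₀, U q₀) := hGsmooth.contDiffAt
  have hinv := hGat.to_localInverse hG' (by simp)
  have hright := (hGat.hasStrictFDerivAt' hG' (by simp)).eventually_right_inverse
  rw [hG0] at hinv hright
  have hin : ContDiff ℝ ∞ (fun q : ℝ × E => (q, (0 : C(Icc (0 : ℝ) 1, E)))) := by fun_prop
  -- The local inverse at `(q, 0)` solves the integral equation and depends smoothly on `q`. By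
  -- `huniq` it is the trajectory, and evaluation at `s = 1` returns `ψ q.1 q.2`.
  have hV : ContDiffAt ℝ ∞ (fun q : ℝ × E => hGat.localInverse hG' (by simp) (q, 0)) q₀ :=
    ContDiffAt.comp q₀ hinv hin.contDiffAt
  have hone : (1 : ℝ) ∈ Icc (0 : ℝ) 1 := ⟨zero_le_one, le_rfl⟩
  have hW := (ContinuousMap.evalCLM ℝ (⟨1, hone⟩ : Icc (0 : ℝ) 1) :
    C(Icc (0 : ℝ) 1, E) →L[ℝ] E).contDiff.contDiffAt.comp q₀ (contDiffAt_snd.comp q₀ hV)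
  refine hW.congr_of_eventuallyEq ?_
  have hev : ∀ᶠ q : ℝ × E in nhds q₀, |q.1| * L < 1 := by
    refine ContinuousAt.eventually_lt ?_ continuousAt_const hq
    fun_prop
  filter_upwards [hin.continuous.continuousAt.eventually hright, hev] with q h1 h2
  set Z := hGat.localInverse hG' (by simp) (q, 0)
  have hZ : G Z = (q, 0) := h1
  have hZ1 : Z.1 = q := congrArg Prod.fst hZ
  have hZ2 : Z.2 - cst Z.1.2 - Z.1.1 • primitive E (N Z.2) = 0 := congrArg Prod.snd hZ
  rw [hZ1] at hZ2
  have := huniq q h2 _ hZ2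
  show ψ q.1 q.2 = Z.2 ⟨1, hone⟩
  rw [this]
  show _ = ψ (q.1 * 1) q.2
  rw [mul_one]

end Flow

/-! ### Uniqueness, gluing and global smoothness of integral curves. -/

section GlobalFlow

open Set

variable {E : Type} [NormedAddCommGroup E] [NormedSpace ℝ E]

/-- The field is only locally Lipschitz. On a slightly shorter compact interval both curves lie in
one closed ball, on which `X` is Lipschitz. -/
theorem eqOn_Ioo_of_integralCurve [ProperSpace E] {X : E → E} (hX : ContDiff ℝ ∞ X) {f g : ℝ → E}
    {T : ℝ} (hf : ∀ t ∈ Ioo (-T) T, HasDerivAt f (X (f t)) t)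
    (hg : ∀ t ∈ Ioo (-T) T, HasDerivAt g (X (g t)) t) (h : f 0 = g 0) :
    EqOn f g (Ioo (-T) T) := by
  intro t ht
  have htT : |t| < T := abs_lt.2 ht
  obtain ⟨S, hS, hST⟩ := exists_between htT
  have hS0 : 0 < S := (abs_nonneg t).trans_lt hS
  have hsub : Icc (-S) S ⊆ Ioo (-T) T := fun s hs => ⟨by linarith [hs.1], by linarith [hs.2]⟩
  have hfc : ContinuousOn f (Icc (-S) S) := fun s hs =>
    (hf s (hsub hs)).continuousAt.continuousWithinAt
  have hgc : ContinuousOn g (Icc (-S) S) := fun s hs =>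
    (hg s (hsub hs)).continuousAt.continuousWithinAt
  obtain ⟨A, hA⟩ := isCompact_Icc.exists_bound_of_continuousOn hfc
  obtain ⟨B, hB⟩ := isCompact_Icc.exists_bound_of_continuousOn hgc
  obtain ⟨L, hL⟩ := (hX.contDiffOn (s := Metric.closedBall 0 (max A B))).exists_lipschitzOnWith
    (by simp) (convex_closedBall _ _) (isCompact_closedBall _ _)
  have hsub' : Ioo (-S) S ⊆ Icc (-S) S := Ioo_subset_Icc_self
  refine ODE_solution_unique_of_mem_Ioo (v := fun _ => X)
    (s := fun _ => Metric.closedBall 0 (max A B)) (t₀ := 0) (fun _ _ => hL)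
    ⟨by linarith, hS0⟩ (fun s hs => ⟨hf s (hsub (hsub' hs)), ?_⟩)
    (fun s hs => ⟨hg s (hsub (hsub' hs)), ?_⟩) h (abs_lt.1 hS)
  · rw [mem_closedBall_zero_iff]; exact (hA s (hsub' hs)).trans (le_max_left _ _)
  · rw [mem_closedBall_zero_iff]; exact (hB s (hsub' hs)).trans (le_max_right _ _)

theorem eq_of_integralCurve [ProperSpace E] {X : E → E} (hX : ContDiff ℝ ∞ X) {f g : ℝ → E}
    (hf : ∀ t, HasDerivAt f (X (f t)) t) (hg : ∀ t, HasDerivAt g (X (g t)) t) (h : f 0 = g 0) :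
    f = g := by
  funext t
  refine eqOn_Ioo_of_integralCurve (T := |t| + 1) hX (fun s _ => hf s) (fun s _ => hg s) h ?_
  rw [mem_Ioo, ← abs_lt]
  linarith

/-- Uniqueness makes the partial solutions agree on overlaps. Completeness is thereby reduced to
bounded times, for which a cutoff depending on `n` is allowed. -/
theorem exists_integralCurve_of_forall_Ioo [ProperSpace E] {X : E → E} (hX : ContDiff ℝ ∞ X)
    {x : E} (h : ∀ n : ℕ, ∃ f : ℝ → E, f 0 = x ∧
      ∀ t ∈ Ioo (-(n : ℝ)) n, HasDerivAt f (X (f t)) t) :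
    ∃ f : ℝ → E, f 0 = x ∧ ∀ t, HasDerivAt f (X (f t)) t := by
  choose F hF0 hF using h
  let m : ℝ → ℕ := fun t => ⌊|t|⌋₊ + 1
  have hm : ∀ t, |t| < m t := fun t => by
    have := Nat.lt_floor_add_one |t|
    simpa [m] using this
  have heq : ∀ (N : ℕ) (t : ℝ), |t| < N → F (m t) t = F N t := by
    intro N t hN
    rcases le_total (m t) N with hle | hle
    · refine eqOn_Ioo_of_integralCurve hX (hF (m t)) (fun s hs => hF N s ?_)
        ((hF0 _).trans (hF0 _).symm) (abs_lt.1 (hm t))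
      have : (m t : ℝ) ≤ N := by exact_mod_cast hle
      exact ⟨by linarith [hs.1], by linarith [hs.2]⟩
    · refine eqOn_Ioo_of_integralCurve hX (fun s hs => hF (m t) s ?_) (hF N)
        ((hF0 _).trans (hF0 _).symm) (abs_lt.1 hN)
      have : (N : ℝ) ≤ m t := by exact_mod_cast hle
      exact ⟨by linarith [hs.1], by linarith [hs.2]⟩
  refine ⟨fun t => F (m t) t, hF0 _, fun t => ?_⟩
  refine (hF (m t) t (abs_lt.1 (hm t))).congr_of_eventuallyEq ?_
  have hev : ∀ᶠ s in nhds t, |s| < (m t : ℝ) :=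
    continuous_abs.continuousAt.eventually_lt continuousAt_const (hm t)
  filter_upwards [hev] with s hs
  exact heq _ _ hs

theorem exists_integralCurve_of_hasCompactSupport [ProperSpace E] {X : E → E}
    (hX : ContDiff ℝ ∞ X) (hc : HasCompactSupport X) (x : E) :
    ∃ f : ℝ → E, f 0 = x ∧ ∀ t, HasDerivAt f (X (f t)) t := by
  refine exists_integralCurve_of_forall_Ioo hX fun n => ?_
  obtain ⟨L, hL⟩ := hX.lipschitzWith_of_hasCompactSupport hc (by simp)
  obtain ⟨B, hB⟩ := hc.exists_bound_of_continuous hX.continuous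
  have hB0 : 0 ≤ B := (norm_nonneg _).trans (hB 0)
  -- A curve of speed at most `B` cannot leave the ball of radius `B * n` within time `n`, so one
  -- application covers the whole interval.
  have hpl : IsPicardLindelof (fun _ => X) (tmin := -(n : ℝ)) (tmax := n)
      ⟨0, by simp⟩ x (⟨B, hB0⟩ * n) 0 ⟨B, hB0⟩ L := by
    refine IsPicardLindelof.of_time_independent (fun y _ => hB y) hL.lipschitzOnWith ?_
    simp only [sub_zero, zero_sub, neg_neg, max_self, NNReal.coe_zero]
    exact le_rfl
  obtain ⟨f, hf0, hf⟩ := hpl.exists_eq_forall_mem_Icc_hasDerivWithinAt₀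
  exact ⟨f, hf0, fun t ht => (hf t (Ioo_subset_Icc_self ht)).hasDerivAt (Icc_mem_nhds ht.1 ht.2)⟩

/-- The flow of a compactly supported smooth vector field is smooth. -/
theorem contDiff_flow [ProperSpace E] {X : E → E} (hX : ContDiff ℝ ∞ X)
    (hc : HasCompactSupport X) {ψ : ℝ → E → E} (h0 : ∀ x, ψ 0 x = x)
    (hψ : ∀ t x, HasDerivAt (fun s => ψ s x) (X (ψ t x)) t) :
    ContDiff ℝ ∞ (fun q : ℝ × E => ψ q.1 q.2) := by
  obtain ⟨L, hL⟩ := hX.lipschitzWith_of_hasCompactSupport hc (by simp)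
  have hgrp : ∀ s t x, ψ (t + s) x = ψ t (ψ s x) := by
    intro s t x
    have := eq_of_integralCurve hX (f := fun t => ψ (t + s) x) (g := fun t => ψ t (ψ s x))
      (fun t => (hψ (t + s) x).comp_add_const t s) (fun t => hψ t _) (by simp [h0])
    exact congrFun this t
  -- By the group law the flow over time `n * t` is the `n`-fold iterate of the short-time flow. A
  -- general time is then written as `n * (t / n)` with `n > |t| * L`.
  have hsmall : ∀ n : ℕ, ∀ q : ℝ × E, |q.1| * L < 1 →
      ContDiffAt ℝ ∞ (fun q : ℝ × E => ψ (n * q.1) q.2) q := by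
    intro n
    induction n with
    | zero =>
      intro q _
      simp only [Nat.cast_zero, zero_mul, h0]
      exact contDiffAt_snd
    | succ n ih =>
      intro q hq
      have h1 : ContDiffAt ℝ ∞ (fun q : ℝ × E => (q.1, ψ (n * q.1) q.2)) q :=
        contDiffAt_fst.prodMk (ih q hq)
      have h2 := (contDiffAt_flow_of_small hX hc h0 hψ hL
        (q₀ := (q.1, ψ (n * q.1) q.2)) hq).comp q h1
      refine h2.congr_of_eventuallyEq (Filter.Eventually.of_forall fun r => ?_)
      show ψ ((n + 1 : ℕ) * r.1) r.2 = ψ r.1 (ψ (n * r.1) r.2)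
      rw [← hgrp]
      congr 1
      push_cast; ring
  refine contDiff_iff_contDiffAt.2 fun q => ?_
  obtain ⟨n, hn⟩ := exists_nat_gt (|q.1| * L)
  have hn0 : (0 : ℝ) < n := lt_of_le_of_lt (by positivity) hn
  have h1 : ContDiffAt ℝ ∞ (fun q : ℝ × E => (q.1 / n, q.2)) q :=
    (contDiffAt_fst.div_const _).prodMk contDiffAt_snd
  have h2 := (hsmall n (q.1 / n, q.2) (by
    rw [abs_div, Nat.abs_cast, div_mul_eq_mul_div, div_lt_one hn0]; exact hn)).comp q h1
  refine h2.congr_of_eventuallyEq (Filter.Eventually.of_forall fun r => ?_)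
  show ψ r.1 r.2 = ψ (n * (r.1 / n)) r.2
  rw [mul_div_cancel₀ _ hn0.ne']

end GlobalFlow

/-! ### Calculus of functions whose `i`-th derivative is `O(M ^ i)`. -/

section Symbols

variable {ι κ : Type} {D E F G : Type} [NormedAddCommGroup D] [NormedSpace ℝ D]
  [NormedAddCommGroup E] [NormedSpace ℝ E] [NormedAddCommGroup F] [NormedSpace ℝ F]
  [NormedAddCommGroup G] [NormedSpace ℝ G] {M : ι → ℝ} {k : ℕ}

/-- A family of smooth functions `f τ` whose derivatives of order `i ≤ k` at `p τ` are bounded by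
a multiple of `M τ ^ i`, uniformly in the parameter `τ`. -/
structure SymBdd (k : ℕ) (M : ι → ℝ) (f : ι → E → F) (p : ι → E) : Prop where
  smooth : ∀ τ, ContDiff ℝ ∞ (f τ)
  bound : ∀ i ≤ k, ∃ C, ∀ τ, ‖iteratedFDeriv ℝ i (f τ) (p τ)‖ ≤ C * M τ ^ i

theorem SymBdd.exists_uniform {f : ι → E → F} {p : ι → E} (hM : ∀ τ, 1 ≤ M τ)
    (h : SymBdd k M f p) :
    ∃ C, 0 ≤ C ∧ ∀ i ≤ k, ∀ τ, ‖iteratedFDeriv ℝ i (f τ) (p τ)‖ ≤ C * M τ ^ i := by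
  choose! C hC using h.bound
  refine ⟨∑ i ∈ Finset.range (k + 1), |C i|, Finset.sum_nonneg fun _ _ => abs_nonneg _,
    fun i hi τ => (hC i hi τ).trans ?_⟩
  have hMi : 0 ≤ M τ ^ i := pow_nonneg (zero_le_one.trans (hM τ)) i
  refine mul_le_mul_of_nonneg_right ((le_abs_self _).trans ?_) hMi
  exact Finset.single_le_sum (f := fun i => |C i|) (fun _ _ => abs_nonneg _)
    (Finset.mem_range.2 (Nat.lt_succ_of_le hi))

theorem SymBdd.mono {f : ι → E → F} {p : ι → E} {l : ℕ} (h : SymBdd k M f p) (hl : l ≤ k) :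
    SymBdd l M f p :=
  ⟨h.smooth, fun i hi => h.bound i (hi.trans hl)⟩

theorem SymBdd.reindex {f : ι → E → F} {p : ι → E} (h : SymBdd k M f p) (σ : κ → ι) :
    SymBdd k (fun τ => M (σ τ)) (fun τ => f (σ τ)) (fun τ => p (σ τ)) :=
  ⟨fun τ => h.smooth (σ τ), fun i hi => (h.bound i hi).imp fun _ hC τ => hC (σ τ)⟩

/-- The hypothesis yields `O(M ^ i)` for the derivative of order `i + 1`; the spare power is given
away using `1 ≤ M`. -/
theorem SymBdd.of_fderiv {f : ι → E → F} {p : ι → E} (hM : ∀ τ, 1 ≤ M τ)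
    (hs : ∀ τ, ContDiff ℝ ∞ (f τ)) (h0 : ∃ C, ∀ τ, ‖f τ (p τ)‖ ≤ C)
    (h : SymBdd k M (fun τ => fderiv ℝ (f τ)) p) : SymBdd (k + 1) M f p := by
  refine ⟨hs, fun i hi => ?_⟩
  rcases i with _ | i
  · simpa using h0
  · obtain ⟨C, hC0, hC⟩ := h.exists_uniform hM
    refine ⟨C, fun τ => ?_⟩
    rw [← norm_iteratedFDeriv_fderiv]
    refine (hC i (by omega) τ).trans (mul_le_mul_of_nonneg_left ?_ hC0)
    exact pow_le_pow_right₀ (hM τ) (Nat.le_succ i)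

theorem SymBdd.const {c : ι → F} {p : ι → E} (hc : ∃ C, ∀ τ, ‖c τ‖ ≤ C) :
    SymBdd k M (fun τ (_ : E) => c τ) p := by
  refine ⟨fun τ => contDiff_const, fun i _ => ?_⟩
  rcases i with _ | i
  · simpa using hc
  · refine ⟨0, fun τ => ?_⟩
    rw [iteratedFDeriv_const_of_ne (Nat.succ_ne_zero i)]
    simp

theorem SymBdd.add {f g : ι → E → F} {p : ι → E} (hf : SymBdd k M f p) (hg : SymBdd k M g p) :
    SymBdd k M (fun τ x => f τ x + g τ x) p := by
  refine ⟨fun τ => (hf.smooth τ).add (hg.smooth τ), fun i hi => ?_⟩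
  obtain ⟨A, hA⟩ := hf.bound i hi
  obtain ⟨B, hB⟩ := hg.bound i hi
  refine ⟨A + B, fun τ => ?_⟩
  have h : iteratedFDeriv ℝ i (fun x => f τ x + g τ x) (p τ)
      = iteratedFDeriv ℝ i (f τ) (p τ) + iteratedFDeriv ℝ i (g τ) (p τ) :=
    iteratedFDeriv_add_apply (((hf.smooth τ).of_le (by exact_mod_cast le_top)).contDiffAt)
      (((hg.smooth τ).of_le (by exact_mod_cast le_top)).contDiffAt)
  rw [h, add_mul]
  exact (norm_add_le _ _).trans (add_le_add (hA τ) (hB τ))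

theorem SymBdd.clm {f : ι → E → F} {p : ι → E} (hf : SymBdd k M f p) (L : F →L[ℝ] G) :
    SymBdd k M (fun τ x => L (f τ x)) p := by
  refine ⟨fun τ => L.contDiff.comp (hf.smooth τ), fun i hi => ?_⟩
  obtain ⟨A, hA⟩ := hf.bound i hi
  refine ⟨‖L‖ * A, fun τ => ?_⟩
  have := L.norm_iteratedFDeriv_comp_left (n := i) (N := ∞) (x := p τ) (hf.smooth τ).contDiffAt
    (by exact_mod_cast le_top)
  refine this.trans ?_
  rw [mul_assoc]
  exact mul_le_mul_of_nonneg_left (hA τ) (norm_nonneg _)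

theorem SymBdd.neg {f : ι → E → F} {p : ι → E} (hf : SymBdd k M f p) :
    SymBdd k M (fun τ x => -f τ x) p :=
  hf.clm (-ContinuousLinearMap.id ℝ F)

theorem SymBdd.sub {f g : ι → E → F} {p : ι → E} (hf : SymBdd k M f p) (hg : SymBdd k M g p) :
    SymBdd k M (fun τ x => f τ x - g τ x) p := by
  simpa only [sub_eq_add_neg] using hf.add hg.neg

theorem SymBdd.sum {J : Type} (s : Finset J) {f : J → ι → E → F} {p : ι → E}
    (hf : ∀ j ∈ s, SymBdd k M (f j) p) :
    SymBdd k M (fun τ x => ∑ j ∈ s, f j τ x) p := by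
  classical
  induction s using Finset.induction_on with
  | empty => simpa using SymBdd.const (c := fun _ => (0 : F)) ⟨0, fun τ => by simp⟩
  | insert a s ha ih =>
    simp only [Finset.sum_insert ha]
    exact (hf a (Finset.mem_insert_self _ _)).add
      (ih fun j hj => hf j (Finset.mem_insert_of_mem hj))

theorem SymBdd.bilin (B : E →L[ℝ] F →L[ℝ] G) {f : ι → D → E} {g : ι → D → F} {p : ι → D}
    (hM : ∀ τ, 1 ≤ M τ) (hf : SymBdd k M f p) (hg : SymBdd k M g p) :
    SymBdd k M (fun τ x => B (f τ x) (g τ x)) p := by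
  refine ⟨fun τ => (B.contDiff.comp (hf.smooth τ)).clm_apply (hg.smooth τ), fun i hi => ?_⟩
  obtain ⟨a, ha0, ha⟩ := hf.exists_uniform hM
  obtain ⟨b, hb0, hb⟩ := hg.exists_uniform hM
  refine ⟨‖B‖ * ∑ j ∈ Finset.range (i + 1), (i.choose j : ℝ) * a * b, fun τ => ?_⟩
  have := B.norm_iteratedFDeriv_le_of_bilinear (hf.smooth τ) (hg.smooth τ) (p τ) (n := i)
    (by exact_mod_cast le_top)
  refine this.trans ?_
  rw [mul_assoc]
  refine mul_le_mul_of_nonneg_left ?_ (norm_nonneg B)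
  rw [Finset.sum_mul]
  refine Finset.sum_le_sum fun j hj => ?_
  have hj' : j ≤ i := Nat.lt_succ_iff.1 (Finset.mem_range.1 hj)
  have h1 := ha j (hj'.trans hi) τ
  have h2 := hb (i - j) ((Nat.sub_le i j).trans hi) τ
  have hM0 : 0 ≤ M τ := zero_le_one.trans (hM τ)
  calc (i.choose j : ℝ) * ‖iteratedFDeriv ℝ j (f τ) (p τ)‖ * ‖iteratedFDeriv ℝ (i - j) (g τ) (p τ)‖
      ≤ (i.choose j : ℝ) * (a * M τ ^ j) * (b * M τ ^ (i - j)) := by gcongr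
    _ = (i.choose j : ℝ) * a * b * (M τ ^ j * M τ ^ (i - j)) := by ring
    _ = (i.choose j : ℝ) * a * b * M τ ^ i := by rw [← pow_add, Nat.add_sub_cancel' hj']

theorem SymBdd.mul {f g : ι → E → ℝ} {p : ι → E} (hM : ∀ τ, 1 ≤ M τ) (hf : SymBdd k M f p)
    (hg : SymBdd k M g p) : SymBdd k M (fun τ x => f τ x * g τ x) p :=
  SymBdd.bilin (ContinuousLinearMap.mul ℝ ℝ) hM hf hg

theorem SymBdd.clm_comp {f : ι → D → F →L[ℝ] G} {g : ι → D → E →L[ℝ] F} {p : ι → D}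
    (hM : ∀ τ, 1 ≤ M τ) (hf : SymBdd k M f p) (hg : SymBdd k M g p) :
    SymBdd k M (fun τ x => (f τ x).comp (g τ x)) p :=
  SymBdd.bilin (ContinuousLinearMap.compL ℝ E F G) hM hf hg

/-- Composition with an inner function whose derivatives gain one power of `M`. -/
theorem SymBdd.comp {f : ι → E → F} {q : ι → D → E} {p : ι → D} (hM : ∀ τ, 1 ≤ M τ)
    (hf : SymBdd k M f (fun τ => q τ (p τ))) (hq : ∀ τ, ContDiff ℝ ∞ (q τ))
    (hqb : ∀ i < k, ∃ C, ∀ τ, ‖iteratedFDeriv ℝ (i + 1) (q τ) (p τ)‖ ≤ C * M τ ^ i) :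
    SymBdd k M (fun τ x => f τ (q τ x)) p := by
  refine ⟨fun τ => (hf.smooth τ).comp (hq τ), fun n hn => ?_⟩
  obtain ⟨a, ha0, ha⟩ := hf.exists_uniform hM
  choose! B hB using hqb
  -- The summand `1` ensures `b ≤ b ^ i` for `i ≥ 1`, the geometric form required by
  -- `norm_iteratedFDeriv_comp_le`.
  let b : ℝ := 1 + ∑ i ∈ Finset.range k, |B i|
  have hb1 : 1 ≤ b := le_add_of_nonneg_right (Finset.sum_nonneg fun _ _ => abs_nonneg _)
  have hBb : ∀ i < k, B i ≤ b := fun i hi => (le_abs_self _).trans <|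
    (Finset.single_le_sum (f := fun i => |B i|) (fun _ _ => abs_nonneg _)
      (Finset.mem_range.2 hi)).trans (le_add_of_nonneg_left zero_le_one)
  refine ⟨n.factorial * a * b ^ n, fun τ => ?_⟩
  have hM1 := hM τ
  have hM0 : 0 < M τ := zero_lt_one.trans_le hM1
  -- Rescaling the intermediate space by `M` leaves the composite unchanged. It makes the
  -- derivatives of the outer function bounded by `a`, and the `i`-th derivative of the inner one
  -- bounded by `(b * M) ^ i`.
  let f' : E → F := fun x => f τ ((M τ)⁻¹ • x)
  let q' : D → E := fun x => M τ • q τ x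
  let L : E →L[ℝ] E := (M τ)⁻¹ • ContinuousLinearMap.id ℝ E
  have hL : ‖L‖ ≤ (M τ)⁻¹ := by
    refine ContinuousLinearMap.opNorm_le_bound _ (by positivity) fun x => ?_
    show ‖(M τ)⁻¹ • x‖ ≤ _
    rw [norm_smul, Real.norm_of_nonneg (by positivity)]
  have hf's : ContDiff ℝ ∞ f' := (hf.smooth τ).comp L.contDiff
  have hq's : ContDiff ℝ ∞ q' := (hq τ).const_smul (M τ)
  have hfq : (fun x => f τ (q τ x)) = f' ∘ q' := by
    funext x
    show f τ (q τ x) = f τ ((M τ)⁻¹ • M τ • q τ x)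
    rw [inv_smul_smul₀ hM0.ne']
  have hLq : L (q' (p τ)) = q τ (p τ) := by
    show (M τ)⁻¹ • M τ • q τ (p τ) = _
    rw [inv_smul_smul₀ hM0.ne']
  have h1 : ∀ i ≤ n, ‖iteratedFDeriv ℝ i f' (q' (p τ))‖ ≤ a := by
    intro i hi
    have h2 := L.iteratedFDeriv_comp_right (hf.smooth τ) (q' (p τ)) (i := i)
      (by exact_mod_cast le_top)
    have h3 : iteratedFDeriv ℝ i f' (q' (p τ)) = iteratedFDeriv ℝ i (f τ ∘ L) (q' (p τ)) := rfl
    rw [h3, h2]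
    refine (ContinuousMultilinearMap.norm_compContinuousLinearMap_le _ _).trans ?_
    rw [Finset.prod_const, Finset.card_univ, Fintype.card_fin, hLq]
    calc _ ≤ (a * M τ ^ i) * ((M τ)⁻¹) ^ i := by
          gcongr
          exact ha i (hi.trans hn) τ
      _ = a := by
          rw [mul_assoc, ← mul_pow, mul_inv_cancel₀ hM0.ne', one_pow, mul_one]
  have h2 : ∀ i, 1 ≤ i → i ≤ n → ‖iteratedFDeriv ℝ i q' (p τ)‖ ≤ (b * M τ) ^ i := by
    intro i hi1 hin
    obtain ⟨j, rfl⟩ : ∃ j, i = j + 1 := ⟨i - 1, by omega⟩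
    have h3 : iteratedFDeriv ℝ (j + 1) q' (p τ) = M τ • iteratedFDeriv ℝ (j + 1) (q τ) (p τ) :=
      iteratedFDeriv_const_smul_apply (((hq τ).of_le (by exact_mod_cast le_top)).contDiffAt)
    rw [h3, norm_smul, Real.norm_of_nonneg hM0.le, mul_pow]
    have hj : j < k := by omega
    calc M τ * ‖iteratedFDeriv ℝ (j + 1) (q τ) (p τ)‖ ≤ M τ * (b * M τ ^ j) := by
          gcongr
          exact (hB j hj τ).trans (mul_le_mul_of_nonneg_right (hBb j hj) (by positivity))
      _ = b * M τ ^ (j + 1) := by ring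
      _ ≤ b ^ (j + 1) * M τ ^ (j + 1) := by
          gcongr
          exact le_self_pow₀ hb1 (Nat.succ_ne_zero j)
  have h3 := norm_iteratedFDeriv_comp_le hf's hq's (n := n) (by exact_mod_cast le_top) (p τ) h1 h2
  rw [hfq]
  refine h3.trans (le_of_eq ?_)
  rw [mul_pow]; ring

end Symbols

/-! ### Interchanging time and parameter derivatives. -/

section TimeDerivative

variable {P F : Type} [NormedAddCommGroup P] [NormedSpace ℝ P]
  [NormedAddCommGroup F] [NormedSpace ℝ F]

theorem contDiff_deriv_fst {f : ℝ → P → F} (hf : ContDiff ℝ ∞ (Function.uncurry f)) :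
    ContDiff ℝ ∞ (Function.uncurry fun t p => deriv (fun s => f s p) t) := by
  have h : (Function.uncurry fun t p => deriv (fun s => f s p) t)
      = fun z : ℝ × P => fderiv ℝ (fun s => f s z.2) z.1 1 := by
    funext z; exact fderiv_apply_one_eq_deriv.symm
  rw [h]
  have h1 : ContDiff ℝ ∞ (Function.uncurry fun (z : ℝ × P) (s : ℝ) => f s z.2) :=
    hf.comp (g := Function.uncurry f)
      (f := fun z : (ℝ × P) × ℝ => (z.2, z.1.2)) (by fun_prop)
  exact (ContDiff.fderiv (n := ∞) h1 contDiff_fst (by simp)).clm_apply contDiff_const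

theorem contDiff_fderiv_snd {f : ℝ → P → F} (hf : ContDiff ℝ ∞ (Function.uncurry f)) :
    ContDiff ℝ ∞ (Function.uncurry fun t p => fderiv ℝ (f t) p) := by
  have h1 : ContDiff ℝ ∞ (Function.uncurry fun (z : ℝ × P) (p : P) => f z.1 p) :=
    hf.comp (g := Function.uncurry f)
      (f := fun z : (ℝ × P) × P => (z.1.1, z.2)) (by fun_prop)
  exact ContDiff.fderiv (n := ∞) h1 contDiff_snd (by simp)

/-- Both sides are the second derivative of the uncurried function on the pair `(1, 0)`, `(0, h)`,
in opposite orders, so the claim is the symmetry of that derivative. -/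
theorem hasDerivAt_fderiv_snd {f : ℝ → P → F} (hf : ContDiff ℝ ∞ (Function.uncurry f)) (t : ℝ)
    (p : P) : HasDerivAt (fun s => fderiv ℝ (f s) p)
      (fderiv ℝ (fun p => deriv (fun s => f s p) t) p) t := by
  let g := Function.uncurry f
  have hd : ∀ z, HasFDerivAt g (fderiv ℝ g z) z := fun z =>
    ((hf.differentiable (by simp)) z).hasFDerivAt
  have hg' : ContDiff ℝ ∞ (fderiv ℝ g) := hf.fderiv_right (by simp)
  have hdd : ∀ z, HasFDerivAt (fderiv ℝ g) (fderiv ℝ (fderiv ℝ g) z) z := fun z =>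
    ((hg'.differentiable (by simp)) z).hasFDerivAt
  have h1 : ∀ s q, fderiv ℝ (f s) q = (fderiv ℝ g (s, q)).comp (ContinuousLinearMap.inr ℝ ℝ P) :=
    fun s q => ((hd (s, q)).comp q (hasFDerivAt_prodMk_right s q)).fderiv
  have h2 : ∀ s q, deriv (fun s => f s q) s = fderiv ℝ g (s, q) (1, 0) := by
    intro s q
    exact ((hd (s, q)).comp_hasDerivAt s ((hasDerivAt_id s).prodMk (hasDerivAt_const s q))).deriv
  have h3 : HasDerivAt (fun s => fderiv ℝ g (s, p)) (fderiv ℝ (fderiv ℝ g) (t, p) (1, 0)) t :=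
    (hdd (t, p)).comp_hasDerivAt t ((hasDerivAt_id t).prodMk (hasDerivAt_const t p))
  have h4 : HasFDerivAt (fun q => fderiv ℝ g (t, q)) ((fderiv ℝ (fderiv ℝ g) (t, p)).comp
      (ContinuousLinearMap.inr ℝ ℝ P)) p := (hdd (t, p)).comp p (hasFDerivAt_prodMk_right t p)
  have hsymm : IsSymmSndFDerivAt ℝ g (t, p) :=
    (hf.contDiffAt).isSymmSndFDerivAt
      (by rw [minSmoothness_of_isRCLikeNormedField]; exact ENat.LEInfty.out)
  simp only [h1, h2]
  have h5 : HasDerivAt (fun s => (fderiv ℝ g (s, p)).comp (ContinuousLinearMap.inr ℝ ℝ P))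
      ((fderiv ℝ (fderiv ℝ g) (t, p) (1, 0)).comp (ContinuousLinearMap.inr ℝ ℝ P)) t :=
    (((ContinuousLinearMap.compL ℝ P (ℝ × P) F).flip
      (ContinuousLinearMap.inr ℝ ℝ P)).hasFDerivAt.comp_hasDerivAt t h3)
  convert h5 using 1
  have h6 : HasFDerivAt (fun q => fderiv ℝ g (t, q) (1, 0)) _ p :=
    ((ContinuousLinearMap.apply ℝ F ((1, 0) : ℝ × P)).hasFDerivAt).comp p h4
  rw [h6.fderiv]
  ext h
  exact hsymm _ _

theorem hasDerivAt_iteratedFDeriv {f : ℝ → P → F} (hf : ContDiff ℝ ∞ (Function.uncurry f))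
    (k : ℕ) (t : ℝ) (p : P) : HasDerivAt (fun s => iteratedFDeriv ℝ k (f s) p)
      (iteratedFDeriv ℝ k (fun p => deriv (fun s => f s p) t) p) t := by
  induction k generalizing F with
  | zero =>
    simp only [iteratedFDeriv_zero_eq_comp]
    have h : DifferentiableAt ℝ (fun s => f s p) t :=
      (((hf.differentiable (by simp)) (t, p)).comp t
        (f := fun s : ℝ => (s, p)) (by fun_prop))
    exact ((continuousMultilinearCurryFin0 ℝ P F).symm.toContinuousLinearEquiv.hasFDerivAt).comp_hasDerivAt
      t h.hasDerivAt
  | succ k ih =>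
    have h1 := ih (f := fun t p => fderiv ℝ (f t) p) (contDiff_fderiv_snd hf)
    have h2 : (fun p => deriv (fun s => fderiv ℝ (f s) p) t)
        = fderiv ℝ (fun p => deriv (fun s => f s p) t) := by
      funext q; exact (hasDerivAt_fderiv_snd hf t q).deriv
    rw [h2] at h1
    simp only [iteratedFDeriv_succ_eq_comp_right]
    exact ((continuousMultilinearCurryRightEquiv' ℝ k P
      F).symm.toContinuousLinearEquiv.hasFDerivAt).comp_hasDerivAt t h1

end TimeDerivative

/-! ### Gronwall and mean value estimates on `[-1, 1]`. -/

section Gronwall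

variable {E : Type} [NormedAddCommGroup E] [NormedSpace ℝ E]

/-- `gronwallBound` is homogeneous in initial size and forcing together. Bounding both by the same
`ε` lets it factor out, so a later `ε` containing `M ^ k` enters only linearly. Negative times are
handled by reflection. -/
theorem norm_le_gronwallBound_mul_of_abs_le_one {f f' : ℝ → E} {K ε : ℝ} (hK : 0 ≤ K)
    (hε : 0 ≤ ε) (hd : ∀ t, |t| ≤ 1 → HasDerivAt f (f' t) t) (h0 : ‖f 0‖ ≤ ε)
    (hb : ∀ t, |t| ≤ 1 → ‖f' t‖ ≤ K * ‖f t‖ + ε) {t : ℝ} (ht : |t| ≤ 1) :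
    ‖f t‖ ≤ gronwallBound 1 K 1 1 * ε := by
  have hscale : ∀ x, gronwallBound ε K ε x = gronwallBound 1 K 1 x * ε := by
    intro x
    unfold gronwallBound
    split_ifs <;> ring
  have main : ∀ {f f' : ℝ → E}, (∀ t, |t| ≤ 1 → HasDerivAt f (f' t) t) → ‖f 0‖ ≤ ε →
      (∀ t, |t| ≤ 1 → ‖f' t‖ ≤ K * ‖f t‖ + ε) → ∀ t ∈ Set.Icc (0 : ℝ) 1,
      ‖f t‖ ≤ gronwallBound 1 K 1 1 * ε := by
    intro f f' hd h0 hb t ht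
    have habs : ∀ s ∈ Set.Icc (0 : ℝ) 1, |s| ≤ 1 := fun s hs => by
      rw [abs_of_nonneg hs.1]; exact hs.2
    have h1 := norm_le_gronwallBound_of_norm_deriv_right_le (f := f) (f' := f') (δ := ε) (K := K)
      (ε := ε) (a := 0) (b := 1)
      (fun s hs => (hd s (habs s hs)).continuousAt.continuousWithinAt)
      (fun s hs => (hd s (habs s (Set.Ico_subset_Icc_self hs))).hasDerivWithinAt) h0
      (fun s hs => hb s (habs s (Set.Ico_subset_Icc_self hs))) t ht
    rw [sub_zero, hscale] at h1
    exact h1.trans (mul_le_mul_of_nonneg_right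
      (gronwallBound_mono zero_le_one zero_le_one hK ht.2) hε)
  rcases le_total 0 t with h | h
  · exact main hd h0 hb t ⟨h, (le_abs_self t).trans ht⟩
  · have := main (f := fun s => f (-s)) (f' := fun s => -f' (-s))
      (fun s hs => by
        have h1 := HasDerivAt.scomp s (hd (-s) (by rwa [abs_neg])) (hasDerivAt_neg s)
        rwa [neg_one_smul] at h1)
      (by simpa using h0)
      (fun s hs => by
        rw [norm_neg]
        exact hb (-s) (by rwa [abs_neg]))
      (-t) ⟨by linarith, by rw [abs_of_nonpos h] at ht; exact ht⟩
    simpa using this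

theorem norm_sub_le_mul_abs_of_deriv_le {f f' : ℝ → E} {C : ℝ}
    (hd : ∀ t, |t| ≤ 1 → HasDerivAt f (f' t) t) (hb : ∀ t, |t| ≤ 1 → ‖f' t‖ ≤ C) {t : ℝ}
    (ht : |t| ≤ 1) : ‖f t - f 0‖ ≤ C * |t| := by
  have h := Convex.norm_image_sub_le_of_norm_hasDerivWithin_le (f := f) (f' := f') (C := C)
    (s := Set.Icc (-1 : ℝ) 1) (x := 0) (y := t)
    (fun s hs => (hd s (abs_le.2 hs)).hasDerivWithinAt) (fun s hs => hb s (abs_le.2 hs))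
    (convex_Icc _ _) (by simp) (abs_le.1 ht)
  simpa using h

end Gronwall

/-! ### From multi-index derivatives to Fréchet derivatives. -/

section PartialDerivatives

variable {d : ℕ} {ι F : Type} [NormedAddCommGroup F] [NormedSpace ℝ F]

theorem contDiff_pd {f : Sp d → F} (hf : ContDiff ℝ ∞ f) (i : Fin d) : ContDiff ℝ ∞ (pd i f) :=
  (hf.fderiv_right (m := ∞) (by simp)).clm_apply contDiff_const

theorem contDiff_iterate_pd {f : Sp d → F} (hf : ContDiff ℝ ∞ f) (i : Fin d) (n : ℕ) :
    ContDiff ℝ ∞ ((pd i)^[n] f) := by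
  induction n with
  | zero => exact hf
  | succ n ih => rw [Function.iterate_succ_apply']; exact contDiff_pd ih i

theorem pd_comm {f : Sp d → F} (hf : ContDiff ℝ ∞ f) (i j : Fin d) :
    pd i (pd j f) = pd j (pd i f) := by
  have key : ∀ a b : Fin d, ∀ x, pd a (pd b f) x
      = fderiv ℝ (fderiv ℝ f) x (EuclideanSpace.single a 1) (EuclideanSpace.single b 1) := by
    intro a b x
    have h1 : HasFDerivAt (fderiv ℝ f) (fderiv ℝ (fderiv ℝ f) x) x :=
      (((hf.fderiv_right (m := ∞) (by simp)).differentiable (by simp)) x).hasFDerivAt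
    have h2 : HasFDerivAt (pd b f) _ x :=
      ((ContinuousLinearMap.apply ℝ F
        (EuclideanSpace.single b (1 : ℝ) : Sp d)).hasFDerivAt).comp x h1
    unfold pd at h2 ⊢
    rw [h2.fderiv]
    rfl
  funext x
  rw [key, key]
  exact (hf.contDiffAt.isSymmSndFDerivAt
    (by rw [minSmoothness_of_isRCLikeNormedField]; exact ENat.LEInfty.out)) _ _

theorem pd_iterate_pd_comm {f : Sp d → F} (hf : ContDiff ℝ ∞ f) (i j : Fin d) (n : ℕ) :
    pd i ((pd j)^[n] f) = (pd j)^[n] (pd i f) := by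
  induction n with
  | zero => rfl
  | succ n ih =>
    rw [Function.iterate_succ_apply', Function.iterate_succ_apply',
      pd_comm (contDiff_iterate_pd hf j n), ih]

/-- Iterated partial derivatives in the directions of a list. -/
noncomputable def listPd (β : MIdx d) (l : List (Fin d)) (f : Sp d → F) : Sp d → F :=
  l.foldr (fun i u => (pd i)^[β i] u) f

theorem listPd_cons (β : MIdx d) (j : Fin d) (l : List (Fin d)) (f : Sp d → F) :
    listPd β (j :: l) f = (pd j)^[β j] (listPd β l f) := rfl

theorem contDiff_listPd {f : Sp d → F} (hf : ContDiff ℝ ∞ f) (β : MIdx d) (l : List (Fin d)) :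
    ContDiff ℝ ∞ (listPd β l f) := by
  induction l with
  | nil => exact hf
  | cons j l ih => exact contDiff_iterate_pd ih _ _

theorem pd_listPd_comm {f : Sp d → F} (hf : ContDiff ℝ ∞ f) (β : MIdx d) (i : Fin d)
    (l : List (Fin d)) : pd i (listPd β l f) = listPd β l (pd i f) := by
  induction l with
  | nil => rfl
  | cons j l ih =>
    rw [listPd_cons, pd_iterate_pd_comm (contDiff_listPd hf β l), ih, listPd_cons]

theorem listPd_add_single_of_notMem (β : MIdx d) {i : Fin d} {l : List (Fin d)} (hi : i ∉ l)
    (f : Sp d → F) : listPd (β + Pi.single i 1) l f = listPd β l f := by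
  induction l with
  | nil => rfl
  | cons j l ih =>
    have hj : j ≠ i := fun h => hi (h ▸ List.mem_cons_self)
    rw [listPd_cons, listPd_cons, ih fun h => hi (List.mem_cons_of_mem _ h)]
    simp [hj]

/-- Since `l` has no repetitions, the extra derivative appears in exactly one slot, from which it
commutes inward to `f`. -/
theorem listPd_add_single {f : Sp d → F} (hf : ContDiff ℝ ∞ f) (β : MIdx d) {i : Fin d}
    {l : List (Fin d)} (hl : l.Nodup) (hi : i ∈ l) :
    listPd (β + Pi.single i 1) l f = listPd β l (pd i f) := by
  induction l with
  | nil => simp at hi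
  | cons j l ih =>
    rw [List.nodup_cons] at hl
    rw [listPd_cons, listPd_cons]
    by_cases hj : j = i
    · subst hj
      rw [listPd_add_single_of_notMem β hl.1, ← pd_listPd_comm hf]
      simp [Function.iterate_succ_apply]
    · rw [ih hl.2 ((List.mem_cons.1 hi).resolve_left (Ne.symm hj))]
      simp [hj]

theorem multiPd_pd {f : Sp d → F} (hf : ContDiff ℝ ∞ f) (β : MIdx d) (i : Fin d) :
    multiPd β (pd i f) = multiPd (β + Pi.single i 1) f :=
  (listPd_add_single hf β (List.nodup_finRange d) (List.mem_finRange i)).symm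

theorem order_add_single (β : MIdx d) (i : Fin d) :
    MIdx.order (β + Pi.single i 1) = β.order + 1 := by
  simp [MIdx.order, Finset.sum_add_distrib]

theorem multiPd_of_order_eq_zero {β : MIdx d} (hβ : β.order = 0) (f : Sp d → F) :
    multiPd β f = f := by
  have h0 : ∀ i, β i = 0 := fun i => by
    simpa using (Finset.sum_eq_zero_iff.1 hβ) i (Finset.mem_univ i)
  unfold multiPd
  simp [h0]

/-- The operator of rank one with values in `F` attached to the `i`-th coordinate. -/
noncomputable def coordRank (i : Fin d) : F →L[ℝ] Sp d →L[ℝ] F :=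
  ContinuousLinearMap.smulRightL ℝ (Sp d) F (EuclideanSpace.proj i)

theorem fderiv_eq_sum_pd (f : Sp d → F) (x : Sp d) :
    fderiv ℝ f x = ∑ i, coordRank i (pd i f x) := by
  refine ContinuousLinearMap.ext fun v => ?_
  conv_lhs => rw [← (EuclideanSpace.basisFun (Fin d) ℝ).sum_repr v]
  simp [coordRank, pd]

/-- Induction on the order: `fderiv` is a fixed linear combination of the `pd i f`, and `multiPd_pd`
absorbs the additional partial derivative into the multi-index. The coefficients do not involve `τ`,
which keeps the constant uniform. -/
theorem exists_norm_iteratedFDeriv_le_of_multiPd {f : ι → Sp d → F} {p : ι → Sp d} {B : ι → ℝ}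
    (n : ℕ) (hf : ∀ τ, ContDiff ℝ ∞ (f τ))
    (h : ∀ β : MIdx d, β.order = n → ∃ C, ∀ τ, ‖multiPd β (f τ) (p τ)‖ ≤ C * B τ) :
    ∃ C, ∀ τ, ‖iteratedFDeriv ℝ n (f τ) (p τ)‖ ≤ C * B τ := by
  induction n generalizing f with
  | zero =>
    have h0 : MIdx.order (0 : MIdx d) = 0 := by simp [MIdx.order]
    obtain ⟨C, hC⟩ := h 0 h0
    refine ⟨C, fun τ => ?_⟩
    rw [norm_iteratedFDeriv_zero]
    simpa only [multiPd_of_order_eq_zero h0] using hC τ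
  | succ n ih =>
    have h1 : ∀ i : Fin d, ∃ C, ∀ τ, ‖iteratedFDeriv ℝ n (pd i (f τ)) (p τ)‖ ≤ C * B τ := by
      intro i
      refine ih (f := fun τ => pd i (f τ)) (fun τ => contDiff_pd (hf τ) i) fun β hβ => ?_
      obtain ⟨C, hC⟩ := h (β + Pi.single i 1) (by rw [order_add_single, hβ])
      exact ⟨C, fun τ => by rw [multiPd_pd (hf τ)]; exact hC τ⟩
    choose C hC using h1
    refine ⟨∑ i, ‖(coordRank i : F →L[ℝ] Sp d →L[ℝ] F)‖ * C i, fun τ => ?_⟩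
    have h2 : fderiv ℝ (f τ) = fun x => ∑ i, coordRank i (pd i (f τ) x) := by
      funext x; exact fderiv_eq_sum_pd _ _
    rw [← norm_iteratedFDeriv_fderiv, h2, iteratedFDeriv_fun_sum_apply, Finset.sum_mul]
    · refine (norm_sum_le _ _).trans (Finset.sum_le_sum fun i _ => ?_)
      have := (coordRank i : F →L[ℝ] Sp d →L[ℝ] F).norm_iteratedFDeriv_comp_left (n := n)
        (N := ∞) (x := p τ) (contDiff_pd (hf τ) i).contDiffAt (by exact_mod_cast le_top)
      refine this.trans ?_
      rw [mul_assoc]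
      exact mul_le_mul_of_nonneg_left (hC i τ) (norm_nonneg _)
    · intro i _
      have h3 : ContDiff ℝ ∞ fun x => coordRank i (pd i (f τ) x) :=
        (coordRank i : F →L[ℝ] Sp d →L[ℝ] F).contDiff.comp (contDiff_pd (hf τ) i)
      exact (h3.of_le (by exact_mod_cast le_top)).contDiffAt

theorem SymBdd.of_multiPd {M : ι → ℝ} {k : ℕ} {f : ι → Sp d → F} {p : ι → Sp d}
    (hf : ∀ τ, ContDiff ℝ ∞ (f τ))
    (h : ∀ β : MIdx d, β.order ≤ k → ∃ C, ∀ τ, ‖multiPd β (f τ) (p τ)‖ ≤ C * M τ ^ β.order) :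
    SymBdd k M f p :=
  ⟨hf, fun i hi => exists_norm_iteratedFDeriv_le_of_multiPd (B := fun τ => M τ ^ i) i hf
    fun β hβ => by simpa only [hβ] using h β (hβ ▸ hi)⟩

theorem SymBdd.of_pd {M : ι → ℝ} {k : ℕ} {f : ι → Sp d → F} {p : ι → Sp d} (hM : ∀ τ, 1 ≤ M τ)
    (hf : ∀ τ, ContDiff ℝ ∞ (f τ)) (h0 : ∃ C, ∀ τ, ‖f τ (p τ)‖ ≤ C)
    (h : ∀ i, SymBdd k M (fun τ => pd i (f τ)) p) : SymBdd (k + 1) M f p := by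
  refine SymBdd.of_fderiv hM hf h0 ?_
  have : (fun τ => fderiv ℝ (f τ)) = fun τ x => ∑ i, coordRank i (pd i (f τ) x) := by
    funext τ x; exact fderiv_eq_sum_pd _ _
  rw [this]
  exact SymBdd.sum _ fun i _ => (h i).clm (coordRank i)

end PartialDerivatives

/-! ### Mixed partial derivatives as values of iterated Fréchet derivatives. -/

section Mixed

variable {d : ℕ} {P F : Type} [NormedAddCommGroup P] [NormedSpace ℝ P]
  [NormedAddCommGroup F] [NormedSpace ℝ F]

/-- The derivative in the direction `h`. -/
noncomputable def dirDeriv (h : P) (f : P → F) : P → F := fun p => fderiv ℝ f p h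

theorem contDiff_dirDeriv {f : P → F} (hf : ContDiff ℝ ∞ f) (h : P) :
    ContDiff ℝ ∞ (dirDeriv h f) :=
  (hf.fderiv_right (m := ∞) (by simp)).clm_apply contDiff_const

/-- `T` is an `n`-fold iterated derivative in directions of norm at most `1`. -/
def IsIteratedDeriv (n : ℕ) (T : (P → F) → P → F) : Prop :=
  ∃ v : Fin n → P, (∀ i, ‖v i‖ ≤ 1) ∧
    ∀ f : P → F, ContDiff ℝ ∞ f → ∀ p, T f p = iteratedFDeriv ℝ n f p v

theorem isIteratedDeriv_id : IsIteratedDeriv 0 (fun f : P → F => f) :=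
  ⟨fun i => i.elim0, fun i => i.elim0, fun f _ p => by simp⟩

theorem IsIteratedDeriv.dirDeriv {n : ℕ} {T : (P → F) → P → F} (hT : IsIteratedDeriv n T) {h : P}
    (hh : ‖h‖ ≤ 1) : IsIteratedDeriv (n + 1) (fun f => dirDeriv h (T f)) := by
  obtain ⟨v, hv, hTv⟩ := hT
  refine ⟨Fin.cons h v, fun i => ?_, fun f hf p => ?_⟩
  · refine Fin.cases ?_ (fun j => ?_) i
    · simpa using hh
    · simpa using hv j
  · have h1 : T f = fun p => iteratedFDeriv ℝ n f p v := funext (hTv f hf)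
    have h2 : DifferentiableAt ℝ (iteratedFDeriv ℝ n f) p :=
      (hf.differentiable_iteratedFDeriv (m := n) (by exact_mod_cast WithTop.coe_lt_top _)) p
    have h3 := ((ContinuousMultilinearMap.apply ℝ (fun _ : Fin n => P) F v).hasFDerivAt).comp p
      h2.hasFDerivAt
    rw [iteratedFDeriv_succ_apply_left]
    show fderiv ℝ (T f) p h = _
    rw [h1]
    show fderiv ℝ (ContinuousMultilinearMap.apply ℝ (fun _ : Fin n => P) F v ∘
      iteratedFDeriv ℝ n f) p h = _
    rw [h3.fderiv]
    simp [Fin.tail_cons]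

theorem IsIteratedDeriv.iterate_dirDeriv {n : ℕ} {T : (P → F) → P → F} (hT : IsIteratedDeriv n T)
    {h : P} (hh : ‖h‖ ≤ 1) (m : ℕ) :
    IsIteratedDeriv (n + m) (fun f => (GeodFlow.dirDeriv h)^[m] (T f)) := by
  induction m with
  | zero => exact hT
  | succ m ih =>
    simp only [Function.iterate_succ_apply']
    exact ih.dirDeriv hh

/-- Iterated directional derivatives along the vectors `e j`. -/
noncomputable def listDirDeriv (e : Fin d → P) (β : MIdx d) (l : List (Fin d)) (f : P → F) :
    P → F :=
  l.foldr (fun j u => (dirDeriv (e j))^[β j] u) f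

theorem contDiff_iterate_dirDeriv {f : P → F} (hf : ContDiff ℝ ∞ f) (h : P) (n : ℕ) :
    ContDiff ℝ ∞ ((dirDeriv h)^[n] f) := by
  induction n with
  | zero => exact hf
  | succ n ih => rw [Function.iterate_succ_apply']; exact contDiff_dirDeriv ih h

theorem contDiff_listDirDeriv {f : P → F} (hf : ContDiff ℝ ∞ f) (e : Fin d → P) (β : MIdx d)
    (l : List (Fin d)) : ContDiff ℝ ∞ (listDirDeriv e β l f) := by
  induction l with
  | nil => exact hf
  | cons j l ih => exact contDiff_iterate_dirDeriv ih _ _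

theorem IsIteratedDeriv.listDirDeriv {n : ℕ} {T : (P → F) → P → F} (hT : IsIteratedDeriv n T)
    {e : Fin d → P} (he : ∀ j, ‖e j‖ ≤ 1) (β : MIdx d) (l : List (Fin d)) :
    IsIteratedDeriv (n + (l.map β).sum) (fun f => GeodFlow.listDirDeriv e β l (T f)) := by
  induction l with
  | nil => exact hT
  | cons j l ih =>
    have h := ih.iterate_dirDeriv (he j) (β j)
    have h1 : n + ((j :: l).map β).sum = n + (l.map β).sum + β j := by
      rw [List.map_cons, List.sum_cons]; ring
    rw [h1]
    exact h

theorem sum_map_finRange (β : MIdx d) : ((List.finRange d).map β).sum = β.order := by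
  rw [MIdx.order, ← List.sum_ofFn, List.ofFn_eq_map]

/-- The chain rule along an affine slice: since the derivative `A` of `s` is constant, no further
terms appear when it is iterated. -/
theorem foldr_pd_comp {s : Sp d → P} {A : Sp d →L[ℝ] P} (hs : ∀ x, HasFDerivAt s A x)
    {f : P → F} (hf : ContDiff ℝ ∞ f) (β : MIdx d) (l : List (Fin d)) :
    l.foldr (fun i u => (pd i)^[β i] u) (fun x => f (s x)) = fun x =>
      listDirDeriv (fun j => A (EuclideanSpace.single j 1)) β l f (s x) := by
  have h1 : ∀ (j : Fin d) (u : P → F), ContDiff ℝ ∞ u → pd j (fun x => u (s x))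
      = fun x => dirDeriv (A (EuclideanSpace.single j 1)) u (s x) := by
    intro j u hu
    funext x
    have := (((hu.differentiable (by simp)) (s x)).hasFDerivAt).comp x (hs x)
    show fderiv ℝ (u ∘ s) x _ = _
    rw [this.fderiv]
    rfl
  have h2 : ∀ (j : Fin d) (n : ℕ) (u : P → F), ContDiff ℝ ∞ u → (pd j)^[n] (fun x => u (s x))
      = fun x => (dirDeriv (A (EuclideanSpace.single j 1)))^[n] u (s x) := by
    intro j n
    induction n with
    | zero => intro u _; rfl
    | succ n ih =>
      intro u hu
      rw [Function.iterate_succ_apply, h1 j u hu, ih _ (contDiff_dirDeriv hu _)]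
      rfl
  induction l with
  | nil => rfl
  | cons j l ih =>
    rw [List.foldr_cons, ih, h2 j _ _ (contDiff_listDirDeriv hf _ _ _)]
    rfl

/-- Mixed partial derivatives are values of the iterated derivative on vectors of norm `≤ 1`. -/
theorem exists_mixedPd_eq_iteratedFDeriv (β α : MIdx d) :
    ∃ v : Fin (α.order + β.order) → Sp d × Sp d, (∀ i, ‖v i‖ ≤ 1) ∧
      ∀ Φ : Sp d → Sp d → F, ContDiff ℝ ∞ (Function.uncurry Φ) → ∀ y w,
        mixedPd β α Φ y w
          = iteratedFDeriv ℝ (α.order + β.order) (Function.uncurry Φ) (y, w) v := by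
  let L := ContinuousLinearMap.inl ℝ (Sp d) (Sp d)
  let R := ContinuousLinearMap.inr ℝ (Sp d) (Sp d)
  let eL : Fin d → Sp d × Sp d := fun j => L (EuclideanSpace.single j 1)
  let eR : Fin d → Sp d × Sp d := fun j => R (EuclideanSpace.single j 1)
  have heL : ∀ j, ‖eL j‖ ≤ 1 := fun j => by simp [eL, L]
  have heR : ∀ j, ‖eR j‖ ≤ 1 := fun j => by simp [eR, R]
  -- The `w`-derivatives act first, along the second factor, then the `y`-derivatives along the
  -- first. The directions `v` are fixed before `Φ`, so that they can be shared by the flow at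
  -- different times.
  have h := ((isIteratedDeriv_id (P := Sp d × Sp d) (F := F)).listDirDeriv heR α
    (List.finRange d)).listDirDeriv heL β (List.finRange d)
  rw [zero_add, sum_map_finRange, sum_map_finRange] at h
  obtain ⟨v, hv, hvT⟩ := h
  refine ⟨v, hv, fun Φ hΦ y w => ?_⟩
  rw [← hvT _ hΦ]
  unfold mixedPd multiPd
  have h1 : ∀ y', (List.finRange d).foldr (fun i u => (pd i)^[α i] u) (fun w' => Φ y' w') w
      = listDirDeriv eR α (List.finRange d) (Function.uncurry Φ) (y', w) := fun y' =>
    congrFun (foldr_pd_comp (s := fun w' => (y', w')) (A := R)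
      (fun w' => hasFDerivAt_prodMk_right y' w') hΦ α (List.finRange d)) w
  simp only [h1]
  exact congrFun (foldr_pd_comp (s := fun y' => (y', w)) (A := L)
    (fun y' => hasFDerivAt_prodMk_left y' w)
    (contDiff_listDirDeriv hΦ eR α (List.finRange d)) β (List.finRange d)) y

end Mixed

/-! ### Smoothness and algebra of the metric and its inverse. -/

section Smooth

variable {d : ℕ} {g : MetricField d}

theorem IsRiemannianMetric.symm (hg : IsRiemannianMetric g) (x : Sp d) (i j : Fin d) :
    g x i j = g x j i := by
  have := (hg.posDef x).1.apply j i
  simpa using this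

theorem IsRiemannianMetric.isUnit_det (hg : IsRiemannianMetric g) (x : Sp d) :
    IsUnit (g x).det := (hg.posDef x).det_pos.ne'.isUnit

theorem contDiff_det {E : Type} [NormedAddCommGroup E] [NormedSpace ℝ E]
    {A : E → Matrix (Fin d) (Fin d) ℝ} (hA : ∀ i j, ContDiff ℝ ∞ fun x => A x i j) :
    ContDiff ℝ ∞ fun x => (A x).det := by
  simp only [Matrix.det_apply]
  exact ContDiff.sum fun σ _ => (contDiff_prod fun i _ => hA _ _).const_smul _

/-- Cramer's rule gives a quotient of determinants, whose denominator never vanishes by positivity.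
-/
theorem IsRiemannianMetric.contDiff_upper (hg : IsRiemannianMetric g) (i j : Fin d) :
    ContDiff ℝ ∞ (upper g i j) := by
  have h1 : upper g i j = fun x => ((g x).det)⁻¹ * ((g x).updateRow j (Pi.single i 1)).det := by
    funext x
    rw [upper, Matrix.inv_def, Matrix.smul_apply, Matrix.adjugate_apply, smul_eq_mul,
      Ring.inverse_eq_inv']
  rw [h1]
  refine ((contDiff_det hg.smooth).inv fun x => (hg.posDef x).det_pos.ne').mul
    (contDiff_det fun a b => ?_)
  by_cases h : a = j
  · subst h
    simp only [Matrix.updateRow_self]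
    exact contDiff_const
  · simp only [Matrix.updateRow_ne h]
    exact hg.smooth a b

theorem IsRiemannianMetric.contDiff_christoffel (hg : IsRiemannianMetric g) (n i j : Fin d) :
    ContDiff ℝ ∞ (christoffel g n i j) :=
  contDiff_const.mul (ContDiff.sum fun m _ => (hg.contDiff_upper n m).mul
    (((contDiff_pd (hg.smooth m j) i).add (contDiff_pd (hg.smooth m i) j)).sub
      (contDiff_pd (hg.smooth i j) m)))

theorem IsRiemannianMetric.contDiff_riemann (hg : IsRiemannianMetric g) (i j k l : Fin d) :
    ContDiff ℝ ∞ (riemann g i j k l) :=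
  ContDiff.sum fun n _ => (hg.smooth l n).mul
    (((contDiff_pd (hg.contDiff_christoffel n j k) i).sub
      (contDiff_pd (hg.contDiff_christoffel n i k) j)).add
      (ContDiff.sum fun m _ =>
        ((hg.contDiff_christoffel m j k).mul (hg.contDiff_christoffel n i m)).sub
        ((hg.contDiff_christoffel m i k).mul (hg.contDiff_christoffel n j m))))

theorem IsRiemannianMetric.christoffel_symm (hg : IsRiemannianMetric g) (n i j : Fin d)
    (x : Sp d) : christoffel g n i j x = christoffel g n j i x := by
  unfold christoffel
  have h : (fun z => g z i j) = fun z => g z j i := funext fun z => hg.symm z i j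
  congr 1
  refine Finset.sum_congr rfl fun m _ => ?_
  rw [h]; ring

theorem IsRiemannianMetric.sum_upper_mul (hg : IsRiemannianMetric g) (x : Sp d) (a j : Fin d) :
    ∑ b, upper g a b x * g x b j = (1 : Matrix (Fin d) (Fin d) ℝ) a j := by
  rw [← Matrix.nonsing_inv_mul (g x) (hg.isUnit_det x), Matrix.mul_apply]; rfl

theorem IsRiemannianMetric.sum_mul_upper (hg : IsRiemannianMetric g) (x : Sp d) (a j : Fin d) :
    ∑ b, g x a b * upper g b j x = (1 : Matrix (Fin d) (Fin d) ℝ) a j := by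
  rw [← Matrix.mul_nonsing_inv (g x) (hg.isUnit_det x), Matrix.mul_apply]; rfl

/-- Obtained by differentiating `g⁻¹ g = 1` and multiplying by `g` on the left. It transfers the
hypotheses on derivatives of `g⁻¹` to derivatives of `g`. -/
theorem IsRiemannianMetric.pd_eq (hg : IsRiemannianMetric g) (k i j : Fin d) (x : Sp d) :
    pd k (fun z => g z i j) x = -∑ a, ∑ b, g x i a * pd k (upper g a b) x * g x b j := by
  have h1 : ∀ a, ∑ b, (pd k (upper g a b) x * g x b j + upper g a b x * pd k (fun z => g z b j) x)
      = 0 := by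
    intro a
    have h2 : (fun z => ∑ b, upper g a b z * g z b j)
        = fun _ => (1 : Matrix (Fin d) (Fin d) ℝ) a j := funext fun z => hg.sum_upper_mul z a j
    have h3 : pd k (fun z => ∑ b, upper g a b z * g z b j) x = 0 := by
      rw [h2]; simp [pd]
    have h4 : HasFDerivAt (fun z => ∑ b, upper g a b z * g z b j)
        (∑ b, (upper g a b x • fderiv ℝ (fun z => g z b j) x
          + g x b j • fderiv ℝ (upper g a b) x)) x :=
      HasFDerivAt.fun_sum fun b _ =>
        (((hg.contDiff_upper a b).differentiable (by simp)) x).hasFDerivAt.mul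
          (((hg.smooth b j).differentiable (by simp)) x).hasFDerivAt
    rw [pd, h4.fderiv] at h3
    rw [← h3, sum_apply]
    refine Finset.sum_congr rfl fun b _ => ?_
    simp only [pd, add_apply, smul_apply, smul_eq_mul]
    ring
  have h5 : ∑ a, g x i a *
      ∑ b, (pd k (upper g a b) x * g x b j + upper g a b x * pd k (fun z => g z b j) x) = 0 := by
    simp only [h1, mul_zero, Finset.sum_const_zero]
  simp only [Finset.sum_add_distrib, mul_add, Finset.mul_sum] at h5
  have h6 : ∑ a, ∑ b, g x i a * (upper g a b x * pd k (fun z => g z b j) x)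
      = pd k (fun z => g z i j) x := by
    rw [Finset.sum_comm]
    have : ∀ b, ∑ a, g x i a * (upper g a b x * pd k (fun z => g z b j) x)
        = (1 : Matrix (Fin d) (Fin d) ℝ) i b * pd k (fun z => g z b j) x := by
      intro b
      rw [← hg.sum_mul_upper x i b, Finset.sum_mul]
      exact Finset.sum_congr rfl fun a _ => by ring
    simp only [this]
    rw [Finset.sum_eq_single i]
    · simp
    · intro b _ hb; simp [Matrix.one_apply_ne (Ne.symm hb)]
    · simp
  rw [h6] at h5
  rw [eq_neg_iff_add_eq_zero, add_comm, ← h5]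
  congr 1
  exact Finset.sum_congr rfl fun a _ => Finset.sum_congr rfl fun b _ => by ring

end Smooth

section Generic

variable {E F G : Type} [NormedAddCommGroup E] [NormedSpace ℝ E] [NormedAddCommGroup F]
  [NormedSpace ℝ F] [NormedAddCommGroup G] [NormedSpace ℝ G]

theorem contDiff_smul_const {f : E → ℝ} (hf : ContDiff ℝ ∞ f) (c : F) :
    ContDiff ℝ ∞ fun x => f x • c := hf.smul contDiff_const

theorem hasFDerivAt_clm_comp (L : F →L[ℝ] G) {f : E → F} {f' : E →L[ℝ] F} {x : E}
    (h : HasFDerivAt f f' x) : HasFDerivAt (fun y => L (f y)) (L.comp f') x :=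
  L.hasFDerivAt.comp x h

end Generic

/-! ### Christoffel symbols and curvature as operator-valued fields. -/

section Tensors

variable {d : ℕ}

@[simp] theorem coordRank_apply {F : Type} [NormedAddCommGroup F] [NormedSpace ℝ F] (i : Fin d)
    (c : F) (u : Sp d) : coordRank i c u = u i • c := rfl

/-- The Christoffel symbols as a field of vector-valued bilinear maps. -/
noncomputable def chr (g : MetricField d) (x : Sp d) : Sp d →L[ℝ] Sp d →L[ℝ] Sp d :=
  ∑ n, ∑ i, ∑ j, christoffel g n i j x •
    coordRank i (coordRank j (EuclideanSpace.single n (1 : ℝ) : Sp d))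

/-- The curvature operator `Y ↦ R(X, Y) Z`. -/
noncomputable def curv (g : MetricField d) (x X Z : Sp d) : Sp d →L[ℝ] Sp d :=
  ∑ n, ∑ i, ∑ j, ∑ k, ((∑ l, upper g n l x * riemann g i j k l x) * (X i * Z k)) •
    coordRank j (EuclideanSpace.single n (1 : ℝ) : Sp d)

variable {g : MetricField d}

theorem sum_apply_coord {J : Type} (s : Finset J) (f : J → Sp d) (n : Fin d) :
    (∑ j ∈ s, f j) n = ∑ j ∈ s, f j n := by
  simp

theorem chr_apply (g : MetricField d) (x u v : Sp d) (n : Fin d) :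
    chr g x u v n = ∑ i, ∑ j, christoffel g n i j x * u i * v j := by
  simp only [chr, sum_apply, smul_apply, coordRank_apply, sum_apply_coord]
  rw [Finset.sum_eq_single n]
  · refine Finset.sum_congr rfl fun i _ => Finset.sum_congr rfl fun j _ => ?_
    simp [mul_assoc]
  · intro m _ hm
    refine Finset.sum_eq_zero fun i _ => Finset.sum_eq_zero fun j _ => ?_
    simp [hm.symm]
  · simp

theorem curv_apply (g : MetricField d) (x X Y Z : Sp d) (n : Fin d) :
    curv g x X Z Y n = ∑ i, ∑ j, ∑ k, (∑ l, upper g n l x * riemann g i j k l x) *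
      (X i * Y j * Z k) := by
  simp only [curv, sum_apply, smul_apply, coordRank_apply, sum_apply_coord]
  rw [Finset.sum_eq_single n]
  · refine Finset.sum_congr rfl fun i _ => Finset.sum_congr rfl fun j _ =>
      Finset.sum_congr rfl fun k _ => ?_
    simp only [PiLp.smul_apply, PiLp.single_apply, if_true, smul_eq_mul]
    ring
  · intro m _ hm
    refine Finset.sum_eq_zero fun i _ => Finset.sum_eq_zero fun j _ =>
      Finset.sum_eq_zero fun k _ => ?_
    simp [hm.symm]
  · simp

theorem IsRiemannianMetric.chr_symm (hg : IsRiemannianMetric g) (x u v : Sp d) :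
    chr g x u v = chr g x v u := by
  ext n
  rw [chr_apply, chr_apply, Finset.sum_comm]
  refine Finset.sum_congr rfl fun i _ => Finset.sum_congr rfl fun j _ => ?_
  rw [hg.christoffel_symm n j i]; ring

theorem IsRiemannianMetric.contDiff_chr (hg : IsRiemannianMetric g) : ContDiff ℝ ∞ (chr g) :=
  ContDiff.sum fun n _ => ContDiff.sum fun i _ => ContDiff.sum fun j _ =>
    contDiff_smul_const (hg.contDiff_christoffel n i j) _

theorem fderiv_eq_sum_mul_pd (f : Sp d → ℝ) (x X : Sp d) :
    fderiv ℝ f x X = ∑ i, X i * pd i f x := by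
  rw [fderiv_eq_sum_pd]
  simp [sum_apply]

theorem IsRiemannianMetric.fderiv_chr_apply (hg : IsRiemannianMetric g) (x X Y Z : Sp d)
    (n : Fin d) : fderiv ℝ (chr g) x X Y Z n
      = ∑ j, ∑ k, (∑ i, X i * pd i (christoffel g n j k) x) * Y j * Z k := by
  let ev : (Sp d →L[ℝ] Sp d →L[ℝ] Sp d) →L[ℝ] ℝ :=
    (EuclideanSpace.proj n : Sp d →L[ℝ] ℝ).comp ((ContinuousLinearMap.apply ℝ (Sp d) Z).comp
      (ContinuousLinearMap.apply ℝ (Sp d →L[ℝ] Sp d) Y))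
  have h1 : HasFDerivAt (fun x => chr g x Y Z n) (ev.comp (fderiv ℝ (chr g) x)) x :=
    hasFDerivAt_clm_comp ev ((hg.contDiff_chr.differentiable (by simp)) x).hasFDerivAt
  have h2 : HasFDerivAt (fun x => ∑ j, ∑ k, christoffel g n j k x * (Y j * Z k))
      (∑ j, ∑ k, (Y j * Z k) • fderiv ℝ (christoffel g n j k) x) x :=
    HasFDerivAt.fun_sum fun j _ => HasFDerivAt.fun_sum fun k _ =>
      ((((hg.contDiff_christoffel n j k).differentiable (by simp)) x).hasFDerivAt).mul_const _
  have h3 : (fun x => chr g x Y Z n) = fun x => ∑ j, ∑ k, christoffel g n j k x * (Y j * Z k) := by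
    funext x
    rw [chr_apply]
    exact Finset.sum_congr rfl fun j _ => Finset.sum_congr rfl fun k _ => by ring
  rw [h3] at h1
  have h4 := DFunLike.congr_fun (h1.unique h2) X
  refine Eq.trans (by rfl) (h4.trans ?_)
  simp only [sum_apply, smul_apply, smul_eq_mul, fderiv_eq_sum_mul_pd]
  exact Finset.sum_congr rfl fun j _ => Finset.sum_congr rfl fun k _ => by ring

/-- The curvature operator in terms of the Christoffel symbols. -/
theorem IsRiemannianMetric.curv_eq (hg : IsRiemannianMetric g) (x X Y Z : Sp d) :
    curv g x X Z Y = fderiv ℝ (chr g) x X Y Z - fderiv ℝ (chr g) x Y X Z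
      + chr g x X (chr g x Y Z) - chr g x Y (chr g x X Z) := by
  -- Raising the last index undoes the contraction with `g` in `riemann` and leaves the expression
  -- in Christoffel symbols.
  have raise : ∀ n i j k, ∑ l, upper g n l x * riemann g i j k l x
      = pd i (christoffel g n j k) x - pd j (christoffel g n i k) x
      + ∑ m, (christoffel g m j k x * christoffel g n i m x
          - christoffel g m i k x * christoffel g n j m x) := by
    intro n i j k
    unfold riemann
    simp only [Finset.mul_sum, ← mul_assoc]
    rw [Finset.sum_comm]
    simp only [← Finset.sum_mul, hg.sum_upper_mul]
    rw [Finset.sum_eq_single n]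
    · simp
    · intro b _ hb; simp [Matrix.one_apply_ne (Ne.symm hb)]
    · simp
  ext n
  simp only [PiLp.sub_apply, PiLp.add_apply, curv_apply, raise, hg.fderiv_chr_apply]
  rw [chr_apply g x X, chr_apply g x Y]
  simp only [chr_apply, Finset.sum_mul, Finset.mul_sum]
  -- The four terms on the right are reordered as sums over `i`, `j`, `k` (and `m`), after which the
  -- identity holds summand by summand.
  have e1 : ∑ j, ∑ k, ∑ i, X i * pd i (christoffel g n j k) x * Y j * Z k
      = ∑ i, ∑ j, ∑ k, pd i (christoffel g n j k) x * (X i * Y j * Z k) := by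
    rw [Finset.sum_comm (f := fun i j => ∑ k, pd i (christoffel g n j k) x * (X i * Y j * Z k))]
    refine Finset.sum_congr rfl fun j _ => ?_
    rw [Finset.sum_comm]
    exact Finset.sum_congr rfl fun i _ => Finset.sum_congr rfl fun k _ => by ring
  have e2 : ∑ i, ∑ k, ∑ j, Y j * pd j (christoffel g n i k) x * X i * Z k
      = ∑ i, ∑ j, ∑ k, pd j (christoffel g n i k) x * (X i * Y j * Z k) := by
    refine Finset.sum_congr rfl fun i _ => ?_
    rw [Finset.sum_comm]
    exact Finset.sum_congr rfl fun j _ => Finset.sum_congr rfl fun k _ => by ring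
  have e3 : ∑ i, ∑ m, ∑ j, ∑ k, christoffel g n i m x * X i * (christoffel g m j k x * Y j * Z k)
      = ∑ i, ∑ j, ∑ k, ∑ m, christoffel g m j k x * christoffel g n i m x
          * (X i * Y j * Z k) := by
    refine Finset.sum_congr rfl fun i _ => ?_
    rw [Finset.sum_comm]
    refine Finset.sum_congr rfl fun j _ => ?_
    rw [Finset.sum_comm]
    exact Finset.sum_congr rfl fun k _ => Finset.sum_congr rfl fun m _ => by ring
  have e4 : ∑ j, ∑ m, ∑ i, ∑ k, christoffel g n j m x * Y j * (christoffel g m i k x * X i * Z k)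
      = ∑ i, ∑ j, ∑ k, ∑ m, christoffel g m i k x * christoffel g n j m x
          * (X i * Y j * Z k) := by
    rw [Finset.sum_comm]
    have : ∀ m, ∑ j, ∑ i, ∑ k, christoffel g n j m x * Y j * (christoffel g m i k x * X i * Z k)
        = ∑ i, ∑ j, ∑ k, christoffel g m i k x * christoffel g n j m x * (X i * Y j * Z k) := by
      intro m
      rw [Finset.sum_comm]
      exact Finset.sum_congr rfl fun i _ => Finset.sum_congr rfl fun j _ =>
        Finset.sum_congr rfl fun k _ => by ring
    simp only [this]
    rw [Finset.sum_comm]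
    refine Finset.sum_congr rfl fun i _ => ?_
    rw [Finset.sum_comm]
    refine Finset.sum_congr rfl fun j _ => ?_
    rw [Finset.sum_comm]
  rw [e1, e2, e3, e4, ← Finset.sum_sub_distrib, ← Finset.sum_add_distrib, ← Finset.sum_sub_distrib]
  refine Finset.sum_congr rfl fun i _ => ?_
  rw [← Finset.sum_sub_distrib, ← Finset.sum_add_distrib, ← Finset.sum_sub_distrib]
  refine Finset.sum_congr rfl fun j _ => ?_
  rw [← Finset.sum_sub_distrib, ← Finset.sum_add_distrib, ← Finset.sum_sub_distrib]
  refine Finset.sum_congr rfl fun k _ => ?_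
  rw [add_mul, Finset.sum_mul, sub_mul]
  simp only [sub_mul, Finset.sum_sub_distrib]
  ring

end Tensors

/-! ### Pointwise consequences of the smallness condition. -/

section SmallNorms

variable {d : ℕ} {g : MetricField d} {c : ℝ}

theorem abs_le_of_supNorm_le {f : Sp d → ℝ} (hc : 0 ≤ c) (h : supNorm f ≤ ENNReal.ofReal c)
    (x : Sp d) : |f x| ≤ c := by
  have h1 : ‖f x‖ₑ ≤ ENNReal.ofReal c := (le_iSup (fun x => ‖f x‖ₑ) x).trans h
  rwa [Real.enorm_eq_ofReal_abs, ENNReal.ofReal_le_ofReal_iff hc] at h1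

theorem SmallNorms.abs_riemann_le (h : SmallNorms g c) (hc : 0 ≤ c) (i j k l : Fin d) (x : Sp d) :
    |riemann g i j k l x| ≤ c := by
  refine abs_le_of_supNorm_le hc (le_trans ?_ ((le_self_add.trans le_self_add).trans h)) x
  exact le_iSup_of_le i (le_iSup_of_le j (le_iSup_of_le k (le_iSup_of_le l le_rfl)))

theorem SmallNorms.lipNorm_le (h : SmallNorms g c) (i j : Fin d) :
    lipNorm (fun x => g x i j - (1 : Matrix (Fin d) (Fin d) ℝ) i j) ≤ ENNReal.ofReal c := by
  refine le_trans ?_ ((le_add_self.trans le_self_add).trans h)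
  exact le_iSup_of_le i (le_iSup_of_le j le_rfl)

theorem SmallNorms.abs_sub_le (h : SmallNorms g c) (hc : 0 ≤ c) (i j : Fin d) (x : Sp d) :
    |g x i j - (1 : Matrix (Fin d) (Fin d) ℝ) i j| ≤ c :=
  abs_le_of_supNorm_le (f := fun x => g x i j - (1 : Matrix (Fin d) (Fin d) ℝ) i j) hc
    (le_self_add.trans (h.lipNorm_le i j)) x

theorem SmallNorms.abs_pd_le (h : SmallNorms g c) (hc : 0 ≤ c) (k i j : Fin d) (x : Sp d) :
    |pd k (fun z => g z i j) x| ≤ c := by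
  let f : Sp d → ℝ := fun x => g x i j - (1 : Matrix (Fin d) (Fin d) ℝ) i j
  have h1 : LipschitzWith c.toNNReal f := by
    intro a b
    have h2 : edist (f a) (f b) / edist a b ≤ ENNReal.ofReal c :=
      (((le_iSup (fun y => edist (f a) (f y) / edist a y) b).trans
        (le_iSup (fun x => ⨆ y, edist (f x) (f y) / edist x y) a)).trans le_add_self).trans
        (h.lipNorm_le i j)
    rcases eq_or_ne a b with rfl | hab
    · simp
    · exact (ENNReal.div_le_iff (by simpa using hab) (edist_ne_top a b)).1 h2
  have h3 : fderiv ℝ (fun z => g z i j) x = fderiv ℝ f x :=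
    (fderiv_sub_const _).symm
  have h4 := norm_fderiv_le_of_lipschitz ℝ h1 (x₀ := x)
  rw [pd, h3, ← Real.norm_eq_abs]
  refine ((fderiv ℝ f x).le_opNorm _).trans ?_
  simpa [Real.coe_toNNReal c hc] using h4

/-- The kinetic energy `g(v, v)` at the point `x`. -/
noncomputable def energy (g : MetricField d) (x v : Sp d) : ℝ := ∑ i, ∑ j, g x i j * v i * v j

/-- Cauchy–Schwarz turns `c * (∑ |v i|) ^ 2` into `c * d * ‖v‖ ^ 2`, and the threshold gives `c * d
≤ 1 / 2`. Using `d + 1` keeps the threshold meaningful for `d = 0`. -/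
theorem SmallNorms.abs_energy_sub_le (h : SmallNorms g c) (hc : 0 ≤ c)
    (hcd : c ≤ 1 / (2 * (d + 1))) (x v : Sp d) : |energy g x v - ‖v‖ ^ 2| ≤ 1 / 2 * ‖v‖ ^ 2 := by
  have h1 : ‖v‖ ^ 2 = ∑ i, ∑ j, (1 : Matrix (Fin d) (Fin d) ℝ) i j * v i * v j := by
    rw [EuclideanSpace.real_norm_sq_eq]
    refine Finset.sum_congr rfl fun i _ => ?_
    rw [Finset.sum_eq_single i]
    · simp [sq]
    · intro j _ hj; simp [Matrix.one_apply_ne (Ne.symm hj)]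
    · simp
  have h2 : energy g x v - ‖v‖ ^ 2
      = ∑ i, ∑ j, (g x i j - (1 : Matrix (Fin d) (Fin d) ℝ) i j) * v i * v j := by
    rw [h1, energy, ← Finset.sum_sub_distrib]
    refine Finset.sum_congr rfl fun i _ => ?_
    rw [← Finset.sum_sub_distrib]
    exact Finset.sum_congr rfl fun j _ => by ring
  have h3 : |energy g x v - ‖v‖ ^ 2| ≤ c * (∑ i, |v i|) ^ 2 := by
    rw [h2, sq, Finset.sum_mul_sum, Finset.mul_sum]
    refine (Finset.abs_sum_le_sum_abs _ _).trans (Finset.sum_le_sum fun i _ => ?_)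
    rw [Finset.mul_sum]
    refine (Finset.abs_sum_le_sum_abs _ _).trans (Finset.sum_le_sum fun j _ => ?_)
    rw [abs_mul, abs_mul, mul_assoc]
    exact mul_le_mul_of_nonneg_right (h.abs_sub_le hc i j x) (by positivity)
  have h4 : (∑ i, |v i|) ^ 2 ≤ d * ‖v‖ ^ 2 := by
    have := sq_sum_le_card_mul_sum_sq (s := Finset.univ) (f := fun i => |v i|)
    simpa [EuclideanSpace.real_norm_sq_eq] using this
  have h5 : c * d ≤ 1 / 2 := by
    rw [le_div_iff₀ (by positivity)] at hcd
    nlinarith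
  calc _ ≤ c * (∑ i, |v i|) ^ 2 := h3
    _ ≤ c * (d * ‖v‖ ^ 2) := by gcongr
    _ = (c * d) * ‖v‖ ^ 2 := by ring
    _ ≤ 1 / 2 * ‖v‖ ^ 2 := by gcongr

theorem abs_coord_le_norm (v : Sp d) (i : Fin d) : |v i| ≤ ‖v‖ := by
  simpa using PiLp.norm_apply_le v i

/-- The `j`-th column `u` of the inverse satisfies `g(u, u) = u j`, so `‖u‖ ^ 2 / 2 ≤ u j ≤ ‖u‖` and
hence `‖u‖ ≤ 2`. -/
theorem SmallNorms.abs_upper_le (h : SmallNorms g c) (hg : IsRiemannianMetric g) (hc : 0 ≤ c)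
    (hcd : c ≤ 1 / (2 * (d + 1))) (i j : Fin d) (x : Sp d) : |upper g i j x| ≤ 2 := by
  let u : Sp d := WithLp.toLp 2 fun a => upper g a j x
  have h1 : energy g x u = u j := by
    have : ∀ i, ∑ b, g x i b * u i * u b = u i * (1 : Matrix (Fin d) (Fin d) ℝ) i j := by
      intro i
      rw [← hg.sum_mul_upper x i j, Finset.mul_sum]
      exact Finset.sum_congr rfl fun b _ => by simp only [u]; ring
    rw [energy]
    simp only [this]
    rw [Finset.sum_eq_single j]
    · simp
    · intro b _ hb; simp [Matrix.one_apply_ne hb]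
    · simp
  have h2 := (abs_le.1 (h.abs_energy_sub_le hc hcd x u)).1
  have h3 := (le_abs_self _).trans (abs_coord_le_norm u j)
  have h4 : ‖u‖ ≤ 2 := by
    rw [h1] at h2
    by_contra hlt
    push Not at hlt
    nlinarith
  exact (abs_coord_le_norm u i).trans h4

theorem SmallNorms.abs_christoffel_le (h : SmallNorms g c) (hg : IsRiemannianMetric g)
    (hc : 0 ≤ c) (hcd : c ≤ 1 / (2 * (d + 1))) (n i j : Fin d) (x : Sp d) :
    |christoffel g n i j x| ≤ 3 * d * c := by
  have h1 : ∀ m, |upper g n m x * (pd i (fun z => g z m j) x + pd j (fun z => g z m i) x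
      - pd m (fun z => g z i j) x)| ≤ 2 * (3 * c) := by
    intro m
    rw [abs_mul]
    refine mul_le_mul (h.abs_upper_le hg hc hcd n m x) ?_ (abs_nonneg _) zero_le_two
    have a1 := abs_le.1 (h.abs_pd_le hc i m j x)
    have a2 := abs_le.1 (h.abs_pd_le hc j m i x)
    have a3 := abs_le.1 (h.abs_pd_le hc m i j x)
    rw [abs_le]
    constructor <;> linarith
  have h2 := (Finset.abs_sum_le_sum_abs (fun m => upper g n m x *
    (pd i (fun z => g z m j) x + pd j (fun z => g z m i) x - pd m (fun z => g z i j) x))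
    Finset.univ).trans (Finset.sum_le_sum fun m _ => h1 m)
  rw [Finset.sum_const, Finset.card_univ, Fintype.card_fin, nsmul_eq_mul] at h2
  rw [christoffel, abs_mul, abs_of_nonneg (by norm_num : (0 : ℝ) ≤ 1 / 2)]
  linarith

theorem norm_smul_le_of_abs_le {F : Type} [NormedAddCommGroup F] [NormedSpace ℝ F] {a B : ℝ}
    (h : |a| ≤ B) (T : F) : ‖a • T‖ ≤ B * ‖T‖ := by
  rw [norm_smul, Real.norm_eq_abs]
  exact mul_le_mul_of_nonneg_right h (norm_nonneg T)

theorem exists_norm_chr_le (d : ℕ) : ∃ A, 0 ≤ A ∧ ∀ (g : MetricField d) (c : ℝ),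
    IsRiemannianMetric g → SmallNorms g c → 0 ≤ c → c ≤ 1 / (2 * (d + 1)) →
    ∀ x, ‖chr g x‖ ≤ A * c := by
  refine ⟨∑ n : Fin d, ∑ i : Fin d, ∑ j : Fin d, 3 * d *
    ‖(coordRank i (coordRank j (EuclideanSpace.single n (1 : ℝ) : Sp d)) :
      Sp d →L[ℝ] Sp d →L[ℝ] Sp d)‖, by positivity, fun g c hg h hc hcd x => ?_⟩
  simp only [Finset.sum_mul]
  rw [chr]
  refine norm_sum_le_of_le (E := Sp d →L[ℝ] Sp d →L[ℝ] Sp d) _ fun n _ => ?_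
  refine norm_sum_le_of_le (E := Sp d →L[ℝ] Sp d →L[ℝ] Sp d) _ fun i _ => ?_
  refine norm_sum_le_of_le (E := Sp d →L[ℝ] Sp d →L[ℝ] Sp d) _ fun j _ => ?_
  refine (norm_smul_le_of_abs_le (F := Sp d →L[ℝ] Sp d →L[ℝ] Sp d)
    (h.abs_christoffel_le hg hc hcd n i j x) _).trans (le_of_eq ?_)
  ring

/-- Only the components of `R` and of the inverse metric enter, no derivative of `Γ`. Raising the
last index costs the factor `2 * d`. -/
theorem exists_norm_curv_le (d : ℕ) : ∃ A, 0 ≤ A ∧ ∀ (g : MetricField d) (c : ℝ),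
    IsRiemannianMetric g → SmallNorms g c → 0 ≤ c → c ≤ 1 / (2 * (d + 1)) →
    ∀ x X Z, ‖curv g x X Z‖ ≤ A * c * (‖X‖ * ‖Z‖) := by
  refine ⟨∑ n : Fin d, ∑ i : Fin d, ∑ j : Fin d, ∑ k : Fin d, 2 * d *
    ‖(coordRank j (EuclideanSpace.single n (1 : ℝ) : Sp d) : Sp d →L[ℝ] Sp d)‖, by positivity,
    fun g c hg h hc hcd x X Z => ?_⟩
  simp only [Finset.sum_mul]
  rw [curv]
  refine norm_sum_le_of_le _ fun n _ => ?_
  refine norm_sum_le_of_le _ fun i _ => ?_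
  refine norm_sum_le_of_le _ fun j _ => ?_
  refine norm_sum_le_of_le _ fun k _ => ?_
  have h1 : |∑ l, upper g n l x * riemann g i j k l x| ≤ 2 * d * c := by
    refine (Finset.abs_sum_le_sum_abs _ _).trans ((Finset.sum_le_sum fun l _ =>
      (show |upper g n l x * riemann g i j k l x| ≤ 2 * c from ?_)).trans (le_of_eq ?_))
    · rw [abs_mul]
      exact mul_le_mul (h.abs_upper_le hg hc hcd n l x) (h.abs_riemann_le hc i j k l x)
        (abs_nonneg _) zero_le_two
    · rw [Finset.sum_const, Finset.card_univ, Fintype.card_fin, nsmul_eq_mul]; ring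
  rw [norm_smul, Real.norm_eq_abs, abs_mul, abs_mul]
  calc _ ≤ 2 * d * c * (‖X‖ * ‖Z‖) *
        ‖(coordRank j (EuclideanSpace.single n (1 : ℝ) : Sp d) : Sp d →L[ℝ] Sp d)‖ := by
        gcongr
        · exact abs_coord_le_norm X i
        · exact abs_coord_le_norm Z k
    _ = _ := by ring

end SmallNorms

/-! ### The metric, its inverse, `Γ` and `R` as symbols. -/

section SymbolBounds

variable {d k : ℕ} {ι : Type} {M c : ι → ℝ} {g : ι → MetricField d} {p : ι → Sp d}
  {C : MIdx d → ℝ}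

theorem symBdd_riemann (hg : ∀ τ, IsRiemannianMetric (g τ))
    (hC : ∀ τ, DerivBounds (g τ) C (M τ)) (i j k' l : Fin d) :
    SymBdd k M (fun τ => riemann (g τ) i j k' l) p :=
  SymBdd.of_multiPd (fun τ => (hg τ).contDiff_riemann i j k' l) fun β _ =>
    ⟨C β, fun τ => (hC τ).riemann_bound β i j k' l (p τ)⟩

/-- The exponent `|β| - 1` in the hypothesis is exactly a symbol bound once one derivative has been
taken. -/
theorem symBdd_pd_upper (hg : ∀ τ, IsRiemannianMetric (g τ))
    (hC : ∀ τ, DerivBounds (g τ) C (M τ)) (m i j : Fin d) :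
    SymBdd k M (fun τ => pd m (upper (g τ) i j)) p :=
  SymBdd.of_multiPd (fun τ => contDiff_pd ((hg τ).contDiff_upper i j) m) fun β _ =>
    ⟨C (β + Pi.single m 1), fun τ => by
      have := (hC τ).upper_bound (β + Pi.single m 1) (by rw [order_add_single]; omega) i j (p τ)
      rwa [order_add_single, Nat.add_sub_cancel, ← multiPd_pd ((hg τ).contDiff_upper i j)] at this⟩

theorem symBdd_upper (hM : ∀ τ, 1 ≤ M τ) (hg : ∀ τ, IsRiemannianMetric (g τ))
    (hc : ∀ τ, 0 ≤ c τ) (hcd : ∀ τ, c τ ≤ 1 / (2 * (d + 1))) (hs : ∀ τ, SmallNorms (g τ) (c τ))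
    (hC : ∀ τ, DerivBounds (g τ) C (M τ)) (i j : Fin d) :
    SymBdd k M (fun τ => upper (g τ) i j) p :=
  (SymBdd.of_pd (k := k) hM (fun τ => (hg τ).contDiff_upper i j)
    ⟨2, fun τ => (hs τ).abs_upper_le (hg τ) (hc τ) (hcd τ) i j (p τ)⟩
    fun m => symBdd_pd_upper hg hC m i j).mono (Nat.le_succ k)

theorem symBdd_pd_metric_of (hM : ∀ τ, 1 ≤ M τ) (hg : ∀ τ, IsRiemannianMetric (g τ))
    (hC : ∀ τ, DerivBounds (g τ) C (M τ)) (h : ∀ i j, SymBdd k M (fun τ x => g τ x i j) p)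
    (m i j : Fin d) : SymBdd k M (fun τ => pd m (fun z => g τ z i j)) p := by
  have h1 : (fun τ => pd m (fun z => g τ z i j)) = fun τ x =>
      -∑ a, ∑ b, g τ x i a * pd m (upper (g τ) a b) x * g τ x b j := by
    funext τ x; exact (hg τ).pd_eq m i j x
  rw [h1]
  exact (SymBdd.sum _ fun a _ => SymBdd.sum _ fun b _ =>
    ((h i a).mul hM (symBdd_pd_upper hg hC m a b)).mul hM (h b j)).neg

/-- A bootstrap: order `k` for `g` gives order `k` for `∂g = -g (∂g⁻¹) g`, hence order `k + 1` for
`g`. It starts from the closeness of `g` to the identity. -/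
theorem symBdd_metric (hM : ∀ τ, 1 ≤ M τ) (hg : ∀ τ, IsRiemannianMetric (g τ))
    (hc : ∀ τ, 0 ≤ c τ) (hcd : ∀ τ, c τ ≤ 1 / (2 * (d + 1))) (hs : ∀ τ, SmallNorms (g τ) (c τ))
    (hC : ∀ τ, DerivBounds (g τ) C (M τ)) (i j : Fin d) :
    SymBdd k M (fun τ x => g τ x i j) p := by
  have h0 : ∀ i j : Fin d, ∃ B, ∀ τ, ‖g τ (p τ) i j‖ ≤ B := by
    intro i j
    refine ⟨|(1 : Matrix (Fin d) (Fin d) ℝ) i j| + 1 / (2 * (d + 1)), fun τ => ?_⟩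
    have h1 := ((hs τ).abs_sub_le (hc τ) i j (p τ)).trans (hcd τ)
    rw [Real.norm_eq_abs]
    have h2 := abs_add_le ((1 : Matrix (Fin d) (Fin d) ℝ) i j)
      (g τ (p τ) i j - (1 : Matrix (Fin d) (Fin d) ℝ) i j)
    rw [add_sub_cancel] at h2
    linarith
  induction k generalizing i j with
  | zero =>
    refine ⟨fun τ => (hg τ).smooth i j, fun n hn => ?_⟩
    obtain rfl : n = 0 := by omega
    simpa using h0 i j
  | succ k ih =>
    exact SymBdd.of_pd hM (fun τ => (hg τ).smooth i j) (h0 i j)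
      fun m => symBdd_pd_metric_of hM hg hC ih m i j

theorem symBdd_christoffel (hM : ∀ τ, 1 ≤ M τ) (hg : ∀ τ, IsRiemannianMetric (g τ))
    (hc : ∀ τ, 0 ≤ c τ) (hcd : ∀ τ, c τ ≤ 1 / (2 * (d + 1))) (hs : ∀ τ, SmallNorms (g τ) (c τ))
    (hC : ∀ τ, DerivBounds (g τ) C (M τ)) (n i j : Fin d) :
    SymBdd k M (fun τ => christoffel (g τ) n i j) p := by
  have hpd : ∀ m i j, SymBdd k M (fun τ => pd m (fun z => g τ z i j)) p := fun m i j =>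
    symBdd_pd_metric_of hM hg hC (fun i j => symBdd_metric hM hg hc hcd hs hC i j) m i j
  exact (SymBdd.const (c := fun _ => (1 / 2 : ℝ)) ⟨_, fun _ => le_rfl⟩).mul hM
    (SymBdd.sum _ fun m _ => (symBdd_upper hM hg hc hcd hs hC n m).mul hM
      (((hpd i m j).add (hpd j m i)).sub (hpd m i j)))

end SymbolBounds

/-! ### Energy, completeness and smoothness of the geodesic flow. -/

section GeodesicField

variable {d : ℕ} {g : MetricField d} {c : ℝ}

/-- The geodesic vector field on `ℝ^d × ℝ^d`. -/
noncomputable def geoField (g : MetricField d) (z : Sp d × Sp d) : Sp d × Sp d :=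
  (z.2, -chr g z.1 z.2 z.2)

theorem IsRiemannianMetric.contDiff_geoField (hg : IsRiemannianMetric g) :
    ContDiff ℝ ∞ (geoField g) :=
  contDiff_snd.prodMk
    (((hg.contDiff_chr.comp contDiff_fst).clm_apply contDiff_snd).clm_apply contDiff_snd).neg

theorem hasDerivAt_of_coord {f : ℝ → Sp d} {f' : Sp d} {t : ℝ}
    (h : ∀ n, HasDerivAt (fun s => f s n) (f' n) t) : HasDerivAt f f' t := by
  have h1 : HasDerivAt (fun s => WithLp.ofLp (f s)) (WithLp.ofLp f') t := hasDerivAt_pi.2 h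
  exact ((PiLp.continuousLinearEquiv 2 ℝ (fun _ : Fin d => ℝ)).symm.hasFDerivAt).comp_hasDerivAt
    t h1

theorem IsGeodesic.hasDerivAt {f : ℝ → Sp d} (h : IsGeodesic g f) (t : ℝ) :
    HasDerivAt (fun s => (f s, deriv f s)) (geoField g (f t, deriv f t)) t := by
  refine (h.1 t).hasDerivAt.prodMk (hasDerivAt_of_coord fun n => ?_)
  have h1 := h.2 t n
  rwa [← chr_apply g (f t) (deriv f t) (deriv f t) n] at h1

theorem isGeodesic_of_hasDerivAt {z : ℝ → Sp d × Sp d}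
    (h : ∀ t, HasDerivAt z (geoField g (z t)) t) :
    IsGeodesic g (fun t => (z t).1) ∧ ∀ t, deriv (fun t => (z t).1) t = (z t).2 := by
  have h1 : ∀ t, HasDerivAt (fun t => (z t).1) (z t).2 t := fun t =>
    (hasFDerivAt_fst (𝕜 := ℝ) (E := Sp d) (F := Sp d)).comp_hasDerivAt t (h t)
  have h2 : deriv (fun t => (z t).1) = fun t => (z t).2 := funext fun t => (h1 t).deriv
  have h3 : ∀ t, HasDerivAt (fun t => (z t).2) (-chr g (z t).1 (z t).2 (z t).2) t := fun t =>
    (hasFDerivAt_snd (𝕜 := ℝ) (E := Sp d) (F := Sp d)).comp_hasDerivAt t (h t)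
  refine ⟨⟨fun t => (h1 t).differentiableAt, fun t n => ?_⟩, fun t => (h1 t).deriv⟩
  rw [h2, ← chr_apply g (z t).1 (z t).2 (z t).2 n]
  exact (EuclideanSpace.proj n : Sp d →L[ℝ] ℝ).hasFDerivAt.comp_hasDerivAt t (h3 t)

theorem IsRiemannianMetric.sum_mul_christoffel (hg : IsRiemannianMetric g) (x : Sp d)
    (l a b : Fin d) : ∑ n, g x l n * christoffel g n a b x = 1 / 2 *
      (pd a (fun z => g z l b) x + pd b (fun z => g z l a) x - pd l (fun z => g z a b) x) := by
  unfold christoffel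
  simp only [Finset.mul_sum]
  rw [Finset.sum_comm]
  have : ∀ m, ∑ n, g x l n * (1 / 2 * (upper g n m x *
      (pd a (fun z => g z m b) x + pd b (fun z => g z m a) x - pd m (fun z => g z a b) x)))
      = (1 : Matrix (Fin d) (Fin d) ℝ) l m * (1 / 2 *
      (pd a (fun z => g z m b) x + pd b (fun z => g z m a) x - pd m (fun z => g z a b) x)) := by
    intro m
    rw [← hg.sum_mul_upper x l m, Finset.sum_mul]
    exact Finset.sum_congr rfl fun n _ => by ring
  simp only [this]
  rw [Finset.sum_eq_single l]
  · simp
  · intro m _ hm; simp [Matrix.one_apply_ne (Ne.symm hm)]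
  · simp

/-- On the diagonal the three terms of the Christoffel symbol have the same contraction `S` after
relabelling, so they add up to `S + S - S`. This is the cancellation behind conservation of energy.
-/
theorem IsRiemannianMetric.sum_mul_chr (hg : IsRiemannianMetric g) (x v : Sp d) :
    2 * ∑ i, ∑ j, g x i j * v i * chr g x v v j
      = ∑ i, ∑ j, (∑ k, v k * pd k (fun z => g z i j) x) * v i * v j := by
  have h1 : ∀ i, ∑ j, g x i j * v i * chr g x v v j
      = ∑ a, ∑ b, 1 / 2 * (pd a (fun z => g z i b) x + pd b (fun z => g z i a) x
        - pd i (fun z => g z a b) x) * (v i * v a * v b) := by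
    intro i
    simp only [chr_apply, Finset.mul_sum]
    rw [Finset.sum_comm]
    refine Finset.sum_congr rfl fun a _ => ?_
    rw [Finset.sum_comm]
    refine Finset.sum_congr rfl fun b _ => ?_
    rw [← hg.sum_mul_christoffel x i a b, Finset.sum_mul]
    exact Finset.sum_congr rfl fun n _ => by ring
  let S := ∑ i, ∑ j, ∑ k, pd k (fun z => g z i j) x * (v i * v j * v k)
  have e1 : ∑ i, ∑ a, ∑ b, pd a (fun z => g z i b) x * (v i * v a * v b) = S := by
    refine Finset.sum_congr rfl fun i _ => ?_
    rw [Finset.sum_comm]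
    exact Finset.sum_congr rfl fun b _ => Finset.sum_congr rfl fun a _ => by ring
  have e2 : ∑ i, ∑ a, ∑ b, pd b (fun z => g z i a) x * (v i * v a * v b) = S := rfl
  have e3 : ∑ i, ∑ a, ∑ b, pd i (fun z => g z a b) x * (v i * v a * v b) = S := by
    rw [Finset.sum_comm]
    refine Finset.sum_congr rfl fun a _ => ?_
    rw [Finset.sum_comm]
    exact Finset.sum_congr rfl fun b _ => Finset.sum_congr rfl fun i _ => by ring
  have e4 : ∑ i, ∑ j, (∑ k, v k * pd k (fun z => g z i j) x) * v i * v j = S := by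
    refine Finset.sum_congr rfl fun i _ => Finset.sum_congr rfl fun j _ => ?_
    rw [Finset.sum_mul, Finset.sum_mul]
    exact Finset.sum_congr rfl fun k _ => by ring
  rw [e4]
  simp only [h1]
  have e5 : ∑ i, ∑ a, ∑ b, 1 / 2 * (pd a (fun z => g z i b) x + pd b (fun z => g z i a) x
        - pd i (fun z => g z a b) x) * (v i * v a * v b) = 1 / 2 * (S + S - S) := by
    nth_rw 1 [← e1]
    nth_rw 1 [← e2]
    nth_rw 1 [← e3]
    simp only [Finset.mul_sum, ← Finset.sum_add_distrib, ← Finset.sum_sub_distrib]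
    exact Finset.sum_congr rfl fun i _ => Finset.sum_congr rfl fun a _ =>
      Finset.sum_congr rfl fun b _ => by ring
  rw [e5]; ring

/-- The energy is constant along rescaled geodesics. -/
theorem IsRiemannianMetric.energy_eq (hg : IsRiemannianMetric g) {z : ℝ → Sp d × Sp d}
    {σ : ℝ → ℝ} (h : ∀ t, HasDerivAt z (σ t • geoField g (z t)) t) (t : ℝ) :
    energy g (z t).1 (z t).2 = energy g (z 0).1 (z 0).2 := by
  have hd : ∀ t, HasDerivAt (fun t => energy g (z t).1 (z t).2) 0 t := by
    intro t
    let x := (z t).1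
    let v := (z t).2
    have h1 : HasDerivAt (fun t => (z t).1) (σ t • v) t :=
      (hasFDerivAt_fst (𝕜 := ℝ) (E := Sp d) (F := Sp d)).comp_hasDerivAt t (h t)
    have h2 : HasDerivAt (fun t => (z t).2) (σ t • -chr g x v v) t :=
      (hasFDerivAt_snd (𝕜 := ℝ) (E := Sp d) (F := Sp d)).comp_hasDerivAt t (h t)
    have h3 : ∀ i, HasDerivAt (fun t => (z t).2 i) (-(σ t * chr g x v v i)) t := fun i => by
      have h : HasDerivAt (fun t => (z t).2 i) ((σ t • -chr g x v v) i) t :=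
        (EuclideanSpace.proj i : Sp d →L[ℝ] ℝ).hasFDerivAt.comp_hasDerivAt t h2
      exact h.congr_deriv (by simp)
    have h4 : ∀ i j, HasDerivAt (fun t => g (z t).1 i j)
        (σ t * ∑ k, v k * pd k (fun y => g y i j) x) t := fun i j => by
      have := (((hg.smooth i j).differentiable (by simp)) x).hasFDerivAt.comp_hasDerivAt t h1
      rw [map_smul, fderiv_eq_sum_mul_pd, smul_eq_mul] at this
      exact this
    have h5 := HasDerivAt.fun_sum (u := Finset.univ) fun i _ =>
      HasDerivAt.fun_sum (u := Finset.univ) fun j _ => ((h4 i j).mul (h3 i)).mul (h3 j)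
    refine HasDerivAt.congr_deriv (f' := _) h5 ?_
    have h6 := hg.sum_mul_chr x v
    have h7 : ∑ i, ∑ j, g x i j * chr g x v v i * v j = ∑ i, ∑ j, g x i j * v i * chr g x v v j := by
      rw [Finset.sum_comm]
      refine Finset.sum_congr rfl fun i _ => Finset.sum_congr rfl fun j _ => ?_
      rw [hg.symm x j i]; ring
    -- The scalar `σ` factors out of the whole derivative. Thus energy is also conserved along
    -- trajectories of a cut-off geodesic field.
    have h8 : σ t * (∑ i, ∑ j, (∑ k, v k * pd k (fun z => g z i j) x) * v i * v j
        - ∑ i, ∑ j, g x i j * chr g x v v i * v j - ∑ i, ∑ j, g x i j * v i * chr g x v v j) = 0 := by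
      rw [h7, ← h6]; ring
    rw [← h8]
    simp only [Finset.mul_sum, ← Finset.sum_sub_distrib]
    refine Finset.sum_congr rfl fun i _ => Finset.sum_congr rfl fun j _ => ?_
    show ((∑ k, σ t * (v k * pd k (fun y => g y i j) x)) * v i + g x i j * -(σ t * chr g x v v i))
      * v j + g x i j * v i * -(σ t * chr g x v v j) = _
    rw [← Finset.mul_sum]
    ring
  exact is_const_of_deriv_eq_zero (fun t => (hd t).differentiableAt) (fun t => (hd t).deriv) t 0

/-- The energy lies between `1 / 2` and `3 / 2` times the squared Euclidean norm, so its
conservation allows growth of `‖v‖ ^ 2` by at most a factor `3 ≤ 4`. -/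
theorem norm_velocity_le (hg : IsRiemannianMetric g) (hs : SmallNorms g c) (hc : 0 ≤ c)
    (hcd : c ≤ 1 / (2 * (d + 1)))
    {z : ℝ → Sp d × Sp d} {σ : ℝ → ℝ}
    (h : ∀ t, HasDerivAt z (σ t • geoField g (z t)) t) (t : ℝ) : ‖(z t).2‖ ≤ 2 * ‖(z 0).2‖ := by
  have h1 := hg.energy_eq h t
  have h2 := abs_le.1 (hs.abs_energy_sub_le hc hcd (z t).1 (z t).2)
  have h3 := abs_le.1 (hs.abs_energy_sub_le hc hcd (z 0).1 (z 0).2)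
  refine abs_le_of_sq_le_sq' ?_ (by positivity) |>.2
  nlinarith [h2.1, h3.2, sq_nonneg ‖(z 0).2‖]

/-- The bound does not involve `σ`, so the radius of a cutoff can be chosen from it before the
cutoff itself. -/
theorem norm_trajectory_le (hg : IsRiemannianMetric g) (hs : SmallNorms g c) (hc : 0 ≤ c)
    (hcd : c ≤ 1 / (2 * (d + 1)))
    {z : ℝ → Sp d × Sp d} {σ : ℝ → ℝ} (hσ : ∀ t, |σ t| ≤ 1)
    (h : ∀ t, HasDerivAt z (σ t • geoField g (z t)) t) (t : ℝ) :
    ‖z t‖ ≤ ‖z 0‖ + 2 * ‖z 0‖ * |t| + 2 * ‖z 0‖ := by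
  have hw : ‖(z 0).2‖ ≤ ‖z 0‖ := norm_snd_le _
  have h1 : ∀ t, HasDerivAt (fun t => (z t).1) (σ t • (z t).2) t := fun t =>
    (hasFDerivAt_fst (𝕜 := ℝ) (E := Sp d) (F := Sp d)).comp_hasDerivAt t (h t)
  have h2 : ∀ t, ‖σ t • (z t).2‖ ≤ 2 * ‖z 0‖ := fun t => by
    rw [norm_smul, Real.norm_eq_abs]
    have := norm_velocity_le hg hs hc hcd h t
    calc |σ t| * ‖(z t).2‖ ≤ 1 * (2 * ‖(z 0).2‖) := by gcongr; exact hσ t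
      _ ≤ 2 * ‖z 0‖ := by linarith
  have h3 := Convex.norm_image_sub_le_of_norm_hasDerivWithin_le (f := fun t => (z t).1)
    (s := Set.univ) (x := 0) (y := t) (fun s _ => (h1 s).hasDerivWithinAt) (fun s _ => h2 s)
    convex_univ (Set.mem_univ _) (Set.mem_univ _)
  rw [sub_zero, Real.norm_eq_abs] at h3
  have h4 : ‖(z t).1‖ ≤ ‖(z 0).1‖ + ‖(z t).1 - (z 0).1‖ := norm_le_insert' _ _
  have h5 : ‖(z 0).1‖ ≤ ‖z 0‖ := norm_fst_le _
  have h6 := norm_velocity_le hg hs hc hcd h t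
  have h7 : 0 ≤ ‖z 0‖ * |t| := by positivity
  rw [Prod.norm_def]
  exact max_le (by linarith [norm_nonneg (z 0)]) (by linarith [norm_nonneg (z 0)])

theorem exists_cutoff_geoField (hg : IsRiemannianMetric g) {R : ℝ} (hR : 0 < R) :
    ∃ (X : Sp d × Sp d → Sp d × Sp d) (χ : Sp d × Sp d → ℝ), ContDiff ℝ ∞ X ∧
      HasCompactSupport X ∧ (∀ z, X z = χ z • geoField g z) ∧ (∀ z, |χ z| ≤ 1) ∧
      ∀ z, ‖z‖ ≤ R → X z = geoField g z := by
  let χ : ContDiffBump (0 : Sp d × Sp d) := ⟨R, R + 1, hR, by linarith⟩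
  refine ⟨fun z => χ z • geoField g z, χ, χ.contDiff.smul hg.contDiff_geoField,
    χ.hasCompactSupport.smul_right, fun z => rfl,
    fun z => by rw [abs_of_nonneg χ.nonneg]; exact χ.le_one, fun z hz => ?_⟩
  have : χ z = 1 := χ.one_of_mem_closedBall (by simpa using hz)
  simp only [this, one_smul]

/-- Up to time `n` a trajectory of the cut-off field stays where the cutoff equals `1`, and so it is
a trajectory of the geodesic field. -/
theorem exists_geodesic (hg : IsRiemannianMetric g) (hs : SmallNorms g c) (hc : 0 ≤ c)
    (hcd : c ≤ 1 / (2 * (d + 1)))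
    (z₀ : Sp d × Sp d) :
    ∃ z : ℝ → Sp d × Sp d, z 0 = z₀ ∧ ∀ t, HasDerivAt z (geoField g (z t)) t := by
  refine exists_integralCurve_of_forall_Ioo hg.contDiff_geoField fun n => ?_
  obtain ⟨X, χ, hX, hXc, hXχ, hχ, hXR⟩ := exists_cutoff_geoField hg
    (R := ‖z₀‖ + 2 * ‖z₀‖ * n + 2 * ‖z₀‖ + 1) (by positivity)
  obtain ⟨z, hz0, hz⟩ := exists_integralCurve_of_hasCompactSupport hX hXc z₀
  refine ⟨z, hz0, fun t ht => ?_⟩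
  have h1 := norm_trajectory_le hg hs hc hcd (z := z) (σ := fun t => χ (z t)) (fun t => hχ _)
    (fun t => by rw [← hXχ]; exact hz t) t
  rw [hz0] at h1
  have h2 : |t| ≤ n := (abs_lt.2 ht).le
  rw [← hXR (z t)]
  · exact hz t
  · have : 2 * ‖z₀‖ * |t| ≤ 2 * ‖z₀‖ * n := by gcongr
    linarith

theorem exists_isGeodesicFlow (hg : IsRiemannianMetric g) (hs : SmallNorms g c) (hc : 0 ≤ c)
    (hcd : c ≤ 1 / (2 * (d + 1)))
    : ∃ γ, IsGeodesicFlow g γ := by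
  choose z hz0 hz using exists_geodesic hg hs hc hcd
  refine ⟨fun t y w => (z (y, w) t).1, fun y w => ?_⟩
  obtain ⟨h1, h2⟩ := isGeodesic_of_hasDerivAt (hz (y, w))
  exact ⟨h1, by simp [hz0], by rw [velocity, h2, hz0]⟩

/-- Smoothness is local. For times and initial data near a given point, the geodesics coincide with
the flow of one compactly supported field. -/
theorem contDiff_geodesicFlow (hg : IsRiemannianMetric g) (hs : SmallNorms g c) (hc : 0 ≤ c)
    (hcd : c ≤ 1 / (2 * (d + 1)))
    {γ : ℝ → Sp d → Sp d → Sp d} (hγ : IsGeodesicFlow g γ) :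
    ContDiff ℝ ∞ (fun p : ℝ × Sp d × Sp d => γ p.1 p.2.1 p.2.2) := by
  let Z : Sp d × Sp d → ℝ → Sp d × Sp d := fun z t => (γ t z.1 z.2, velocity γ t z.1 z.2)
  have hZ0 : ∀ z, Z z 0 = z := fun z =>
    Prod.ext (hγ z.1 z.2).2.1 (hγ z.1 z.2).2.2
  have hZ : ∀ z t, HasDerivAt (Z z) (geoField g (Z z t)) t := fun z t =>
    (hγ z.1 z.2).1.hasDerivAt t
  suffices h : ContDiff ℝ ∞ (fun p : ℝ × Sp d × Sp d => Z p.2 p.1) from contDiff_fst.comp h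
  refine contDiff_iff_contDiffAt.2 fun p₀ => ?_
  let T : ℝ := |p₀.1| + 1
  let ρ : ℝ := ‖p₀.2‖ + 1
  have hρ : 0 < ρ := by positivity
  have hT : 0 < T := by positivity
  obtain ⟨X, χ, hX, hXc, hXχ, hχ, hXR⟩ := exists_cutoff_geoField hg
    (R := ρ + 2 * ρ * T + 2 * ρ) (by positivity)
  choose ψ hψ0 hψ using exists_integralCurve_of_hasCompactSupport hX hXc
  have hsm : ContDiff ℝ ∞ (fun p : ℝ × Sp d × Sp d => ψ p.2 p.1) :=
    contDiff_flow hX hXc (ψ := fun t x => ψ x t) hψ0 (fun t x => hψ x t)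
  refine hsm.contDiffAt.congr_of_eventuallyEq ?_
  have e1 : ∀ᶠ p : ℝ × Sp d × Sp d in nhds p₀, |p.1| < T :=
    ContinuousAt.eventually_lt (by fun_prop) continuousAt_const (by simp [T])
  have e2 : ∀ᶠ p : ℝ × Sp d × Sp d in nhds p₀, ‖p.2‖ < ρ :=
    ContinuousAt.eventually_lt (by fun_prop) continuousAt_const (by simp [ρ])
  filter_upwards [e1, e2] with p h1 h2
  refine eqOn_Ioo_of_integralCurve (T := T) hX (fun t ht => ?_) (fun t _ => hψ p.2 t)
    (by rw [hZ0, hψ0]) (abs_lt.1 h1)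
  have h3 := norm_trajectory_le hg hs hc hcd (z := Z p.2) (σ := fun _ => 1) (by simp)
    (fun t => by rw [one_smul]; exact hZ p.2 t) t
  rw [hZ0] at h3
  have h4 : |t| ≤ T := (abs_lt.2 ht).le
  rw [hXR]
  · exact hZ p.2 t
  · have : 2 * ‖p.2‖ * |t| ≤ 2 * ρ * T := by gcongr
    linarith

end GeodesicField

/-! ### Jacobi fields in covariant form. -/

section Jacobi

variable {d : ℕ} {g : MetricField d} {γ : ℝ → Sp d → Sp d → Sp d}

/-- The position at time `t` as a function of the initial data. -/
def pos (γ : ℝ → Sp d → Sp d → Sp d) (t : ℝ) (z : Sp d × Sp d) : Sp d := γ t z.1 z.2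

/-- The velocity at time `t` as a function of the initial data. -/
noncomputable def vel (γ : ℝ → Sp d → Sp d → Sp d) (t : ℝ) (z : Sp d × Sp d) : Sp d :=
  velocity γ t z.1 z.2

/-- The connection form along the flow. -/
noncomputable def conn (g : MetricField d) (γ : ℝ → Sp d → Sp d → Sp d) (t : ℝ)
    (z : Sp d × Sp d) : Sp d →L[ℝ] Sp d := chr g (pos γ t z) (vel γ t z)

/-- The tidal operator `Y ↦ R(v, Y) v` along the flow. -/
noncomputable def tidal (g : MetricField d) (γ : ℝ → Sp d → Sp d → Sp d) (t : ℝ)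
    (z : Sp d × Sp d) : Sp d →L[ℝ] Sp d := curv g (pos γ t z) (vel γ t z) (vel γ t z)

/-- The Jacobi fields: the derivative of the position. -/
noncomputable def jac (γ : ℝ → Sp d → Sp d → Sp d) (t : ℝ) (z : Sp d × Sp d) :
    Sp d × Sp d →L[ℝ] Sp d := fderiv ℝ (pos γ t) z

/-- The covariant time derivative of the Jacobi fields. -/
noncomputable def covJac (g : MetricField d) (γ : ℝ → Sp d → Sp d → Sp d) (t : ℝ)
    (z : Sp d × Sp d) : Sp d × Sp d →L[ℝ] Sp d :=
  fderiv ℝ (vel γ t) z + (conn g γ t z).comp (jac γ t z)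

theorem contDiff_pos (hs : ContDiff ℝ ∞ fun p : ℝ × Sp d × Sp d => γ p.1 p.2.1 p.2.2) :
    ContDiff ℝ ∞ (Function.uncurry (pos γ)) := hs

theorem contDiff_vel (hs : ContDiff ℝ ∞ fun p : ℝ × Sp d × Sp d => γ p.1 p.2.1 p.2.2) :
    ContDiff ℝ ∞ (Function.uncurry (vel γ)) := contDiff_deriv_fst (contDiff_pos hs)

theorem contDiff_jac (hs : ContDiff ℝ ∞ fun p : ℝ × Sp d × Sp d => γ p.1 p.2.1 p.2.2) :
    ContDiff ℝ ∞ (Function.uncurry (jac γ)) := contDiff_fderiv_snd (contDiff_pos hs)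

theorem contDiff_conn (hg : IsRiemannianMetric g)
    (hs : ContDiff ℝ ∞ fun p : ℝ × Sp d × Sp d => γ p.1 p.2.1 p.2.2) :
    ContDiff ℝ ∞ (Function.uncurry (conn g γ)) :=
  (hg.contDiff_chr.comp (contDiff_pos hs)).clm_apply (contDiff_vel hs)

theorem contDiff_covJac (hg : IsRiemannianMetric g)
    (hs : ContDiff ℝ ∞ fun p : ℝ × Sp d × Sp d => γ p.1 p.2.1 p.2.2) :
    ContDiff ℝ ∞ (Function.uncurry (covJac g γ)) :=
  (contDiff_fderiv_snd (contDiff_vel hs)).add ((contDiff_conn hg hs).clm_comp (contDiff_jac hs))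

theorem contDiff_slice {P F : Type} [NormedAddCommGroup P] [NormedSpace ℝ P]
    [NormedAddCommGroup F] [NormedSpace ℝ F] {f : ℝ → P → F}
    (hf : ContDiff ℝ ∞ (Function.uncurry f)) (t : ℝ) : ContDiff ℝ ∞ (f t) :=
  hf.comp (f := fun p : P => (t, p)) (by fun_prop)

theorem IsGeodesicFlow.hasDerivAt_pos (hγ : IsGeodesicFlow g γ) (t : ℝ) (z : Sp d × Sp d) :
    HasDerivAt (fun s => pos γ s z) (vel γ t z) t :=
  ((hγ z.1 z.2).1.1 t).hasDerivAt

theorem IsGeodesicFlow.hasDerivAt_vel (hγ : IsGeodesicFlow g γ) (t : ℝ) (z : Sp d × Sp d) :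
    HasDerivAt (fun s => vel γ s z) (-chr g (pos γ t z) (vel γ t z) (vel γ t z)) t :=
  (hasFDerivAt_snd (𝕜 := ℝ) (E := Sp d) (F := Sp d)).comp_hasDerivAt t
    ((hγ z.1 z.2).1.hasDerivAt t)

theorem hasDerivAt_jac (hs : ContDiff ℝ ∞ fun p : ℝ × Sp d × Sp d => γ p.1 p.2.1 p.2.2) (t : ℝ)
    (z : Sp d × Sp d) : HasDerivAt (fun s => jac γ s z) (fderiv ℝ (vel γ t) z) t :=
  hasDerivAt_fderiv_snd (contDiff_pos hs) t z

theorem fderiv_vel_eq (t : ℝ) (z : Sp d × Sp d) :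
    fderiv ℝ (vel γ t) z = covJac g γ t z - (conn g γ t z).comp (jac γ t z) := by
  rw [covJac, add_sub_cancel_right]

theorem hasDerivAt_comp_curve {E F : Type} [NormedAddCommGroup E] [NormedSpace ℝ E]
    [NormedAddCommGroup F] [NormedSpace ℝ F] {f : E → F} {f' : E →L[ℝ] F} {q : ℝ → E} {q' : E}
    {t : ℝ} (hf : HasFDerivAt f f' (q t)) (hq : HasDerivAt q q' t) :
    HasDerivAt (fun s => f (q s)) (f' q') t :=
  hf.comp_hasDerivAt t hq

theorem IsRiemannianMetric.fderiv_chr_symm (hg : IsRiemannianMetric g) (x X Y Z : Sp d) :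
    fderiv ℝ (chr g) x X Y Z = fderiv ℝ (chr g) x X Z Y := by
  ext n
  rw [hg.fderiv_chr_apply, hg.fderiv_chr_apply, Finset.sum_comm]
  refine Finset.sum_congr rfl fun j _ => Finset.sum_congr rfl fun k _ => ?_
  have h : christoffel g n k j = christoffel g n j k := funext fun x => hg.christoffel_symm n k j x
  rw [h]; ring

theorem fderiv_chr_apply_self (hg : IsRiemannianMetric g) {P : Type} [NormedAddCommGroup P]
    [NormedSpace ℝ P] {q v : P → Sp d} {q' v' : P →L[ℝ] Sp d} {z : P} (hq : HasFDerivAt q q' z)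
    (hv : HasFDerivAt v v' z) (h : P) :
    fderiv ℝ (fun z => chr g (q z) (v z) (v z)) z h
      = fderiv ℝ (chr g) (q z) (q' h) (v z) (v z) + 2 • chr g (q z) (v z) (v' h) := by
  have h1 : HasFDerivAt (fun z => chr g (q z)) ((fderiv ℝ (chr g) (q z)).comp q') z :=
    (((hg.contDiff_chr.differentiable (by simp)) (q z)).hasFDerivAt).comp z hq
  have h2 := (h1.clm_apply hv).clm_apply hv
  rw [h2.fderiv, two_smul]
  have h3 := hg.chr_symm (q z) (v' h) (v z)
  simp only [add_apply, ContinuousLinearMap.comp_apply, ContinuousLinearMap.flip_apply]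
  rw [h3]; abel

/-- The linearized acceleration contributes `-DΓ(J)(v, v)`, and the time derivative of `Γ(v, J)`
contributes `DΓ(v)(v, J)`. Together with the quadratic terms in `Γ` these form `R(v, J)v`, and no
bare derivative of `Γ` survives. -/
theorem hasDerivAt_covJac (hg : IsRiemannianMetric g) (hγ : IsGeodesicFlow g γ)
    (hs : ContDiff ℝ ∞ fun p : ℝ × Sp d × Sp d => γ p.1 p.2.1 p.2.2) (t : ℝ) (z : Sp d × Sp d) :
    HasDerivAt (fun s => covJac g γ s z)
      (-(conn g γ t z).comp (covJac g γ t z) + (tidal g γ t z).comp (jac γ t z)) t := by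
  let x := pos γ t z
  let v := vel γ t z
  have hacc : (fun z => deriv (fun s => vel γ s z) t)
      = fun z => -chr g (pos γ t z) (vel γ t z) (vel γ t z) :=
    funext fun z => (hγ.hasDerivAt_vel t z).deriv
  have h1 : HasDerivAt (fun s => fderiv ℝ (vel γ s) z)
      (fderiv ℝ (fun z => -chr g (pos γ t z) (vel γ t z) (vel γ t z)) z) t := by
    have := hasDerivAt_fderiv_snd (contDiff_vel hs) t z
    rwa [hacc] at this
  have h2 : HasDerivAt (fun s => chr g (pos γ s z)) (fderiv ℝ (chr g) x v) t :=
    hasDerivAt_comp_curve ((hg.contDiff_chr.differentiable (by simp)) x).hasFDerivAt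
      (hγ.hasDerivAt_pos t z)
  have h3 : HasDerivAt (fun s => conn g γ s z)
      (fderiv ℝ (chr g) x v v + chr g x (-chr g x v v)) t :=
    h2.clm_apply (hγ.hasDerivAt_vel t z)
  have h4 := h1.add (h3.clm_comp (hasDerivAt_jac hs t z))
  refine h4.congr_deriv ?_
  refine ContinuousLinearMap.ext fun h => ?_
  have hp : HasFDerivAt (pos γ t) (jac γ t z) z :=
    (((contDiff_slice (contDiff_pos hs) t).differentiable (by simp)) z).hasFDerivAt
  have hv : HasFDerivAt (vel γ t) (fderiv ℝ (vel γ t) z) z :=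
    (((contDiff_slice (contDiff_vel hs) t).differentiable (by simp)) z).hasFDerivAt
  have h5 := fderiv_chr_apply_self hg hp hv h
  have h6 : fderiv ℝ (fun z => -chr g (pos γ t z) (vel γ t z) (vel γ t z)) z
      = -fderiv ℝ (fun z => chr g (pos γ t z) (vel γ t z) (vel γ t z)) z := fderiv_fun_neg
  have h7 := hg.curv_eq x v (jac γ t z h) v
  rw [h6]
  show -(fderiv ℝ (fun z => chr g (pos γ t z) (vel γ t z) (vel γ t z)) z h)
      + ((fderiv ℝ (chr g) x v v + chr g x (-chr g x v v)) (jac γ t z h)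
        + chr g x v (fderiv ℝ (vel γ t) z h))
    = -(chr g x v (fderiv ℝ (vel γ t) z h + chr g x v (jac γ t z h)))
      + curv g x v v (jac γ t z h)
  rw [h5, h7, map_neg, map_add]
  have h8 := hg.chr_symm x (chr g x v v) (jac γ t z h)
  simp only [add_apply, neg_apply]
  rw [h8, hg.chr_symm x (jac γ t z h) v, hg.fderiv_chr_symm x v (jac γ t z h) v, two_smul]
  show -(fderiv ℝ (chr g) x (jac γ t z h) v v
    + (chr g x v (fderiv ℝ (vel γ t) z h) + chr g x v (fderiv ℝ (vel γ t) z h))) + _ = _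
  abel

theorem IsGeodesicFlow.pos_zero (hγ : IsGeodesicFlow g γ) : pos γ 0 = Prod.fst :=
  funext fun z => (hγ z.1 z.2).2.1

theorem IsGeodesicFlow.vel_zero (hγ : IsGeodesicFlow g γ) : vel γ 0 = Prod.snd :=
  funext fun z => (hγ z.1 z.2).2.2

theorem IsGeodesicFlow.jac_zero (hγ : IsGeodesicFlow g γ) (z : Sp d × Sp d) :
    jac γ 0 z = ContinuousLinearMap.fst ℝ (Sp d) (Sp d) := by
  rw [jac, hγ.pos_zero]; exact fderiv_fst

theorem IsGeodesicFlow.covJac_zero (hγ : IsGeodesicFlow g γ) (z : Sp d × Sp d) :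
    covJac g γ 0 z = ContinuousLinearMap.snd ℝ (Sp d) (Sp d)
      + (conn g γ 0 z).comp (ContinuousLinearMap.fst ℝ (Sp d) (Sp d)) := by
  rw [covJac, hγ.jac_zero, hγ.vel_zero]; congr 1; exact fderiv_snd

theorem norm_vel_le {c : ℝ} (hg : IsRiemannianMetric g) (hsn : SmallNorms g c) (hc : 0 ≤ c)
    (hcd : c ≤ 1 / (2 * (d + 1))) (hγ : IsGeodesicFlow g γ) (t : ℝ) (z : Sp d × Sp d) :
    ‖vel γ t z‖ ≤ 2 * ‖z.2‖ := by
  have := norm_velocity_le hg hsn hc hcd (z := fun t => (pos γ t z, vel γ t z)) (σ := fun _ => 1)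
    (fun t => by rw [one_smul]; exact (hγ z.1 z.2).1.hasDerivAt t) t
  simpa [hγ.vel_zero] using this

end Jacobi

/-! ### First derivatives: comparison with the flat flow. -/

section FirstOrder

variable {d : ℕ}

/-- The first derivatives of the geodesic flow are close to those of the flat flow. -/
theorem exists_first_order_bound (d : ℕ) : ∃ b, 0 ≤ b ∧
    ∀ (g : MetricField d) (c : ℝ) (γ : ℝ → Sp d → Sp d → Sp d), IsRiemannianMetric g →
    SmallNorms g c → 0 ≤ c → c ≤ 1 / (2 * (d + 1)) → IsGeodesicFlow g γ →
    (ContDiff ℝ ∞ fun p : ℝ × Sp d × Sp d => γ p.1 p.2.1 p.2.2) →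
    ∀ z : Sp d × Sp d, ‖z.2‖ ≤ 2 → ∀ t : ℝ, |t| ≤ 1 →
      ‖fderiv ℝ (vel γ t) z - ContinuousLinearMap.snd ℝ (Sp d) (Sp d)‖ ≤ b * c ∧
      ‖jac γ t z - ContinuousLinearMap.fst ℝ (Sp d) (Sp d)
        - t • ContinuousLinearMap.snd ℝ (Sp d) (Sp d)‖ ≤ b * c * |t| := by
  obtain ⟨A₁, hA₁, hchr⟩ := exists_norm_chr_le d
  obtain ⟨A₂, hA₂, hcurv⟩ := exists_norm_curv_le d
  -- The speed is at most `4`, once in the connection term and twice in the curvature term, so `a *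
  -- c` bounds both coefficients.
  let a : ℝ := 4 * A₁ + 16 * A₂
  have ha : 0 ≤ a := by positivity
  -- An a priori bound for `(J, K)`: the rate `1 + 2 * a` covers both equations, and `1 + a` covers
  -- the initial values.
  let N : ℝ := gronwallBound 1 (1 + 2 * a) 1 1 * (1 + a)
  have hN0 : 0 ≤ N := by
    refine mul_nonneg ?_ (by positivity)
    have h0 := gronwallBound_x0 1 (1 + 2 * a) 1
    have := gronwallBound_mono (zero_le_one) (zero_le_one) (by positivity : 0 ≤ 1 + 2 * a)
      (zero_le_one (α := ℝ))
    rw [h0] at this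
    linarith
  -- Two terms `a * N` come from the drift of `K`, one from `Γ(v, J)` at time `t`, and the last `a`
  -- from the connection term in `K 0`.
  refine ⟨3 * a * N + a, by positivity, fun g c γ hg hsn hc hcd hγ hs z hz => ?_⟩
  have hc1 : c ≤ 1 := hcd.trans (by rw [div_le_one (by positivity)]; linarith [Nat.cast_nonneg (α := ℝ) d])
  have hV : ∀ t, ‖vel γ t z‖ ≤ 4 := fun t =>
    (norm_vel_le hg hsn hc hcd hγ t z).trans (by linarith)
  have hA : ∀ t, ‖conn g γ t z‖ ≤ a * c := fun t => by
    refine ((chr g _).le_opNorm _).trans ?_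
    calc ‖chr g (pos γ t z)‖ * ‖vel γ t z‖ ≤ (A₁ * c) * 4 := by
          gcongr
          · exact hchr g c hg hsn hc hcd _
          · exact hV t
      _ ≤ a * c := by simp only [a]; nlinarith [mul_nonneg hA₂ hc]
  have hB : ∀ t, ‖tidal g γ t z‖ ≤ a * c := fun t => by
    refine (hcurv g c hg hsn hc hcd _ _ _).trans ?_
    calc A₂ * c * (‖vel γ t z‖ * ‖vel γ t z‖) ≤ A₂ * c * (4 * 4) := by
          gcongr <;> exact hV t
      _ ≤ a * c := by simp only [a]; nlinarith [mul_nonneg hA₁ hc]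
  have hac : a * c ≤ a := mul_le_of_le_one_right ha hc1
  let J := fun t => jac γ t z
  let K := fun t => covJac g γ t z
  let W := fun t => fderiv ℝ (vel γ t) z
  have hJ : ∀ t, HasDerivAt J (W t) t := fun t => hasDerivAt_jac hs t z
  have hK : ∀ t, HasDerivAt K (-(conn g γ t z).comp (K t) + (tidal g γ t z).comp (J t)) t :=
    fun t => hasDerivAt_covJac hg hγ hs t z
  have hW : ∀ t, W t = K t - (conn g γ t z).comp (J t) := fun t => fderiv_vel_eq t z
  have hcomp : ∀ (T : Sp d →L[ℝ] Sp d) (S : Sp d × Sp d →L[ℝ] Sp d) (B : ℝ), ‖T‖ ≤ a * c →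
      ‖S‖ ≤ B → ‖T.comp S‖ ≤ a * c * B := fun T S B hT hS =>
    (T.opNorm_comp_le S).trans (mul_le_mul hT hS (norm_nonneg _) (by positivity))
  have hfst : ‖ContinuousLinearMap.fst ℝ (Sp d) (Sp d)‖ ≤ 1 :=
    ContinuousLinearMap.norm_fst_le ..
  have hsnd : ‖ContinuousLinearMap.snd ℝ (Sp d) (Sp d)‖ ≤ 1 :=
    ContinuousLinearMap.norm_snd_le ..
  have hK0 : K 0 = ContinuousLinearMap.snd ℝ (Sp d) (Sp d)
      + (conn g γ 0 z).comp (ContinuousLinearMap.fst ℝ (Sp d) (Sp d)) := hγ.covJac_zero z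
  have hgron : ∀ t, |t| ≤ 1 → ‖(J t, K t)‖ ≤ N := by
    intro t ht
    refine norm_le_gronwallBound_mul_of_abs_le_one (K := 1 + 2 * a) (ε := 1 + a) (by positivity)
      (by positivity) (f := fun t => (J t, K t)) (fun t _ => (hJ t).prodMk (hK t)) ?_ ?_ ht
    · rw [Prod.norm_def]
      refine max_le ?_ ?_
      · show ‖jac γ 0 z‖ ≤ _
        rw [hγ.jac_zero]; linarith
      · show ‖K 0‖ ≤ _
        rw [hK0]
        refine (norm_add_le _ _).trans (add_le_add hsnd ?_)
        exact (hcomp _ _ 1 (hA 0) hfst).trans (by linarith)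
    · intro t _
      have hJn : ‖J t‖ ≤ ‖(J t, K t)‖ := norm_fst_le (J t, K t)
      have hKn : ‖K t‖ ≤ ‖(J t, K t)‖ := norm_snd_le (J t, K t)
      have hn := norm_nonneg (J t, K t)
      have hle : a * c * ‖(J t, K t)‖ ≤ a * ‖(J t, K t)‖ := by gcongr
      have h1 := hcomp _ _ _ (hA t) hJn
      have h2 := hcomp _ _ _ (hA t) hKn
      have h3 := hcomp _ _ _ (hB t) hJn
      rw [Prod.norm_def]
      refine max_le ?_ ?_
      · show ‖W t‖ ≤ _
        rw [hW]
        refine (norm_sub_le _ _).trans ?_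
        nlinarith
      · show ‖-(conn g γ t z).comp (K t) + (tidal g γ t z).comp (J t)‖ ≤ _
        refine (norm_add_le _ _).trans ?_
        rw [norm_neg]
        nlinarith
  have hJN : ∀ t, |t| ≤ 1 → ‖J t‖ ≤ N := fun t ht => (norm_fst_le (J t, K t)).trans (hgron t ht)
  have hKN : ∀ t, |t| ≤ 1 → ‖K t‖ ≤ N := fun t ht => (norm_snd_le (J t, K t)).trans (hgron t ht)
  have hWb : ∀ t, |t| ≤ 1 → ‖W t - ContinuousLinearMap.snd ℝ (Sp d) (Sp d)‖
      ≤ (3 * a * N + a) * c := by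
    intro t ht
    have h1 : ‖K t - K 0‖ ≤ 2 * (a * c * N) * |t| := by
      refine norm_sub_le_mul_abs_of_deriv_le (fun t _ => hK t) (fun t ht => ?_) ht
      refine (norm_add_le _ _).trans ?_
      rw [norm_neg]
      have h2 := hcomp _ _ _ (hA t) (hKN t ht)
      have h3 := hcomp _ _ _ (hB t) (hJN t ht)
      linarith
    have h2 : W t - ContinuousLinearMap.snd ℝ (Sp d) (Sp d) = (K t - K 0)
        + (conn g γ 0 z).comp (ContinuousLinearMap.fst ℝ (Sp d) (Sp d))
        - (conn g γ t z).comp (J t) := by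
      rw [hW, hK0]; abel
    rw [h2]
    have h3 := hcomp _ _ 1 (hA 0) hfst
    have h4 := hcomp _ _ _ (hA t) (hJN t ht)
    have h5 : 2 * (a * c * N) * |t| ≤ 2 * (a * c * N) := mul_le_of_le_one_right (by positivity) ht
    refine (norm_sub_le _ _).trans ?_
    have h6 := norm_add_le (K t - K 0)
      ((conn g γ 0 z).comp (ContinuousLinearMap.fst ℝ (Sp d) (Sp d)))
    linarith
  refine fun t ht => ⟨hWb t ht, ?_⟩
  -- The deviation from the flat flow vanishes at time `0` and has derivative `W - snd = O(c)`,
  -- which gives the factor `|t|`.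
  have h1 : ∀ t, HasDerivAt (fun t => J t - ContinuousLinearMap.fst ℝ (Sp d) (Sp d)
      - t • ContinuousLinearMap.snd ℝ (Sp d) (Sp d))
      (W t - ContinuousLinearMap.snd ℝ (Sp d) (Sp d)) t := fun t => by
    have := ((hJ t).sub_const (ContinuousLinearMap.fst ℝ (Sp d) (Sp d))).sub
      ((hasDerivAt_id t).smul_const (ContinuousLinearMap.snd ℝ (Sp d) (Sp d)))
    exact this.congr_deriv (by simp)
  have h2 := norm_sub_le_mul_abs_of_deriv_le (fun t _ => h1 t) hWb ht
  have h3 : J 0 = ContinuousLinearMap.fst ℝ (Sp d) (Sp d) := hγ.jac_zero z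
  have h4 : J 0 - ContinuousLinearMap.fst ℝ (Sp d) (Sp d)
      - (0 : ℝ) • ContinuousLinearMap.snd ℝ (Sp d) (Sp d) = 0 := by
    rw [h3, sub_self]
    exact ContinuousLinearMap.ext fun x => by simp
  rw [h4, sub_zero] at h2
  exact h2

end FirstOrder

/-! ### Top order estimates for families of linear systems. -/

section Families

variable {ι D P E F G : Type} [NormedAddCommGroup P] [NormedSpace ℝ P] [NormedAddCommGroup E]
  [NormedSpace ℝ E] [NormedAddCommGroup F] [NormedSpace ℝ F] [NormedAddCommGroup G]
  [NormedSpace ℝ G] {k : ℕ}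

/-- In a bilinear expression only the zeroth order term involves the top derivative. -/
theorem exists_norm_iteratedFDeriv_bilin_le (B : E →L[ℝ] F →L[ℝ] G) {M : ι → ℝ}
    {f : ι → P → E} {g : ι → P → F} {p : ι → P} (hM : ∀ τ, 1 ≤ M τ) (hf : SymBdd k M f p)
    (hgs : ∀ τ, ContDiff ℝ ∞ (g τ))
    (hg : ∀ i < k, ∃ C, ∀ τ, ‖iteratedFDeriv ℝ i (g τ) (p τ)‖ ≤ C * M τ ^ i) :
    ∃ C, 0 ≤ C ∧ ∀ τ, ‖iteratedFDeriv ℝ k (fun x => B (f τ x) (g τ x)) (p τ)‖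
      ≤ C * ‖iteratedFDeriv ℝ k (g τ) (p τ)‖ + C * M τ ^ k := by
  obtain ⟨a, ha0, ha⟩ := hf.exists_uniform hM
  choose! b hb using hg
  let S : ℝ := ∑ i ∈ Finset.range k, (k.choose (i + 1) : ℝ) * a * |b (k - (i + 1))|
  have hS : 0 ≤ S := Finset.sum_nonneg fun i _ => by positivity
  refine ⟨‖B‖ * (a + S), mul_nonneg (norm_nonneg B) (by positivity), fun τ => ?_⟩
  have hM0 : 0 ≤ M τ := zero_le_one.trans (hM τ)
  have h1 := B.norm_iteratedFDeriv_le_of_bilinear (hf.smooth τ) (hgs τ) (p τ) (n := k)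
    (by exact_mod_cast le_top)
  refine h1.trans ?_
  rw [mul_assoc, mul_assoc, ← mul_add]
  refine mul_le_mul_of_nonneg_left ?_ (norm_nonneg B)
  -- Splits off the Leibniz term in which all derivatives fall on `g`. Every other term involves
  -- only the lower derivatives of `g` already bounded.
  rw [Finset.sum_range_succ']
  have h2 : ∑ i ∈ Finset.range k, (k.choose (i + 1) : ℝ) * ‖iteratedFDeriv ℝ (i + 1) (f τ) (p τ)‖
      * ‖iteratedFDeriv ℝ (k - (i + 1)) (g τ) (p τ)‖ ≤ S * M τ ^ k := by
    rw [Finset.sum_mul]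
    refine Finset.sum_le_sum fun i hi => ?_
    have hi' : i + 1 ≤ k := Finset.mem_range.1 hi
    have h3 := ha (i + 1) hi' τ
    have h4 : ‖iteratedFDeriv ℝ (k - (i + 1)) (g τ) (p τ)‖
        ≤ |b (k - (i + 1))| * M τ ^ (k - (i + 1)) :=
      (hb (k - (i + 1)) (by omega) τ).trans
        (mul_le_mul_of_nonneg_right (le_abs_self _) (by positivity))
    calc _ ≤ (k.choose (i + 1) : ℝ) * (a * M τ ^ (i + 1))
          * (|b (k - (i + 1))| * M τ ^ (k - (i + 1))) := by gcongr
      _ = (k.choose (i + 1) : ℝ) * a * |b (k - (i + 1))|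
          * (M τ ^ (i + 1) * M τ ^ (k - (i + 1))) := by ring
      _ = _ := by rw [← pow_add, Nat.add_sub_cancel' hi']
  have h5 : ((k.choose 0 : ℕ) : ℝ) * ‖iteratedFDeriv ℝ 0 (f τ) (p τ)‖
      * ‖iteratedFDeriv ℝ (k - 0) (g τ) (p τ)‖ ≤ a * ‖iteratedFDeriv ℝ k (g τ) (p τ)‖ := by
    have := ha 0 (Nat.zero_le k) τ
    rw [pow_zero, mul_one] at this
    rw [Nat.choose_zero_right, Nat.cast_one, one_mul, Nat.sub_zero]
    exact mul_le_mul_of_nonneg_right this (norm_nonneg _)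
  have h6 : 0 ≤ S * ‖iteratedFDeriv ℝ k (g τ) (p τ)‖ := mul_nonneg hS (norm_nonneg _)
  have h7 : 0 ≤ a * M τ ^ k := by positivity
  linarith

/-- The time interval `[-1, 1]`. -/
abbrev Times : Type := Set.Icc (-1 : ℝ) 1

/-- Symbol bounds for a family of time dependent functions, uniformly for times in `[-1, 1]`. -/
def FlowBdd (k : ℕ) (M : D → ℝ) (f : D → ℝ → P → F) (p : D → P) : Prop :=
  SymBdd k (fun τ : D × Times => M τ.1) (fun τ => f τ.1 τ.2) (fun τ => p τ.1)

/-- Top order estimate for a linear system of the form of the Jacobi equations. -/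
theorem exists_norm_iteratedFDeriv_linear_system_le (B : E →L[ℝ] F →L[ℝ] F) {M : D → ℝ}
    {p : D → P} {S T : D → ℝ → P → E} {J K : D → ℝ → P → F} (hM : ∀ δ, 1 ≤ M δ)
    (hS : FlowBdd k M S p) (hT : FlowBdd k M T p)
    (hJs : ∀ δ, ContDiff ℝ ∞ (Function.uncurry (J δ)))
    (hKs : ∀ δ, ContDiff ℝ ∞ (Function.uncurry (K δ)))
    (hSs : ∀ δ t, ContDiff ℝ ∞ (S δ t)) (hTs : ∀ δ t, ContDiff ℝ ∞ (T δ t))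
    (hJ : ∀ δ t z, HasDerivAt (fun s => J δ s z) (K δ t z - B (S δ t z) (J δ t z)) t)
    (hK : ∀ δ t z, HasDerivAt (fun s => K δ s z)
      (-B (S δ t z) (K δ t z) + B (T δ t z) (J δ t z)) t)
    (hJl : ∀ i < k, ∃ C, ∀ τ : D × Times, ‖iteratedFDeriv ℝ i (J τ.1 τ.2) (p τ.1)‖ ≤ C * M τ.1 ^ i)
    (hKl : ∀ i < k, ∃ C, ∀ τ : D × Times, ‖iteratedFDeriv ℝ i (K τ.1 τ.2) (p τ.1)‖ ≤ C * M τ.1 ^ i)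
    (hJ0 : ∃ C, ∀ δ, ‖iteratedFDeriv ℝ k (J δ 0) (p δ)‖ ≤ C * M δ ^ k)
    (hK0 : ∃ C, ∀ δ, ‖iteratedFDeriv ℝ k (K δ 0) (p δ)‖ ≤ C * M δ ^ k) :
    ∃ C, ∀ τ : D × Times, ‖iteratedFDeriv ℝ k (J τ.1 τ.2) (p τ.1)‖ ≤ C * M τ.1 ^ k ∧
      ‖iteratedFDeriv ℝ k (K τ.1 τ.2) (p τ.1)‖ ≤ C * M τ.1 ^ k := by
  have hM' : ∀ τ : D × Times, 1 ≤ M τ.1 := fun τ => hM τ.1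
  have hJt : ∀ δ t, ContDiff ℝ ∞ (J δ t) := fun δ t => contDiff_slice (hJs δ) t
  have hKt : ∀ δ t, ContDiff ℝ ∞ (K δ t) := fun δ t => contDiff_slice (hKs δ) t
  obtain ⟨C₁, hC₁, h₁⟩ := exists_norm_iteratedFDeriv_bilin_le B hM' hS (fun τ => hJt τ.1 τ.2) hJl
  obtain ⟨C₂, hC₂, h₂⟩ := exists_norm_iteratedFDeriv_bilin_le B hM' hS (fun τ => hKt τ.1 τ.2) hKl
  obtain ⟨C₃, hC₃, h₃⟩ := exists_norm_iteratedFDeriv_bilin_le B hM' hT (fun τ => hJt τ.1 τ.2) hJl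
  obtain ⟨a, ha⟩ := hJ0
  obtain ⟨b, hb⟩ := hK0
  -- The rate: `1` for the term `K` in `J'`, and one constant for each of the three bilinear terms.
  -- `R` adds the sizes of the initial values.
  let Q : ℝ := 1 + C₁ + C₂ + C₃
  let R : ℝ := Q + |a| + |b|
  have hQ : 0 ≤ Q := by positivity
  refine ⟨gronwallBound 1 Q 1 1 * R, ?_⟩
  rintro ⟨δ, t, ht⟩
  have hMk : 0 ≤ M δ ^ k := pow_nonneg (zero_le_one.trans (hM δ)) k
  let f : ℝ → (P [×k]→L[ℝ] F) × (P [×k]→L[ℝ] F) := fun s =>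
    (iteratedFDeriv ℝ k (J δ s) (p δ), iteratedFDeriv ℝ k (K δ s) (p δ))
  have hJd : ∀ s, (fun z => deriv (fun s => J δ s z) s) = fun z => K δ s z - B (S δ s z) (J δ s z) :=
    fun s => funext fun z => (hJ δ s z).deriv
  have hKd : ∀ s, (fun z => deriv (fun s => K δ s z) s)
      = fun z => -B (S δ s z) (K δ s z) + B (T δ s z) (J δ s z) :=
    fun s => funext fun z => (hK δ s z).deriv
  have hd1 := fun s => hasDerivAt_iteratedFDeriv (hJs δ) k s (p δ)
  have hd2 := fun s => hasDerivAt_iteratedFDeriv (hKs δ) k s (p δ)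
  simp only [hJd] at hd1
  simp only [hKd] at hd2
  have hle : ∀ {f : P → F}, ContDiff ℝ ∞ f → ContDiffAt ℝ k f (p δ) := fun hf =>
    (hf.of_le (by exact_mod_cast le_top)).contDiffAt
  have hbil : ∀ {u : P → E} {v : P → F}, ContDiff ℝ ∞ u → ContDiff ℝ ∞ v →
      ContDiff ℝ ∞ fun z => B (u z) (v z) := fun hu hv => (B.contDiff.comp hu).clm_apply hv
  -- The rate `Q` is free of `M`; only the forcing and the initial values carry `M ^ k`.
  have key : ‖f t‖ ≤ gronwallBound 1 Q 1 1 * (R * M δ ^ k) := by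
    refine norm_le_gronwallBound_mul_of_abs_le_one hQ (mul_nonneg (by positivity) hMk)
      (fun s _ => (hd1 s).prodMk (hd2 s)) ?_ ?_ (abs_le.2 ht)
    · rw [Prod.norm_def]
      refine max_le ((ha δ).trans ?_) ((hb δ).trans ?_) <;>
        refine mul_le_mul_of_nonneg_right ?_ hMk
      · linarith [le_abs_self a, abs_nonneg b]
      · linarith [le_abs_self b, abs_nonneg a]
    · intro s hs
      have hsm : s ∈ Set.Icc (-1 : ℝ) 1 := abs_le.1 hs
      have i1 := h₁ (δ, ⟨s, hsm⟩)
      have i2 := h₂ (δ, ⟨s, hsm⟩)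
      have i3 := h₃ (δ, ⟨s, hsm⟩)
      dsimp only at i1 i2 i3
      have n1 : ‖iteratedFDeriv ℝ k (J δ s) (p δ)‖ ≤ ‖f s‖ := norm_fst_le (f s)
      have n2 : ‖iteratedFDeriv ℝ k (K δ s) (p δ)‖ ≤ ‖f s‖ := norm_snd_le (f s)
      have m1 := mul_le_mul_of_nonneg_left n1 hC₁
      have m2 := mul_le_mul_of_nonneg_left n2 hC₂
      have m3 := mul_le_mul_of_nonneg_left n1 hC₃
      have hf0 : 0 ≤ ‖f s‖ := norm_nonneg _
      have q1 := mul_nonneg hC₁ hf0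
      have q2 := mul_nonneg hC₂ hf0
      have q3 := mul_nonneg hC₃ hf0
      have r1 := mul_nonneg hC₁ hMk
      have r2 := mul_nonneg hC₂ hMk
      have r3 := mul_nonneg hC₃ hMk
      have r4 := mul_nonneg (abs_nonneg a) hMk
      have r5 := mul_nonneg (abs_nonneg b) hMk
      have hQf : Q * ‖f s‖ = ‖f s‖ + C₁ * ‖f s‖ + C₂ * ‖f s‖ + C₃ * ‖f s‖ := by
        simp only [Q]; ring
      have hRM : R * M δ ^ k = M δ ^ k + C₁ * M δ ^ k + C₂ * M δ ^ k + C₃ * M δ ^ k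
          + |a| * M δ ^ k + |b| * M δ ^ k := by simp only [R, Q]; ring
      rw [Prod.norm_def]
      refine max_le ?_ ?_
      · have e : iteratedFDeriv ℝ k (fun z => K δ s z - B (S δ s z) (J δ s z)) (p δ)
            = iteratedFDeriv ℝ k (K δ s) (p δ)
              - iteratedFDeriv ℝ k (fun z => B (S δ s z) (J δ s z)) (p δ) :=
          iteratedFDeriv_sub_apply (hle (hKt δ s)) (hle (hbil (hSs δ s) (hJt δ s)))
        show ‖iteratedFDeriv ℝ k (fun z => K δ s z - B (S δ s z) (J δ s z)) (p δ)‖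
          ≤ Q * ‖f s‖ + R * M δ ^ k
        rw [e]
        refine (norm_sub_le _ _).trans ?_
        linarith
      · have e : iteratedFDeriv ℝ k (fun z => -B (S δ s z) (K δ s z) + B (T δ s z) (J δ s z)) (p δ)
            = -iteratedFDeriv ℝ k (fun z => B (S δ s z) (K δ s z)) (p δ)
              + iteratedFDeriv ℝ k (fun z => B (T δ s z) (J δ s z)) (p δ) := by
          rw [← iteratedFDeriv_neg_apply]
          exact iteratedFDeriv_add_apply (hle (hbil (hSs δ s) (hKt δ s)).neg)
            (hle (hbil (hTs δ s) (hJt δ s)))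
        show ‖iteratedFDeriv ℝ k (fun z => -B (S δ s z) (K δ s z) + B (T δ s z) (J δ s z)) (p δ)‖
          ≤ Q * ‖f s‖ + R * M δ ^ k
        rw [e]
        refine (norm_add_le _ _).trans ?_
        rw [norm_neg]
        linarith
  rw [← mul_assoc] at key
  exact ⟨(norm_fst_le (f t)).trans key, (norm_snd_le (f t)).trans key⟩

end Families

/-! ### Induction on the order of differentiation. -/

section Induction

variable {d k : ℕ} {C : MIdx d → ℝ}

theorem contDiff_tidal {g : MetricField d} {γ : ℝ → Sp d → Sp d → Sp d}
    (hg : IsRiemannianMetric g)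
    (hs : ContDiff ℝ ∞ fun p : ℝ × Sp d × Sp d => γ p.1 p.2.1 p.2.2) (t : ℝ) :
    ContDiff ℝ ∞ (tidal g γ t) := by
  have hp : ContDiff ℝ ∞ (pos γ t) := contDiff_slice (contDiff_pos hs) t
  have hv : ∀ i, ContDiff ℝ ∞ fun z => vel γ t z i := fun i =>
    (EuclideanSpace.proj (𝕜 := ℝ) i : Sp d →L[ℝ] ℝ).contDiff.comp
      (contDiff_slice (contDiff_vel hs) t)
  show ContDiff ℝ ∞ fun z => ∑ n, ∑ i, ∑ j, ∑ m,
    ((∑ l, upper g n l (pos γ t z) * riemann g i j m l (pos γ t z)) *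
      (vel γ t z i * vel γ t z m)) • coordRank j (EuclideanSpace.single n (1 : ℝ) : Sp d)
  exact ContDiff.sum fun n _ => ContDiff.sum fun i _ => ContDiff.sum fun j _ =>
    ContDiff.sum fun m _ => contDiff_smul_const (E := Sp d × Sp d) (F := Sp d →L[ℝ] Sp d) ((ContDiff.sum fun l _ =>
      ((hg.contDiff_upper n l).comp hp).mul ((hg.contDiff_riemann i j m l).comp hp)).mul
        ((hv i).mul (hv m))) _

/-- A metric satisfying the hypotheses with derivative constants `C`, its geodesic flow, and
initial data `z = (y, w)` with `|w| ≤ 2`. -/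
structure FlowDatum (d : ℕ) (C : MIdx d → ℝ) where
  M : ℝ
  c : ℝ
  g : MetricField d
  γ : ℝ → Sp d → Sp d → Sp d
  z : Sp d × Sp d
  one_le : 1 ≤ M
  nonneg : 0 ≤ c
  le : c ≤ 1 / (2 * (d + 1))
  metric : IsRiemannianMetric g
  small : SmallNorms g c
  bounds : DerivBounds g C M
  flow : IsGeodesicFlow g γ
  smooth : ContDiff ℝ ∞ fun p : ℝ × Sp d × Sp d => γ p.1 p.2.1 p.2.2
  norm_le : ‖z.2‖ ≤ 2

/-- The derivative of order `i + 1` of the position is the derivative of order `i` of `jac`, so only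
orders of `jac` strictly below `k` are needed. This strictness is what allows the induction to
close. -/
theorem flowBdd_comp_pos {a : MetricField d → Sp d → ℝ}
    (ha : ∀ q : FlowDatum d C × Times → Sp d, SymBdd k (fun τ => τ.1.M) (fun τ => a τ.1.g) q)
    (hJ : ∀ i < k, ∃ B, ∀ τ : FlowDatum d C × Times,
      ‖iteratedFDeriv ℝ i (jac τ.1.γ τ.2) τ.1.z‖ ≤ B * τ.1.M ^ i) :
    FlowBdd k FlowDatum.M (fun (δ : FlowDatum d C) t z => a δ.g (pos δ.γ t z)) FlowDatum.z :=
  SymBdd.comp (fun τ => τ.1.one_le) (ha fun τ => pos τ.1.γ τ.2 τ.1.z)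
    (fun τ => contDiff_slice (contDiff_pos τ.1.smooth) τ.2) fun i hi =>
      (hJ i hi).imp fun B hB τ => by
        rw [← norm_iteratedFDeriv_fderiv]; exact hB τ

theorem flowBdd_conn
    (hv : FlowBdd k FlowDatum.M (fun (δ : FlowDatum d C) => vel δ.γ) FlowDatum.z)
    (hJ : ∀ i < k, ∃ B, ∀ τ : FlowDatum d C × Times,
      ‖iteratedFDeriv ℝ i (jac τ.1.γ τ.2) τ.1.z‖ ≤ B * τ.1.M ^ i) :
    FlowBdd k FlowDatum.M (fun (δ : FlowDatum d C) => conn δ.g δ.γ) FlowDatum.z := by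
  have hM : ∀ τ : FlowDatum d C × Times, 1 ≤ τ.1.M := fun τ => τ.1.one_le
  have h : (fun (δ : FlowDatum d C) => conn δ.g δ.γ) = fun δ t z => ∑ n, ∑ i, ∑ j,
      ContinuousLinearMap.toSpanSingleton ℝ
        (coordRank j (EuclideanSpace.single n (1 : ℝ) : Sp d))
        (christoffel δ.g n i j (pos δ.γ t z) * EuclideanSpace.proj (𝕜 := ℝ) i (vel δ.γ t z)) := by
    funext δ t z
    simp only [conn, chr, sum_apply, smul_apply, coordRank_apply, smul_smul,
      ContinuousLinearMap.toSpanSingleton_apply]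
    rfl
  rw [h]
  refine SymBdd.sum _ fun n _ => SymBdd.sum _ fun i _ => SymBdd.sum _ fun j _ => SymBdd.clm ?_ _
  exact SymBdd.mul hM (flowBdd_comp_pos (a := fun g => christoffel g n i j) (fun q =>
    symBdd_christoffel hM (fun τ => τ.1.metric) (fun τ => τ.1.nonneg) (fun τ => τ.1.le)
      (fun τ => τ.1.small) (fun τ => τ.1.bounds) n i j) hJ) (SymBdd.clm hv _)

theorem flowBdd_tidal
    (hv : FlowBdd k FlowDatum.M (fun (δ : FlowDatum d C) => vel δ.γ) FlowDatum.z)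
    (hJ : ∀ i < k, ∃ B, ∀ τ : FlowDatum d C × Times,
      ‖iteratedFDeriv ℝ i (jac τ.1.γ τ.2) τ.1.z‖ ≤ B * τ.1.M ^ i) :
    FlowBdd k FlowDatum.M (fun (δ : FlowDatum d C) => tidal δ.g δ.γ) FlowDatum.z := by
  have hM : ∀ τ : FlowDatum d C × Times, 1 ≤ τ.1.M := fun τ => τ.1.one_le
  have h : (fun (δ : FlowDatum d C) => tidal δ.g δ.γ) = fun δ t z => ∑ n, ∑ i, ∑ j, ∑ m,
      ContinuousLinearMap.toSpanSingleton ℝ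
        (coordRank j (EuclideanSpace.single n (1 : ℝ) : Sp d))
        ((∑ l, upper δ.g n l (pos δ.γ t z) * riemann δ.g i j m l (pos δ.γ t z)) *
          (EuclideanSpace.proj (𝕜 := ℝ) i (vel δ.γ t z) *
            EuclideanSpace.proj (𝕜 := ℝ) m (vel δ.γ t z))) := rfl
  rw [h]
  refine SymBdd.sum _ fun n _ => SymBdd.sum _ fun i _ => SymBdd.sum _ fun j _ =>
    SymBdd.sum _ fun m _ => SymBdd.clm ?_ _
  refine SymBdd.mul hM (SymBdd.sum _ fun l _ => ?_)
    (SymBdd.mul hM (SymBdd.clm hv _) (SymBdd.clm hv _))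
  exact SymBdd.mul hM (flowBdd_comp_pos (a := fun g => upper g n l) (fun q =>
    symBdd_upper hM (fun τ => τ.1.metric) (fun τ => τ.1.nonneg) (fun τ => τ.1.le)
      (fun τ => τ.1.small) (fun τ => τ.1.bounds) n l) hJ)
    (flowBdd_comp_pos (a := fun g => riemann g i j m l) (fun q =>
      symBdd_riemann (fun τ => τ.1.metric) (fun τ => τ.1.bounds) i j m l) hJ)

/-- The coefficients of the Jacobi system are controlled to order `k` using `J` only below order
`k`, so the linear estimate applies at top order. At time `0`, `J` is constant and `K` is a constant
plus a connection term. -/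
theorem flowBdd_jac_covJac_of_vel
    (hv : FlowBdd k FlowDatum.M (fun (δ : FlowDatum d C) => vel δ.γ) FlowDatum.z)
    (hJ : ∀ i < k, ∃ B, ∀ τ : FlowDatum d C × Times,
      ‖iteratedFDeriv ℝ i (jac τ.1.γ τ.2) τ.1.z‖ ≤ B * τ.1.M ^ i)
    (hK : ∀ i < k, ∃ B, ∀ τ : FlowDatum d C × Times,
      ‖iteratedFDeriv ℝ i (covJac τ.1.g τ.1.γ τ.2) τ.1.z‖ ≤ B * τ.1.M ^ i) :
    FlowBdd k FlowDatum.M (fun (δ : FlowDatum d C) => jac δ.γ) FlowDatum.z ∧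
      FlowBdd k FlowDatum.M (fun (δ : FlowDatum d C) => covJac δ.g δ.γ) FlowDatum.z := by
  have hconn := flowBdd_conn hv hJ
  have htidal := flowBdd_tidal hv hJ
  have hJs : ∀ δ : FlowDatum d C, ContDiff ℝ ∞ (Function.uncurry (jac δ.γ)) := fun δ =>
    contDiff_jac δ.smooth
  have hKs : ∀ δ : FlowDatum d C, ContDiff ℝ ∞ (Function.uncurry (covJac δ.g δ.γ)) := fun δ =>
    contDiff_covJac δ.metric δ.smooth
  have htidal_smooth : ∀ (δ : FlowDatum d C) t, ContDiff ℝ ∞ (tidal δ.g δ.γ t) := fun δ t =>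
    contDiff_tidal δ.metric δ.smooth t
  have hfst : SymBdd k (FlowDatum.M (d := d) (C := C))
      (fun _ (_ : Sp d × Sp d) => ContinuousLinearMap.fst ℝ (Sp d) (Sp d)) FlowDatum.z :=
    SymBdd.const ⟨_, fun _ => le_rfl⟩
  have hsnd : SymBdd k (FlowDatum.M (d := d) (C := C))
      (fun _ (_ : Sp d × Sp d) => ContinuousLinearMap.snd ℝ (Sp d) (Sp d)) FlowDatum.z :=
    SymBdd.const ⟨_, fun _ => le_rfl⟩
  have hconn0 : SymBdd k (FlowDatum.M (d := d) (C := C)) (fun δ => conn δ.g δ.γ 0) FlowDatum.z :=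
    hconn.reindex fun δ => (δ, ⟨0, by simp⟩)
  have hJ0 : ∃ B, ∀ δ : FlowDatum d C, ‖iteratedFDeriv ℝ k (jac δ.γ 0) δ.z‖ ≤ B * δ.M ^ k := by
    obtain ⟨B, hB⟩ := hfst.bound k le_rfl
    refine ⟨B, fun δ => ?_⟩
    rw [show jac δ.γ 0 = _ from funext δ.flow.jac_zero]
    exact hB δ
  have hK0 : ∃ B, ∀ δ : FlowDatum d C,
      ‖iteratedFDeriv ℝ k (covJac δ.g δ.γ 0) δ.z‖ ≤ B * δ.M ^ k := by
    obtain ⟨B, hB⟩ :=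
      (hsnd.add (hconn0.clm_comp (fun δ => δ.one_le) hfst)).bound k le_rfl
    refine ⟨B, fun δ => ?_⟩
    rw [show covJac δ.g δ.γ 0 = _ from funext δ.flow.covJac_zero]
    exact hB δ
  obtain ⟨B, hB⟩ := exists_norm_iteratedFDeriv_linear_system_le
    (ContinuousLinearMap.compL ℝ (Sp d × Sp d) (Sp d) (Sp d)) (p := FlowDatum.z)
    (fun δ : FlowDatum d C => δ.one_le) hconn htidal hJs hKs
    (fun δ t => contDiff_slice (contDiff_conn δ.metric δ.smooth) t) htidal_smooth
    (fun δ t z => (hasDerivAt_jac δ.smooth t z).congr_deriv (fderiv_vel_eq t z))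
    (fun δ t z => hasDerivAt_covJac δ.metric δ.flow δ.smooth t z) hJ hK hJ0 hK0
  refine ⟨⟨fun τ => contDiff_slice (hJs τ.1) τ.2, fun i hi => ?_⟩,
    ⟨fun τ => contDiff_slice (hKs τ.1) τ.2, fun i hi => ?_⟩⟩
  · rcases hi.lt_or_eq with hi | rfl
    · exact hJ i hi
    · exact ⟨B, fun τ => (hB τ).1⟩
  · rcases hi.lt_or_eq with hi | rfl
    · exact hK i hi
    · exact ⟨B, fun τ => (hB τ).2⟩

theorem flowBdd_fderiv_vel
    (hv : FlowBdd k FlowDatum.M (fun (δ : FlowDatum d C) => vel δ.γ) FlowDatum.z)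
    (hJ : FlowBdd k FlowDatum.M (fun (δ : FlowDatum d C) => jac δ.γ) FlowDatum.z)
    (hK : FlowBdd k FlowDatum.M (fun (δ : FlowDatum d C) => covJac δ.g δ.γ) FlowDatum.z) :
    FlowBdd k FlowDatum.M (fun (δ : FlowDatum d C) t => fderiv ℝ (vel δ.γ t)) FlowDatum.z := by
  have h : (fun (δ : FlowDatum d C) t => fderiv ℝ (vel δ.γ t))
      = fun δ t z => covJac δ.g δ.γ t z - (conn δ.g δ.γ t z).comp (jac δ.γ t z) := by
    funext δ t z; exact fderiv_vel_eq t z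
  rw [h]
  exact SymBdd.sub hK (SymBdd.clm_comp (fun τ => τ.1.one_le)
    (flowBdd_conn hv fun i hi => hJ.bound i hi.le) hJ)

theorem exists_norm_vel_le :
    ∃ B, ∀ τ : FlowDatum d C × Times, ‖vel τ.1.γ τ.2 τ.1.z‖ ≤ B := by
  refine ⟨4, fun ⟨δ, t⟩ => ?_⟩
  have h1 := norm_vel_le δ.metric δ.small δ.nonneg δ.le δ.flow t δ.z
  have h2 := δ.norm_le
  show ‖vel δ.γ t δ.z‖ ≤ 4
  linarith

/-- The loop starts from the energy bound on the velocity. Each round gains one order for `vel`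
through `flowBdd_fderiv_vel`, and then one for `jac` and `covJac`. -/
theorem flowBdd_vel_jac_covJac (k : ℕ) (C : MIdx d → ℝ) :
    FlowBdd k FlowDatum.M (fun (δ : FlowDatum d C) => vel δ.γ) FlowDatum.z ∧
      FlowBdd k FlowDatum.M (fun (δ : FlowDatum d C) => jac δ.γ) FlowDatum.z ∧
      FlowBdd k FlowDatum.M (fun (δ : FlowDatum d C) => covJac δ.g δ.γ) FlowDatum.z := by
  have hvs : ∀ τ : FlowDatum d C × Times, ContDiff ℝ ∞ (vel τ.1.γ τ.2) := fun τ =>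
    contDiff_slice (contDiff_vel τ.1.smooth) τ.2
  induction k with
  | zero =>
    have hv : FlowBdd 0 FlowDatum.M (fun (δ : FlowDatum d C) => vel δ.γ) FlowDatum.z := by
      refine ⟨hvs, fun i hi => ?_⟩
      obtain rfl := Nat.le_zero.1 hi
      simpa using exists_norm_vel_le
    exact ⟨hv, flowBdd_jac_covJac_of_vel hv (by simp) (by simp)⟩
  | succ k ih =>
    obtain ⟨hv, hJ, hK⟩ := ih
    have hv' : FlowBdd (k + 1) FlowDatum.M (fun (δ : FlowDatum d C) => vel δ.γ) FlowDatum.z :=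
      SymBdd.of_fderiv (fun τ => τ.1.one_le) hvs exists_norm_vel_le (flowBdd_fderiv_vel hv hJ hK)
    exact ⟨hv', flowBdd_jac_covJac_of_vel hv' (fun i hi => hJ.bound i (Nat.le_of_lt_succ hi))
      fun i hi => hK.bound i (Nat.le_of_lt_succ hi)⟩

/-- Derivatives of order `k + 1` of the geodesic flow grow at most like `M ^ k`. -/
theorem exists_norm_iteratedFDeriv_flow_le (k : ℕ) (C : MIdx d → ℝ) :
    ∃ B, 0 ≤ B ∧ ∀ (δ : FlowDatum d C) (t : ℝ), |t| ≤ 1 →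
      ‖iteratedFDeriv ℝ (k + 1) (pos δ.γ t) δ.z‖ ≤ B * δ.M ^ k ∧
      ‖iteratedFDeriv ℝ (k + 1) (vel δ.γ t) δ.z‖ ≤ B * δ.M ^ k := by
  obtain ⟨hv, hJ, hK⟩ := flowBdd_vel_jac_covJac k C
  obtain ⟨B₁, hB₁⟩ := hJ.bound k le_rfl
  obtain ⟨B₂, hB₂⟩ := (flowBdd_fderiv_vel hv hJ hK).bound k le_rfl
  refine ⟨|B₁| + |B₂|, by positivity, fun δ t ht => ?_⟩
  have hMk : 0 ≤ δ.M ^ k := pow_nonneg (zero_le_one.trans δ.one_le) k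
  have h1 := hB₁ (δ, ⟨t, abs_le.1 ht⟩)
  have h2 := hB₂ (δ, ⟨t, abs_le.1 ht⟩)
  rw [← norm_iteratedFDeriv_fderiv, ← norm_iteratedFDeriv_fderiv]
  constructor
  · refine h1.trans (mul_le_mul_of_nonneg_right ?_ hMk)
    linarith [le_abs_self B₁, abs_nonneg B₂]
  · refine h2.trans (mul_le_mul_of_nonneg_right ?_ hMk)
    linarith [le_abs_self B₂, abs_nonneg B₁]

end Induction

/-! ### Bounds for mixed partial derivatives and the factor `|t|`. -/

section MixedBounds

variable {d : ℕ}

theorem multiPd_zero {F : Type} [NormedAddCommGroup F] [NormedSpace ℝ F] (β : MIdx d) :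
    multiPd β (fun _ : Sp d => (0 : F)) = fun _ => 0 := by
  have h : ∀ i : Fin d, pd i (fun _ : Sp d => (0 : F)) = fun _ => 0 := fun i => by
    funext x; simp [pd]
  unfold multiPd
  induction List.finRange d with
  | nil => rfl
  | cons i l ih => rw [List.foldr_cons, ih]; exact Function.iterate_fixed (h i) _

theorem multiPd_const {F : Type} [NormedAddCommGroup F] [NormedSpace ℝ F] {β : MIdx d}
    (hβ : 1 ≤ β.order) (a : F) : multiPd β (fun _ : Sp d => a) = fun _ => 0 := by
  obtain ⟨i, -, hi⟩ := Finset.exists_ne_zero_of_sum_ne_zero (Nat.one_le_iff_ne_zero.1 hβ)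
  have h1 : β = (β - Pi.single i 1) + Pi.single i 1 := by
    refine (tsub_add_cancel_of_le fun j => ?_).symm
    rcases eq_or_ne j i with rfl | hj
    · simpa using Nat.one_le_iff_ne_zero.2 hi
    · simp [hj]
  have h2 : pd i (fun _ : Sp d => a) = fun _ => 0 := by
    funext x; simp [pd]
  rw [h1, ← multiPd_pd contDiff_const, h2, multiPd_zero]

theorem iteratedFDeriv_clm_of_two_le {E F : Type} [NormedAddCommGroup E] [NormedSpace ℝ E]
    [NormedAddCommGroup F] [NormedSpace ℝ F] (L : E →L[ℝ] F) {k : ℕ} (hk : 2 ≤ k) (x : E) :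
    iteratedFDeriv ℝ k L x = 0 := by
  obtain ⟨k, rfl⟩ := Nat.exists_eq_add_of_le' hk
  rw [← norm_eq_zero, ← norm_iteratedFDeriv_fderiv]
  have h : fderiv ℝ L = fun _ => L := funext fun x => L.fderiv
  rw [h, iteratedFDeriv_const_of_ne (Nat.succ_ne_zero k)]
  simp

/-- The map `(y, w) ↦ y` is independent of `w` and linear in `y`. This singles out the derivatives
of the position that vanish at time `0`. -/
theorem mixedPd_initial_position {α β : MIdx d} (h : 1 ≤ α.order ∨ 2 ≤ β.order) (y w : Sp d) :
    mixedPd β α (fun y _ => y) y w = 0 := by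
  by_cases hα : 1 ≤ α.order
  · unfold mixedPd
    simp only [multiPd_const hα]
    rw [multiPd_zero]
  · obtain ⟨v, -, hv⟩ := exists_mixedPd_eq_iteratedFDeriv (F := Sp d) β α
    rw [hv _ contDiff_fst]
    have := iteratedFDeriv_clm_of_two_le (ContinuousLinearMap.fst ℝ (Sp d) (Sp d))
      (k := α.order + β.order) (by omega) (y, w)
    show iteratedFDeriv ℝ _ (ContinuousLinearMap.fst ℝ (Sp d) (Sp d)) (y, w) v = 0
    rw [this]; rfl

/-- The bound with `|t|` integrates the velocity estimate from time `0`. The constant precedes the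
condition on the orders so that it can be chosen for all pairs of multi-indices at once. -/
theorem exists_norm_mixedPd_flow_le (C : MIdx d → ℝ) (α β : MIdx d) :
    ∃ K, 0 ≤ K ∧ (1 ≤ α.order + β.order → ∀ (δ : FlowDatum d C) (t : ℝ), |t| ≤ 1 →
      ‖mixedPd β α (δ.γ t) δ.z.1 δ.z.2‖ ≤ K * δ.M ^ (α.order + β.order - 1) ∧
      ‖mixedPd β α (velocity δ.γ t) δ.z.1 δ.z.2‖ ≤ K * δ.M ^ (α.order + β.order - 1) ∧
      (1 ≤ α.order ∨ 2 ≤ β.order →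
        ‖mixedPd β α (δ.γ t) δ.z.1 δ.z.2‖ ≤ K * |t| * δ.M ^ (α.order + β.order - 1))) := by
  obtain ⟨B, hB0, hB⟩ := exists_norm_iteratedFDeriv_flow_le (α.order + β.order - 1) C
  refine ⟨B, hB0, fun hk δ t ht => ?_⟩
  rw [Nat.sub_add_cancel hk] at hB
  obtain ⟨v, hv, hmixed⟩ := exists_mixedPd_eq_iteratedFDeriv (F := Sp d) β α
  have hv' : ‖v‖ ≤ 1 := (pi_norm_le_iff_of_nonneg zero_le_one).2 hv
  have hp : ∀ s, mixedPd β α (δ.γ s) δ.z.1 δ.z.2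
      = iteratedFDeriv ℝ (α.order + β.order) (pos δ.γ s) δ.z v := fun s =>
    hmixed _ (contDiff_slice (contDiff_pos δ.smooth) s) _ _
  have hw : mixedPd β α (velocity δ.γ t) δ.z.1 δ.z.2
      = iteratedFDeriv ℝ (α.order + β.order) (vel δ.γ t) δ.z v :=
    hmixed _ (contDiff_slice (contDiff_vel δ.smooth) t) _ _
  refine ⟨?_, ?_, fun hαβ => ?_⟩
  · rw [hp]
    exact (ContinuousMultilinearMap.unit_le_opNorm _ hv').trans (hB δ t ht).1
  · rw [hw]
    exact (ContinuousMultilinearMap.unit_le_opNorm _ hv').trans (hB δ t ht).2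
  · have h0 : mixedPd β α (δ.γ 0) δ.z.1 δ.z.2 = 0 := by
      have : δ.γ 0 = fun y _ => y := funext fun y => funext fun w => (δ.flow y w).2.1
      rw [this]
      exact mixedPd_initial_position hαβ _ _
    have h1 := norm_sub_le_mul_abs_of_deriv_le
      (fun s _ => hasDerivAt_iteratedFDeriv (contDiff_pos δ.smooth) (α.order + β.order) s δ.z)
      (fun s hs => (hB δ s hs).2) ht
    rw [← sub_zero (mixedPd β α (δ.γ t) δ.z.1 δ.z.2), ← h0, hp, hp]
    refine (ContinuousMultilinearMap.unit_le_opNorm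
      (iteratedFDeriv ℝ (α.order + β.order) (pos δ.γ t) δ.z
        - iteratedFDeriv ℝ (α.order + β.order) (pos δ.γ 0) δ.z) hv').trans (h1.trans_eq ?_)
    ring

/-- The partial derivatives are the restrictions of the total derivative to the factors. -/
theorem norm_fderiv_slices_le {f : Sp d × Sp d → Sp d} {y w : Sp d} {B : ℝ}
    {L : Sp d × Sp d →L[ℝ] Sp d} (hf : DifferentiableAt ℝ f (y, w))
    (h : ‖fderiv ℝ f (y, w) - L‖ ≤ B) :
    ‖fderiv ℝ (fun y' => f (y', w)) y - L.comp (ContinuousLinearMap.inl ℝ (Sp d) (Sp d))‖ ≤ B ∧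
      ‖fderiv ℝ (fun w' => f (y, w')) w - L.comp (ContinuousLinearMap.inr ℝ (Sp d) (Sp d))‖
        ≤ B := by
  have hcomp : ∀ S : Sp d →L[ℝ] Sp d × Sp d, ‖S‖ ≤ 1 →
      ‖(fderiv ℝ f (y, w)).comp S - L.comp S‖ ≤ B := fun S hS => by
    rw [← ContinuousLinearMap.sub_comp]
    refine (ContinuousLinearMap.opNorm_comp_le _ _).trans
      ((mul_le_of_le_one_right (norm_nonneg _) hS).trans h)
  constructor
  · have h1 : fderiv ℝ (fun y' => f (y', w)) y
        = (fderiv ℝ f (y, w)).comp (ContinuousLinearMap.inl ℝ (Sp d) (Sp d)) :=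
      (hf.hasFDerivAt.comp y (hasFDerivAt_prodMk_left y w)).fderiv
    rw [h1]
    exact hcomp _ (ContinuousLinearMap.norm_inl_le_one ℝ (Sp d) (Sp d))
  · have h1 : fderiv ℝ (fun w' => f (y, w')) w
        = (fderiv ℝ f (y, w)).comp (ContinuousLinearMap.inr ℝ (Sp d) (Sp d)) :=
      (hf.hasFDerivAt.comp w (hasFDerivAt_prodMk_right y w)).fderiv
    rw [h1]
    exact hcomp _ (ContinuousLinearMap.norm_inr_le_one ℝ (Sp d) (Sp d))

end MixedBounds

end GeodFlow

theorem theorem3p1 (d : ℕ) :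
    -- The smallness threshold and the constant implicit in `≲` depend only on `d`.
    ∃ c₀ : ℝ, 0 < c₀ ∧ ∃ A : ℝ,
    -- The constants `K α β` depend only on `d` and on the constants `C β`.
    ∀ C : GeodFlow.MIdx d → ℝ, ∃ K : GeodFlow.MIdx d → GeodFlow.MIdx d → ℝ,
    ∀ c : ℝ, 0 < c → c ≤ c₀ → ∀ M : ℝ, 1 ≤ M →
    ∀ g : GeodFlow.MetricField d, GeodFlow.IsRiemannianMetric g →
      GeodFlow.SmallNorms g c → GeodFlow.DerivBounds g C M →
      (∃ γ, GeodFlow.IsGeodesicFlow g γ) ∧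
      ∀ γ : ℝ → GeodFlow.Sp d → GeodFlow.Sp d → GeodFlow.Sp d, GeodFlow.IsGeodesicFlow g γ →
        ContDiff ℝ ∞
          (fun p : ℝ × GeodFlow.Sp d × GeodFlow.Sp d => γ p.1 p.2.1 p.2.2) ∧
        ∀ (t : ℝ) (y w : GeodFlow.Sp d), |t| ≤ 1 → 1 / 2 ≤ ‖w‖ → ‖w‖ ≤ 2 →
          (‖fderiv ℝ (fun y' => γ t y' w) y - ContinuousLinearMap.id ℝ (GeodFlow.Sp d)‖
            + ‖fderiv ℝ (fun y' => GeodFlow.velocity γ t y' w) y‖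
            + ‖fderiv ℝ (fun w' => GeodFlow.velocity γ t y w') w
                - ContinuousLinearMap.id ℝ (GeodFlow.Sp d)‖ ≤ A * c) ∧
          (‖fderiv ℝ (fun w' => γ t y w') w - t • ContinuousLinearMap.id ℝ (GeodFlow.Sp d)‖
            ≤ A * c * |t|) ∧
          (∀ α β : GeodFlow.MIdx d, 1 ≤ α.order + β.order →
            ‖GeodFlow.mixedPd β α (γ t) y w‖
              + ‖GeodFlow.mixedPd β α (GeodFlow.velocity γ t) y w‖
              ≤ K α β * M ^ (α.order + β.order - 1)) ∧
          (∀ α β : GeodFlow.MIdx d, 1 ≤ α.order ∨ 2 ≤ β.order →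
            ‖GeodFlow.mixedPd β α (γ t) y w‖
              ≤ K α β * |t| * M ^ (α.order + β.order - 1)) := by
  obtain ⟨b, hb0, hb⟩ := GeodFlow.exists_first_order_bound d
  -- The threshold is the one that makes the energy comparable to the Euclidean norm; `3 * b`
  -- accounts for the sum of three norms.
  refine ⟨1 / (2 * (d + 1)), by positivity, 3 * b, fun C => ?_⟩
  choose K hK using fun α β : GeodFlow.MIdx d => GeodFlow.exists_norm_mixedPd_flow_le C α β
  -- The factor `2` is for the sum of the position and velocity bounds.
  refine ⟨fun α β => 2 * K α β, fun c hc hcd M hM g hg hsn hC =>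
    ⟨GeodFlow.exists_isGeodesicFlow hg hsn hc.le hcd, fun γ hγ => ?_⟩⟩
  have hs := GeodFlow.contDiff_geodesicFlow hg hsn hc.le hcd hγ
  refine ⟨hs, fun t y w ht _ hw => ?_⟩
  have hδ := hb g c γ hg hsn hc.le hcd hγ hs (y, w) hw t ht
  let δ : GeodFlow.FlowDatum d C := ⟨M, c, g, γ, (y, w), hM, hc.le, hcd, hg, hsn, hC, hγ, hs, hw⟩
  have hpos : DifferentiableAt ℝ (GeodFlow.pos γ t) (y, w) :=
    (GeodFlow.contDiff_slice (GeodFlow.contDiff_pos hs) t).differentiable (by simp) _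
  have hvel : DifferentiableAt ℝ (GeodFlow.vel γ t) (y, w) :=
    (GeodFlow.contDiff_slice (GeodFlow.contDiff_vel hs) t).differentiable (by simp) _
  let F := ContinuousLinearMap.fst ℝ (GeodFlow.Sp d) (GeodFlow.Sp d)
  let S := ContinuousLinearMap.snd ℝ (GeodFlow.Sp d) (GeodFlow.Sp d)
  have hp0 : ‖fderiv ℝ (GeodFlow.pos γ t) (y, w) - (F + t • S)‖ ≤ b * c * |t| := by
    rw [← sub_sub]; exact hδ.2
  have hp := GeodFlow.norm_fderiv_slices_le (L := F + t • S) hpos hp0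
  have hv := GeodFlow.norm_fderiv_slices_le (L := S) hvel hδ.1
  -- The flat flow `(y, w) ↦ (y + t w, w)` has the partial derivatives `I`, `t I`, `0`, `I` to be
  -- compared with.
  have e1 : (F + t • S).comp (ContinuousLinearMap.inl ℝ (GeodFlow.Sp d) (GeodFlow.Sp d))
      = ContinuousLinearMap.id ℝ (GeodFlow.Sp d) :=
    ContinuousLinearMap.ext fun x => by simp [F, S]
  have e2 : (F + t • S).comp (ContinuousLinearMap.inr ℝ (GeodFlow.Sp d) (GeodFlow.Sp d))
      = t • ContinuousLinearMap.id ℝ (GeodFlow.Sp d) :=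
    ContinuousLinearMap.ext fun x => by simp [F, S]
  have e3 : S.comp (ContinuousLinearMap.inl ℝ (GeodFlow.Sp d) (GeodFlow.Sp d)) = 0 :=
    ContinuousLinearMap.ext fun x => by simp [S]
  have e4 : S.comp (ContinuousLinearMap.inr ℝ (GeodFlow.Sp d) (GeodFlow.Sp d))
      = ContinuousLinearMap.id ℝ (GeodFlow.Sp d) :=
    ContinuousLinearMap.ext fun x => by simp [S]
  rw [e1, e2] at hp
  rw [e3, e4, sub_zero] at hv
  refine ⟨?_, ?_, fun α β hαβ => ?_, fun α β hαβ => ?_⟩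
  · have h1 : ‖fderiv ℝ (fun y' => γ t y' w) y - ContinuousLinearMap.id ℝ (GeodFlow.Sp d)‖
        ≤ b * c * |t| := hp.1
    have h2 : ‖fderiv ℝ (fun y' => GeodFlow.velocity γ t y' w) y‖ ≤ b * c := hv.1
    have h3 : ‖fderiv ℝ (fun w' => GeodFlow.velocity γ t y w') w
        - ContinuousLinearMap.id ℝ (GeodFlow.Sp d)‖ ≤ b * c := hv.2
    have h4 : b * c * |t| ≤ b * c := mul_le_of_le_one_right (by positivity) ht
    linarith
  · have h1 : ‖fderiv ℝ (fun w' => γ t y w') w - t • ContinuousLinearMap.id ℝ (GeodFlow.Sp d)‖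
        ≤ b * c * |t| := hp.2
    have h2 : 0 ≤ b * c * |t| := by positivity
    linarith
  · obtain ⟨h1, h2, -⟩ := (hK α β).2 hαβ δ t ht
    dsimp only [δ] at h1 h2
    linarith
  · obtain ⟨-, -, h1⟩ := (hK α β).2 (by omega) δ t ht
    refine (h1 hαβ).trans ?_
    have h2 : 0 ≤ K α β * |t| * M ^ (α.order + β.order - 1) :=
      mul_nonneg (mul_nonneg (hK α β).1 (abs_nonneg t)) (pow_nonneg (zero_le_one.trans hM) _)
    dsimp only [δ]
    linarith
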